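/- Let $(M,g)$ be a connected smooth Riemannian manifold with Levi-Civita connection $\nabla^g$, and let $\tau$ be a smooth $3$-form on $M$. Define $\tau_XY$ by $g(\tau_XY,Z)=\tau(X,Y,Z)$ and suppose that $(M,g,\tau)$ is a geometry with parallel skew torsion, i.e. $\nabla^\tau\tau=0$ for the connection $\nabla^\tau_XY:=\nabla^g_XY+\tau_XY$. For $x\in M$ let $\mathfrak{stab}(\tau)_x\subseteq\mathfrak{so}(T_xM)$ be the Lie algebra of all skew-symmetric endomorphisms $A$ of $T_xM$ with $A_*\tau=0$. Decompose $T_xM$ orthogonally into irreducible $\mathfrak{stab}(\tau)_x$-modules; let $\mathcal H_x$ be the sum of those summands $W$ with $\mathfrak{so}(W)\cap\mathfrak{stab}(\tau)_x\neq0$, and $\mathcal V_x$ the sum of the others (the canonical $\mathfrak{stab}(\tau)$-splitting $TM=\mathcal H\oplus\mathcal V$). Assume that 1. $\mathfrak{stab}(\tau)$ acts almost irreducibly on the tangent spaces: for every $x$, $\dim\mathcal V_x=1$ and $\mathcal H_x$ is an irreducible $\mathfrak{stab}(\tau)_x$-module; 2. $(M,g,\tau)$ has no local one-dimensional factor: there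 is no decomposition $TM=T_1\oplus T_2$ into nontrivial, orthogonal, smooth, $\nabla^\tau$-parallel distributions with $\operatorname{rank}T_1=1$ and $\tau=\tau_1+\tau_2$, $\tau_i\in\Lambda^3T_i$. Then there is a constant $c>0$ such that the rescaled geometry $(M,g',\tau')$ with $g'=c^2g$, $\tau'=c^2\tau$ (which has the same connection $\nabla^{\tau}$) is locally Sasakian with $\tau'=\xi\wedge\Phi$. That is, every point of $M$ has an open neighbourhood $U$ carrying a smooth vector field $\xi$ and a smooth endomorphism field $\Phi$ such that, on $U$ and with respect to $g'$, $\xi$ is a Killing field of unit length, $\Phi$ is skew-symmetric, $$d\xi=2\Phi,\qquad \Phi^2=-\mathrm{Id}+\xi\otimes\xi,\qquad \nabla^{g'}_X\Phi=-X\wedge\xi\quad\text{for all }X,$$ and $\tau'=\xi\wedge\Phi$. Here vectors are identified with $1$-forms by $g'$, $\Phi$ is identified with the $2$-form $\Phi(X,Y)=g'(\Phi X,Y)$, and $(X\wedge Y)Z=g'(X,Z)Y-g'(Y,Z)X$. If moreover the line bundle $\mathcal V$ is trivial (spanned by a continuous nowhere vanishing vector field), such a pair $(\xi,\Phi)$ exists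 globally on $M$, with $U=M$. -/

import Mathlib

open scoped Manifold ContDiff Bundle Topology

noncomputable section

namespace SkewTorsion

/-! ## Invariant subspaces and the canonical splitting of a Lie algebra of endomorphisms -/

section Algebra

variable {V : Type*} [AddCommGroup V] [Module ℝ V]

/-- `W` is invariant under every element of `𝔤`. -/
def IsInvariant (𝔤 : Submodule ℝ (Module.End ℝ V)) (W : Submodule ℝ V) : Prop :=
  ∀ A ∈ 𝔤, ∀ w ∈ W, A w ∈ W

/-- `W` is an irreducible `𝔤`-submodule (in particular, nonzero). -/
def IsIrreducibleSub (𝔤 : Submodule ℝ (Module.End ℝ V)) (W : Submodule ℝ V) : Prop :=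
  IsInvariant 𝔤 W ∧ W ≠ ⊥ ∧ ∀ W' : Submodule ℝ V, W' ≤ W → IsInvariant 𝔤 W' → W' = ⊥ ∨ W' = W

/-- `𝔰𝔬(W) ∩ 𝔤 ≠ 0` for `𝔤 ⊆ 𝔰𝔬(V, b)`: some nonzero element of `𝔤` maps into `W` and vanishes
on the `b`-orthogonal complement of `W`. -/
def MeetsSo (b : V → V → ℝ) (𝔤 : Submodule ℝ (Module.End ℝ V)) (W : Submodule ℝ V) : Prop :=
  ∃ A ∈ 𝔤, A ≠ 0 ∧ (∀ v, A v ∈ W) ∧ ∀ v, (∀ w ∈ W, b v w = 0) → A v = 0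

/-- `V = Hor ⊕ Ver` is the canonical `𝔤`-splitting of the Euclidean space `(V, b)`: for an
orthogonal decomposition of `V` into irreducible `𝔤`-modules, `Hor` is the sum of the
summands `W` with `𝔰𝔬(W) ∩ 𝔤 ≠ 0`, and `Ver` is the sum of the others. -/
def IsCanonicalSplitting (b : V → V → ℝ) (𝔤 : Submodule ℝ (Module.End ℝ V))
    (Hor Ver : Submodule ℝ V) : Prop :=
  ∃ (k : ℕ) (W : Fin k → Submodule ℝ V),
    (∀ i, IsIrreducibleSub 𝔤 (W i)) ∧
    (∀ i j, i ≠ j → ∀ v ∈ W i, ∀ w ∈ W j, b v w = 0) ∧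
    (⨆ i, W i) = ⊤ ∧
    Hor = (⨆ i, ⨆ (_ : MeetsSo b 𝔤 (W i)), W i) ∧
    Ver = ⨆ i, ⨆ (_ : ¬ MeetsSo b 𝔤 (W i)), W i

/-- `𝔤` acts almost irreducibly: in the canonical `𝔤`-splitting, the vertical part is
one-dimensional and the horizontal part is irreducible. -/
def IsAlmostIrreducible (b : V → V → ℝ) (𝔤 : Submodule ℝ (Module.End ℝ V)) : Prop :=
  ∃ Hor Ver : Submodule ℝ V, IsCanonicalSplitting b 𝔤 Hor Ver ∧
    Module.finrank ℝ Ver = 1 ∧ IsIrreducibleSub 𝔤 Hor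

end Algebra

/-! ## Riemannian metrics, vector fields and the Levi-Civita connection -/

variable {n : ℕ} {M : Type*} [TopologicalSpace M] [ChartedSpace (EuclideanSpace ℝ (Fin n)) M]

variable (n M) in
/-- Vector fields without any regularity. -/
abbrev VField := ∀ x : M, TangentSpace (𝓡 n) x

variable (n M) in
/-- Fields of trilinear forms on the tangent spaces. -/
abbrev TriForm := ∀ x : M, TangentSpace (𝓡 n) x →ₗ[ℝ] TangentSpace (𝓡 n) x →ₗ[ℝ]
  TangentSpace (𝓡 n) x →ₗ[ℝ] ℝ

variable (n M) in
/-- Fields of endomorphisms of the tangent spaces. -/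
abbrev EndField := ∀ x : M, TangentSpace (𝓡 n) x →ₗ[ℝ] TangentSpace (𝓡 n) x

variable (n M) in
/-- Fields of subspaces of the tangent spaces. -/
abbrev Distribution := ∀ x : M, Submodule ℝ (TangentSpace (𝓡 n) x)

/-- Derivative of the function `f` at `x` in direction `v`. -/
def dirDeriv (f : M → ℝ) (x : M) (v : TangentSpace (𝓡 n) x) : ℝ :=
  mvfderiv (𝓡 n) f x v

variable [IsManifold (𝓡 n) ∞ M]

variable (n M) in
/-- Smooth Riemannian metrics on `M`. -/
abbrev Metric := Bundle.ContMDiffRiemannianMetric (𝓡 n) ∞ (EuclideanSpace ℝ (Fin n))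
  (fun x : M => TangentSpace (𝓡 n) x)

set_option synthInstance.maxHeartbeats 400000 in
/-- The metric `c² g`, for `c ≠ 0`. -/
def rescale (g : Metric n M) (c : ℝ) (hc : c ≠ 0) : Metric n M where
  inner x := c ^ 2 • g.inner x
  symm x v w := by simp [g.symm x v w]
  pos x v hv := by
    have := g.pos x v hv
    have hc2 : 0 < c ^ 2 := by positivity
    simpa using mul_pos hc2 this
  isVonNBounded x := by
    have h := (g.isVonNBounded x).image
      (c⁻¹ • ContinuousLinearMap.id ℝ (TangentSpace (𝓡 n) x))
    refine h.subset ?_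
    intro v hv
    refine ⟨c • v, ?_, ?_⟩
    · have hv' : c ^ 2 * g.inner x v v < 1 := hv
      change g.inner x (c • v) (c • v) < 1
      rw [map_smul, map_smul]
      change c * (c * g.inner x v v) < 1
      linarith [show c * (c * g.inner x v v) = c ^ 2 * g.inner x v v by ring]
    · change c⁻¹ • (c • v) = v
      rw [smul_smul, inv_mul_cancel₀ hc, one_smul]
  contMDiff := ContMDiff.const_smul_section g.contMDiff

/-- `X` is a smooth vector field on the open set `U`. -/
def SmoothOn (X : VField n M) (U : Set M) : Prop :=
  ContMDiffOn (𝓡 n) (𝓡 n).tangent ∞ (fun x => (⟨x, X x⟩ : TangentBundle (𝓡 n) M)) U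

/-- The tangent vector `w` with `g(w, z) = α(z)` for all `z`, for a linear form `α`. -/
def sharp (g : Metric n M) (x : M) (α : TangentSpace (𝓡 n) x → ℝ) : TangentSpace (𝓡 n) x :=
  Classical.epsilon fun w => ∀ z, g.inner x w z = α z

/-- The right-hand side of the Koszul formula for `2 g(∇_X Y, Z)`. -/
def koszul (g : Metric n M) (X Y Z : VField n M) (x : M) : ℝ :=
  dirDeriv (fun y => g.inner y (Y y) (Z y)) x (X x)
    + dirDeriv (fun y => g.inner y (X y) (Z y)) x (Y x)
    - dirDeriv (fun y => g.inner y (X y) (Y y)) x (Z x)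
    + g.inner x (VectorField.mlieBracket (𝓡 n) X Y x) (Z x)
    - g.inner x (VectorField.mlieBracket (𝓡 n) X Z x) (Y x)
    - g.inner x (VectorField.mlieBracket (𝓡 n) Y Z x) (X x)

/-- A vector field which extends the tangent vector `v` and is smooth near its base point. -/
abbrev ext {x : M} (v : TangentSpace (𝓡 n) x) : VField n M :=
  FiberBundle.extend (EuclideanSpace ℝ (Fin n)) v

/-- The Levi-Civita connection: `leviCivita g Y x v` is `(∇^g_v Y)(x)`, for `Y` differentiable
at `x`, as given by the Koszul formula. The right-hand side of that formula is tensorial in `X`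
and `Z`, so the choice of the extensions of `v` and `z` does not matter. -/
def leviCivita (g : Metric n M) (Y : VField n M) (x : M) (v : TangentSpace (𝓡 n) x) :
    TangentSpace (𝓡 n) x :=
  sharp g x fun z => koszul g (ext v) Y (ext z) x / 2

/-! ## Geometries with parallel skew torsion -/

/-- `τ` is a smooth `3`-form. -/
structure IsThreeForm (τ : TriForm n M) : Prop where
  alt_left : ∀ x u w, τ x u u w = 0
  alt_right : ∀ x u w, τ x u w w = 0
  smooth : ∀ (U : Set M) (X Y Z : VField n M), IsOpen U → SmoothOn X U → SmoothOn Y U →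
    SmoothOn Z U → ContMDiffOn (𝓡 n) 𝓘(ℝ, ℝ) ∞ (fun x => τ x (X x) (Y x) (Z x)) U

/-- The connection `∇^τ = ∇^g + τ`, that is `∇^τ_v Y = ∇^g_v Y + τ_v Y` with
`g(τ_v w, z) = τ(v, w, z)`. -/
def connection (g : Metric n M) (τ : TriForm n M) (Y : VField n M) (x : M)
    (v : TangentSpace (𝓡 n) x) : TangentSpace (𝓡 n) x :=
  leviCivita g Y x v + sharp g x (τ x v (Y x))

/-- `(M, g, τ)` is a geometry with parallel skew torsion: `τ` is a `3`-form and `∇^τ τ = 0`. -/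
structure IsParallelSkewTorsion (g : Metric n M) (τ : TriForm n M) : Prop where
  threeForm : IsThreeForm τ
  parallel : ∀ (U : Set M) (X Y Z : VField n M), IsOpen U → SmoothOn X U → SmoothOn Y U →
    SmoothOn Z U → ∀ x ∈ U, ∀ v : TangentSpace (𝓡 n) x,
      dirDeriv (fun y => τ y (X y) (Y y) (Z y)) x v
        - τ x (connection g τ X x v) (Y x) (Z x)
        - τ x (X x) (connection g τ Y x v) (Z x)
        - τ x (X x) (Y x) (connection g τ Z x v) = 0

/-- The stabilizer algebra of `τ` at `x`: the skew-symmetric endomorphisms `A` of the tangent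
space with `A_* τ = 0`. -/
def stab (g : Metric n M) (τ : TriForm n M) (x : M) :
    Submodule ℝ (Module.End ℝ (TangentSpace (𝓡 n) x)) where
  carrier := {A | (∀ v w, g.inner x (A v) w + g.inner x v (A w) = 0) ∧
    ∀ u v w, τ x (A u) v w + τ x u (A v) w + τ x u v (A w) = 0}
  add_mem' := by
    rintro A B ⟨hA, hA'⟩ ⟨hB, hB'⟩
    refine ⟨fun v w => ?_, fun u v w => ?_⟩
    · simp only [LinearMap.add_apply, map_add, add_apply]
      linarith [hA v w, hB v w]
    · simp only [LinearMap.add_apply, map_add]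
      linarith [hA' u v w, hB' u v w]
  zero_mem' := by simp
  smul_mem' := by
    rintro c A ⟨hA, hA'⟩
    refine ⟨fun v w => ?_, fun u v w => ?_⟩
    · simp only [LinearMap.smul_apply, map_smul, smul_apply, smul_eq_mul]
      linear_combination c * hA v w
    · simp only [LinearMap.smul_apply, map_smul, smul_eq_mul]
      linear_combination c * hA' u v w

/-! ## Decompositions -/

/-- `T` is a smooth distribution: it is locally spanned by a smooth frame. -/
def IsSmoothDistribution (T : Distribution n M) : Prop :=
  ∀ p : M, ∃ U : Set M, IsOpen U ∧ p ∈ U ∧ ∃ (k : ℕ) (e : Fin k → VField n M),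
    (∀ i, SmoothOn (e i) U) ∧ ∀ x ∈ U, LinearIndependent ℝ (fun i => e i x) ∧
      T x = Submodule.span ℝ (Set.range fun i => e i x)

/-- `T` is `∇^τ`-parallel. -/
def IsParallelDistribution (g : Metric n M) (τ : TriForm n M) (T : Distribution n M) : Prop :=
  ∀ (U : Set M) (Y : VField n M), IsOpen U → SmoothOn Y U → (∀ x ∈ U, Y x ∈ T x) →
    ∀ x ∈ U, ∀ v : TangentSpace (𝓡 n) x, connection g τ Y x v ∈ T x

/-- `TM = T₁ ⊕ T₂` is a decomposition of `(M, g, τ)`: `T₁`, `T₂` are nontrivial, orthogonal,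
`∇^τ`-parallel distributions and `τ = τ₁ + τ₂` with `τᵢ ∈ Λ³Tᵢ`, that is, all mixed components
of `τ` vanish. -/
structure IsDecomposition (g : Metric n M) (τ : TriForm n M) (T₁ T₂ : Distribution n M) :
    Prop where
  smooth₁ : IsSmoothDistribution T₁
  smooth₂ : IsSmoothDistribution T₂
  nontrivial₁ : ∀ x, T₁ x ≠ ⊥
  nontrivial₂ : ∀ x, T₂ x ≠ ⊥
  sup_eq : ∀ x, T₁ x ⊔ T₂ x = ⊤
  orthogonal : ∀ x, ∀ v ∈ T₁ x, ∀ w ∈ T₂ x, g.inner x v w = 0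
  parallel₁ : IsParallelDistribution g τ T₁
  parallel₂ : IsParallelDistribution g τ T₂
  torsion : ∀ x, ∀ v ∈ T₁ x, ∀ w ∈ T₂ x, ∀ z, τ x v w z = 0

/-- `(M, g, τ)` locally splits off a one-dimensional factor: it is decomposable with a
one-dimensional summand. -/
def HasLocalOneDimFactor (g : Metric n M) (τ : TriForm n M) : Prop :=
  ∃ T₁ T₂ : Distribution n M, IsDecomposition g τ T₁ T₂ ∧
    ∀ x, Module.finrank ℝ (T₁ x) = 1

/-! ## Sasaki structures -/

/-- `(g, ξ, Φ)` is a Sasaki structure on the open set `U`. -/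
structure IsSasakiOn (g : Metric n M) (U : Set M) (ξ : VField n M) (Φ : EndField n M) :
    Prop where
  smooth_xi : SmoothOn ξ U
  smooth_phi : ∀ (W : Set M) (Y : VField n M), IsOpen W → W ⊆ U → SmoothOn Y W →
    SmoothOn (fun x => Φ x (Y x)) W
  unit : ∀ x ∈ U, g.inner x (ξ x) (ξ x) = 1
  /-- `ξ` is a Killing field: `(L_ξ g)(X, Y) = 0`. -/
  killing : ∀ (W : Set M) (X Y : VField n M), IsOpen W → W ⊆ U → SmoothOn X W → SmoothOn Y W →
    ∀ x ∈ W, dirDeriv (fun y => g.inner y (X y) (Y y)) x (ξ x)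
      - g.inner x (VectorField.mlieBracket (𝓡 n) ξ X x) (Y x)
      - g.inner x (X x) (VectorField.mlieBracket (𝓡 n) ξ Y x) = 0
  /-- `Φ` is skew-symmetric. -/
  skew : ∀ x ∈ U, ∀ v w, g.inner x (Φ x v) w = - g.inner x v (Φ x w)
  /-- `dξ = 2Φ`, where `ξ` is regarded as a `1`-form and `Φ` as the `2`-form `g(Φ X, Y)`. -/
  d_xi : ∀ (W : Set M) (X Y : VField n M), IsOpen W → W ⊆ U → SmoothOn X W → SmoothOn Y W →
    ∀ x ∈ W, dirDeriv (fun y => g.inner y (ξ y) (Y y)) x (X x)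
      - dirDeriv (fun y => g.inner y (ξ y) (X y)) x (Y x)
      - g.inner x (ξ x) (VectorField.mlieBracket (𝓡 n) X Y x)
      = 2 * g.inner x (Φ x (X x)) (Y x)
  /-- `Φ² = - Id + ξ ⊗ ξ`. -/
  phi_sq : ∀ x ∈ U, ∀ v, Φ x (Φ x v) = - v + g.inner x (ξ x) v • ξ x
  /-- `∇^g_v Φ = - v ∧ ξ`, where `(v ∧ ξ) Y = g(v, Y) ξ - g(ξ, Y) v`. -/
  nabla_phi : ∀ (W : Set M) (Y : VField n M), IsOpen W → W ⊆ U → SmoothOn Y W →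
    ∀ x ∈ W, ∀ v : TangentSpace (𝓡 n) x,
      leviCivita g (fun y => Φ y (Y y)) x v - Φ x (leviCivita g Y x v)
        = - (g.inner x v (Y x) • ξ x - g.inner x (ξ x) (Y x) • v)

/-- The value of the `3`-form `ξ ∧ Φ` at `x`, where `ξ` and `Φ` are regarded as a `1`-form and a
`2`-form by means of `g`. -/
def xiWedgePhi (g : Metric n M) (ξ : VField n M) (Φ : EndField n M) (x : M)
    (u v w : TangentSpace (𝓡 n) x) : ℝ :=
  g.inner x (ξ x) u * g.inner x (Φ x v) w + g.inner x (ξ x) v * g.inner x (Φ x w) u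
    + g.inner x (ξ x) w * g.inner x (Φ x u) v

/-- On the open set `U`, the geometry `(g, τ)` is Sasakian: there is a Sasaki structure
`(g, ξ, Φ)` on `U` with `τ = ξ ∧ Φ`. -/
def IsSasakianOn (g : Metric n M) (τ : TriForm n M) (U : Set M) : Prop :=
  ∃ (ξ : VField n M) (Φ : EndField n M), IsSasakiOn g U ξ Φ ∧
    ∀ x ∈ U, ∀ u v w : TangentSpace (𝓡 n) x, τ x u v w = xiWedgePhi g ξ Φ x u v w

/-- The vertical line bundle of the canonical `𝔰𝔱𝔞𝔟(τ)`-splitting is globally trivial: it is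
spanned by a continuous, nowhere vanishing vector field. -/
def VerticalIsTrivial (g : Metric n M) (τ : TriForm n M) : Prop :=
  ∃ Z : VField n M, Continuous (fun x => (⟨x, Z x⟩ : TangentBundle (𝓡 n) M)) ∧
    ∀ x, Z x ≠ 0 ∧ ∃ Hor : Submodule ℝ (TangentSpace (𝓡 n) x),
      IsCanonicalSplitting (fun v w => g.inner x v w) (stab g τ x) Hor
        (Submodule.span ℝ {Z x})

end SkewTorsion

end

noncomputable section

/-! Write `∇` for the connection `∇^g + τ`. It is metric, has torsion `2τ`, and `∇τ = 0`. Hence its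
curvature `R` takes values in the stabilizer `𝔤` of `τ`, and the Bianchi identity contains only
terms quadratic in `τ`.

At a point, let `ξ` be a unit vertical vector. A skew endomorphism kills an invariant line, so `𝔤 ξ
= 0` and `R(u,v) ξ = 0`. The quadratic torsion term in the Bianchi identity is alternating in four
arguments, so `R` has pair symmetry (`curvature_pair_symm`) and also `R(ξ,u) = 0`. The Bianchi
identity for `ξ, u, v` then says that `J = τ_ξ` is itself a derivation of `τ` (`isStab_t`). By
Schur's lemma `J² = -μ` on `ξ^⊥`. Either `μ = 0` and `J = 0`, or `μ > 0`; in the latter case the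
derivation property forces `τ` to vanish on `ξ^⊥`, so that `τ = ξ ∧ J`
(`IsVertical.t_eq_zero_or_isContact`).

To pass from points to the manifold, use the Casimir operator `S` with `g(S u, v) = -tr(τ_u τ_v)`.
It is parallel, so the traces of its powers are locally constant. In the first case its eigenvalues
are `0` on `ξ` and some `β > 0` on `ξ^⊥`; in the second they are `(n-1)μ` and `2μ`, with `n ≠ 3`
(`IsVertical.casimir_dichotomy`). So `ξ` always spans a simple eigenspace of `S`. The traces of `S`
and `S³` tell the two cases apart and determine the eigenvalues, so on a connected `M` one case
holds everywhere with the same constants (`exists_forall_isVerticalAt`).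

In the first case the two eigenspaces of `S` split off a one-dimensional factor, which is excluded
(`hasLocalOneDimFactor`). In the second, a unit section `ξ` of the eigenline is parallel, and after
scaling by `c = √μ` the Sasaki identities follow from `∇ξ = 0`, `∇τ = 0` and the algebra of `ξ ∧ J`
(`isSasakianOn_of_isContact`). -/

namespace SkewTorsion

set_option linter.unusedSectionVars false

/-! ### Connection, curvature and Casimir operator on an open subset of a vector space. -/

section LocalCalculus

set_option synthInstance.maxHeartbeats 200000

section MultilinearInstances

variable {E F : Type*} [NormedAddCommGroup E] [NormedSpace ℝ E] [NormedAddCommGroup F]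
  [NormedSpace ℝ F]

instance : NormedAddCommGroup (E →L[ℝ] E →L[ℝ] F) := ContinuousLinearMap.toNormedAddCommGroup
instance : NormedSpace ℝ (E →L[ℝ] E →L[ℝ] F) := ContinuousLinearMap.toNormedSpace
instance : NormedAddCommGroup (E →L[ℝ] E →L[ℝ] E →L[ℝ] F) :=
  ContinuousLinearMap.toNormedAddCommGroup
instance : NormedSpace ℝ (E →L[ℝ] E →L[ℝ] E →L[ℝ] F) := ContinuousLinearMap.toNormedSpace
instance : NormedAddCommGroup (E →L[ℝ] E →L[ℝ] E →L[ℝ] E →L[ℝ] F) :=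
  ContinuousLinearMap.toNormedAddCommGroup
instance : NormedSpace ℝ (E →L[ℝ] E →L[ℝ] E →L[ℝ] E →L[ℝ] F) :=
  ContinuousLinearMap.toNormedSpace

end MultilinearInstances

/-! ## Metrics and three-forms on an open subset of a vector space -/

/-- A Riemannian metric and a `3`-form on an open subset of a vector space. -/
structure LocalGeometry (E : Type*) [NormedAddCommGroup E] [NormedSpace ℝ E] where
  domain : Set E
  isOpen_domain : IsOpen domain
  metric : E → E →L[ℝ] E →L[ℝ] ℝ
  form : E → E →L[ℝ] E →L[ℝ] E →L[ℝ] ℝ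
  contDiffOn_metric : ContDiffOn ℝ ∞ metric domain
  contDiffOn_form : ContDiffOn ℝ ∞ form domain
  metric_symm : ∀ z ∈ domain, ∀ a b, metric z a b = metric z b a
  metric_pos : ∀ z ∈ domain, ∀ a, a ≠ 0 → 0 < metric z a a
  form_alt_left : ∀ z ∈ domain, ∀ a b, form z a a b = 0
  form_alt_right : ∀ z ∈ domain, ∀ a b, form z a b b = 0

namespace LocalGeometry

variable {E : Type*} [NormedAddCommGroup E] [NormedSpace ℝ E] [FiniteDimensional ℝ E]
  (L : LocalGeometry E) {z : E}

lemma contDiffAt_of_domain {F : Type*} [NormedAddCommGroup F] [NormedSpace ℝ F] {f : E → F}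
    (hf : ContDiffOn ℝ ∞ f L.domain) (hz : z ∈ L.domain) : ContDiffAt ℝ ∞ f z :=
  hf.contDiffAt (L.isOpen_domain.mem_nhds hz)

lemma differentiableAt_of_domain {F : Type*} [NormedAddCommGroup F] [NormedSpace ℝ F] {f : E → F}
    (hf : ContDiffOn ℝ ∞ f L.domain) (hz : z ∈ L.domain) : DifferentiableAt ℝ f z :=
  (L.contDiffAt_of_domain hf hz).differentiableAt (by simp)

lemma contDiffOn_fderiv {F : Type*} [NormedAddCommGroup F] [NormedSpace ℝ F] {f : E → F}
    (hf : ContDiffOn ℝ ∞ f L.domain) : ContDiffOn ℝ ∞ (fderiv ℝ f) L.domain :=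
  hf.fderiv_of_isOpen L.isOpen_domain (by simp)

lemma form_swap_left (hz : z ∈ L.domain) (a b c : E) : L.form z a b c = - L.form z b a c := by
  have h := L.form_alt_left z hz (a + b) c
  simp only [map_add, add_apply, L.form_alt_left z hz] at h
  linarith

lemma form_swap_right (hz : z ∈ L.domain) (a b c : E) : L.form z a b c = - L.form z a c b := by
  have h := L.form_alt_right z hz a (b + c)
  simp only [map_add, add_apply, L.form_alt_right z hz] at h
  linarith

lemma isInvertible_metric (hz : z ∈ L.domain) : (L.metric z).IsInvertible := by
  have hinj : Function.Injective (L.metric z : E →ₗ[ℝ] (E →L[ℝ] ℝ)) := by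
    rw [injective_iff_map_eq_zero]
    intro a ha
    by_contra h
    have := L.metric_pos z hz a h
    have h0 : L.metric z a = 0 := ha
    simp [h0] at this
  have hfin : Module.finrank ℝ E = Module.finrank ℝ (E →L[ℝ] ℝ) := by
    rw [← Subspace.dual_finrank_eq (K := ℝ) (V := E)]
    exact (LinearMap.toContinuousLinearMap (𝕜 := ℝ) (E := E) (F' := ℝ)).finrank_eq
  refine ⟨(LinearEquiv.ofInjectiveOfFinrankEq _ hinj hfin).toContinuousLinearEquiv, ?_⟩
  ext a b
  rfl

/-- The vector dual to a linear form. -/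
def raise (z : E) : (E →L[ℝ] ℝ) →L[ℝ] E := (L.metric z).inverse

lemma metric_raise (hz : z ∈ L.domain) (α : E →L[ℝ] ℝ) (c : E) :
    L.metric z (L.raise z α) c = α c := by
  rw [raise, (L.isInvertible_metric hz).self_apply_inverse]

lemma metric_ext (hz : z ∈ L.domain) {a b : E} (h : ∀ c, L.metric z a c = L.metric z b c) :
    a = b := by
  by_contra hab
  have h1 := L.metric_pos z hz (a - b) (sub_ne_zero.mpr hab)
  have h2 : L.metric z (a - b) = 0 := by
    ext c
    rw [map_sub, sub_apply, h, sub_self]; rfl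
  rw [h2] at h1
  exact lt_irrefl _ h1

lemma contDiffOn_raise : ContDiffOn ℝ ∞ L.raise L.domain := by
  intro z hz
  obtain ⟨e, he⟩ := L.isInvertible_metric hz
  have h1 : ContDiffAt ℝ ∞ ContinuousLinearMap.inverse (L.metric z) := by
    rw [← he]; exact contDiffAt_map_inverse e
  exact (h1.comp z (L.contDiffAt_of_domain L.contDiffOn_metric hz)).contDiffWithinAt

/-- The `(2,1)`-tensor dual to the `3`-form. -/
def tor (z : E) : E →L[ℝ] E →L[ℝ] E :=
  (ContinuousLinearMap.compL ℝ E (E →L[ℝ] ℝ) E (L.raise z)) ∘L L.form z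

lemma tor_apply (a b : E) : L.tor z a b = L.raise z (L.form z a b) := rfl

lemma metric_tor (hz : z ∈ L.domain) (a b c : E) :
    L.metric z (L.tor z a b) c = L.form z a b c := by
  rw [tor_apply, L.metric_raise hz]

/-- The Christoffel symbols of the first kind. -/
def koszulForm (z : E) : E →L[ℝ] E →L[ℝ] E →L[ℝ] ℝ :=
  (1 / 2 : ℝ) • (fderiv ℝ L.metric z + (fderiv ℝ L.metric z).flip
    - ((ContinuousLinearMap.flipₗᵢ ℝ E E ℝ).toContinuousLinearEquiv :
        (E →L[ℝ] E →L[ℝ] ℝ) →L[ℝ] (E →L[ℝ] E →L[ℝ] ℝ)) ∘L (fderiv ℝ L.metric z).flip)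

lemma koszulForm_apply (a b c : E) :
    L.koszulForm z a b c = (1 / 2 : ℝ) * (fderiv ℝ L.metric z a b c + fderiv ℝ L.metric z b a c
      - fderiv ℝ L.metric z c a b) := rfl

/-- The Christoffel symbols of the connection `∇^g + τ`. -/
def chris (z : E) : E →L[ℝ] E →L[ℝ] E :=
  (ContinuousLinearMap.compL ℝ E (E →L[ℝ] ℝ) E (L.raise z)) ∘L (L.koszulForm z + L.form z)

lemma chris_apply (a b : E) :
    L.chris z a b = L.raise z (L.koszulForm z a b + L.form z a b) := rfl

lemma metric_chris (hz : z ∈ L.domain) (a b c : E) :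
    L.metric z (L.chris z a b) c = L.koszulForm z a b c + L.form z a b c := by
  rw [chris_apply, L.metric_raise hz]; rfl

lemma contDiffOn_tor : ContDiffOn ℝ ∞ L.tor L.domain := by
  simp_rw [contDiffOn_clm_apply]
  intro a b
  exact L.contDiffOn_raise.clm_apply
    ((L.contDiffOn_form.clm_apply contDiffOn_const).clm_apply contDiffOn_const)

lemma contDiffOn_koszulForm : ContDiffOn ℝ ∞ L.koszulForm L.domain := by
  simp_rw [contDiffOn_clm_apply]
  intro a b c
  have h (u v w : E) : ContDiffOn ℝ ∞ (fun z => fderiv ℝ L.metric z u v w) L.domain :=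
    (((L.contDiffOn_fderiv L.contDiffOn_metric).clm_apply contDiffOn_const).clm_apply
      contDiffOn_const).clm_apply contDiffOn_const
  simp_rw [koszulForm_apply]
  exact contDiffOn_const.mul (((h a b c).add (h b a c)).sub (h c a b))

lemma contDiffOn_chris : ContDiffOn ℝ ∞ L.chris L.domain := by
  simp_rw [contDiffOn_clm_apply]
  intro a b
  refine L.contDiffOn_raise.clm_apply (ContDiffOn.add ?_ ?_)
  · exact (L.contDiffOn_koszulForm.clm_apply contDiffOn_const).clm_apply contDiffOn_const
  · exact (L.contDiffOn_form.clm_apply contDiffOn_const).clm_apply contDiffOn_const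

lemma fderiv_metric_symm (hz : z ∈ L.domain) (u a b : E) :
    fderiv ℝ L.metric z u a b = fderiv ℝ L.metric z u b a := by
  have hd := L.differentiableAt_of_domain L.contDiffOn_metric hz
  have key (a b : E) : fderiv ℝ (fun y => L.metric y a b) z u = fderiv ℝ L.metric z u a b := by
    have h1 : HasFDerivAt (fun y => L.metric y a b)
      (((fderiv ℝ L.metric z).flip a).flip b) z := by
      have := (hd.hasFDerivAt.clm_apply (hasFDerivAt_const a z)).clm_apply (hasFDerivAt_const b z)
      convert! this using 1
      ext; simp
    rw [h1.fderiv]; rfl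
  rw [← key, ← key]
  have : (fun y => L.metric y a b) =ᶠ[𝓝 z] fun y => L.metric y b a := by
    filter_upwards [L.isOpen_domain.mem_nhds hz] with y hy using L.metric_symm y hy a b
  rw [this.fderiv_eq]

/-- The connection is metric. -/
lemma fderiv_metric (hz : z ∈ L.domain) (u a b : E) :
    fderiv ℝ L.metric z u a b = L.metric z (L.chris z u a) b + L.metric z a (L.chris z u b) := by
  -- The torsion contributes `τ(u,a,b) + τ(u,b,a) = 0`, so adding a 3-form keeps the connection
  -- metric.
  rw [L.metric_symm z hz a, L.metric_chris hz, L.metric_chris hz, koszulForm_apply,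
    koszulForm_apply, L.form_swap_right hz u b a, L.fderiv_metric_symm hz u b a]
  ring

/-- The torsion of the connection is `2τ`. -/
lemma chris_sub_chris (hz : z ∈ L.domain) (a b : E) :
    L.chris z a b - L.chris z b a = (2 : ℝ) • L.tor z a b := by
  refine L.metric_ext hz fun c => ?_
  simp only [map_sub, sub_apply, map_smul, smul_apply,
    L.metric_chris hz, L.metric_tor hz, koszulForm_apply, smul_eq_mul,
    L.form_swap_left hz b a c, L.fderiv_metric_symm hz c b a]
  ring

lemma tor_swap (hz : z ∈ L.domain) (a b : E) : L.tor z a b = - L.tor z b a := by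
  refine L.metric_ext hz fun c => ?_
  rw [map_neg, neg_apply, L.metric_tor hz, L.metric_tor hz,
    L.form_swap_left hz]

/-- The `3`-form is parallel. -/
def IsParallel : Prop := ∀ z ∈ L.domain, ∀ u a b c, fderiv ℝ L.form z u a b c =
  L.form z (L.chris z u a) b c + L.form z a (L.chris z u b) c + L.form z a b (L.chris z u c)

/-- Differentiation of a tensor with constant arguments. -/
lemma hasFDerivAt_apply_const {F H : Type*} [NormedAddCommGroup F] [NormedSpace ℝ F]
    [NormedAddCommGroup H] [NormedSpace ℝ H] {A : E → F →L[ℝ] H} {A' : E →L[ℝ] F →L[ℝ] H}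
    (hA : HasFDerivAt A A' z) (a : F) :
    HasFDerivAt (fun y => A y a) (A'.flip a) z := by
  have := hA.clm_apply (hasFDerivAt_const a z)
  convert! this using 1
  ext; simp

/-- The product rule for a bilinear map depending on a parameter. -/
lemma fderiv_apply_apply {F H : Type*} [NormedAddCommGroup F] [NormedSpace ℝ F]
    [NormedAddCommGroup H] [NormedSpace ℝ H] {A : E → F →L[ℝ] F →L[ℝ] H} {a b : E → F}
    (hA : DifferentiableAt ℝ A z) (ha : DifferentiableAt ℝ a z) (hb : DifferentiableAt ℝ b z)
    (u : E) :
    fderiv ℝ (fun y => A y (a y) (b y)) z u = fderiv ℝ A z u (a z) (b z)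
      + A z (fderiv ℝ a z u) (b z) + A z (a z) (fderiv ℝ b z u) := by
  have h := (hA.hasFDerivAt.clm_apply ha.hasFDerivAt).clm_apply hb.hasFDerivAt
  rw [h.fderiv]
  simp
  abel

lemma fderiv_apply_const {F H : Type*} [NormedAddCommGroup F] [NormedSpace ℝ F]
    [NormedAddCommGroup H] [NormedSpace ℝ H] {A : E → F →L[ℝ] H}
    (hA : DifferentiableAt ℝ A z) (a : F) (u : E) :
    fderiv ℝ (fun y => A y a) z u = fderiv ℝ A z u a := by
  rw [(hasFDerivAt_apply_const hA.hasFDerivAt a).fderiv]; rfl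

variable {L}

/-- The torsion tensor is parallel. -/
lemma IsParallel.fderiv_tor (hL : L.IsParallel) (hz : z ∈ L.domain) (u a b : E) :
    fderiv ℝ L.tor z u a b = L.tor z (L.chris z u a) b + L.tor z a (L.chris z u b)
      - L.chris z u (L.tor z a b) := by
  have hG := L.differentiableAt_of_domain L.contDiffOn_metric hz
  have ht := L.differentiableAt_of_domain L.contDiffOn_tor hz
  have hT := L.differentiableAt_of_domain L.contDiffOn_form hz
  have hta : DifferentiableAt ℝ (fun y => L.tor y a b) z :=
    (ht.clm_apply (differentiableAt_const a)).clm_apply (differentiableAt_const b)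
  refine L.metric_ext hz fun c => ?_
  -- Differentiate `g(τ_a b, c) = τ(a,b,c)`; the derivative of the metric is removed by
  -- `fderiv_metric`.
  have h1 : fderiv ℝ (fun y => L.metric y (L.tor y a b) c) z u
      = fderiv ℝ (fun y => L.form y a b c) z u := by
    have : (fun y => L.metric y (L.tor y a b) c) =ᶠ[𝓝 z] fun y => L.form y a b c := by
      filter_upwards [L.isOpen_domain.mem_nhds hz] with y hy using L.metric_tor hy a b c
    rw [this.fderiv_eq]
  rw [fderiv_apply_apply hG hta (differentiableAt_const c),
    fderiv_apply_const ((hT.clm_apply (differentiableAt_const a)).clm_apply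
      (differentiableAt_const b)),
    fderiv_apply_const (hT.clm_apply (differentiableAt_const a)), fderiv_apply_const hT,
    fderiv_apply_const (ht.clm_apply (differentiableAt_const a)), fderiv_apply_const ht,
    hL z hz, L.fderiv_metric hz, L.metric_tor hz] at h1
  simp only [map_sub, map_add, sub_apply, add_apply,
    L.metric_tor hz]
  simp at h1
  linarith

variable (L)

/-! ### Curvature -/

/-- The curvature of the connection. -/
def curv (z u v : E) : E →L[ℝ] E :=
  fderiv ℝ L.chris z u v - fderiv ℝ L.chris z v u + L.chris z u ∘L L.chris z v
    - L.chris z v ∘L L.chris z u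

lemma curv_apply (u v a : E) : L.curv z u v a =
    fderiv ℝ L.chris z u v a - fderiv ℝ L.chris z v u a + L.chris z u (L.chris z v a)
      - L.chris z v (L.chris z u a) := rfl

lemma curv_swap (u v a : E) : L.curv z u v a = - L.curv z v u a := by
  simp only [curv_apply]; abel

lemma differentiableAt_chris (hz : z ∈ L.domain) : DifferentiableAt ℝ L.chris z :=
  L.differentiableAt_of_domain L.contDiffOn_chris hz

lemma differentiableAt_chris_apply (hz : z ∈ L.domain) (u a : E) :
    DifferentiableAt ℝ (fun y => L.chris y u a) z :=
  ((L.differentiableAt_chris hz).clm_apply (differentiableAt_const u)).clm_apply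
    (differentiableAt_const a)

lemma fderiv_chris_apply (hz : z ∈ L.domain) (u a v : E) :
    fderiv ℝ (fun y => L.chris y u a) z v = fderiv ℝ L.chris z v u a := by
  rw [fderiv_apply_const ((L.differentiableAt_chris hz).clm_apply (differentiableAt_const u)),
    fderiv_apply_const (L.differentiableAt_chris hz)]

lemma isSymmSndFDerivAt_of_domain {F : Type*} [NormedAddCommGroup F] [NormedSpace ℝ F]
    {f : E → F} (hf : ContDiffOn ℝ ∞ f L.domain) (hz : z ∈ L.domain) :
    IsSymmSndFDerivAt ℝ f z :=
  (L.contDiffAt_of_domain hf hz).isSymmSndFDerivAt (by simp; exact WithTop.coe_le_coe.mpr le_top)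

lemma differentiableAt_fderiv {F : Type*} [NormedAddCommGroup F] [NormedSpace ℝ F]
    {f : E → F} (hf : ContDiffOn ℝ ∞ f L.domain) (hz : z ∈ L.domain) :
    DifferentiableAt ℝ (fderiv ℝ f) z :=
  L.differentiableAt_of_domain (L.contDiffOn_fderiv hf) hz

/-- The curvature is skew-symmetric. -/
lemma metric_curv_skew (hz : z ∈ L.domain) (u v a b : E) :
    L.metric z (L.curv z u v a) b + L.metric z a (L.curv z u v b) = 0 := by
  have hG := L.differentiableAt_of_domain L.contDiffOn_metric hz
  have hG2 := L.differentiableAt_fderiv L.contDiffOn_metric hz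
  -- Differentiate the metric condition once more. In the difference of the `(u,v)` and `(v,u)`
  -- versions the mixed terms `g(Γ_v a, Γ_u b)` cancel, and the symmetry of second derivatives
  -- leaves the curvature.
  have key (u v : E) : fderiv ℝ (fderiv ℝ L.metric) z u v a b =
      L.metric z (L.chris z u (L.chris z v a)) b + L.metric z (L.chris z v a) (L.chris z u b)
      + L.metric z (fderiv ℝ L.chris z u v a) b
      + (L.metric z (L.chris z u a) (L.chris z v b) + L.metric z a (L.chris z u (L.chris z v b))
      + L.metric z a (fderiv ℝ L.chris z u v b)) := by
    have h1 : fderiv ℝ (fun y => fderiv ℝ L.metric y v a b) z u =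
        fderiv ℝ (fun y => L.metric y (L.chris y v a) b + L.metric y a (L.chris y v b)) z u := by
      have : (fun y => fderiv ℝ L.metric y v a b) =ᶠ[𝓝 z]
          fun y => L.metric y (L.chris y v a) b + L.metric y a (L.chris y v b) := by
        filter_upwards [L.isOpen_domain.mem_nhds hz] with y hy using L.fderiv_metric hy v a b
      rw [this.fderiv_eq]
    have d1 := L.differentiableAt_chris_apply hz v a
    have d2 := L.differentiableAt_chris_apply hz v b
    rw [fderiv_fun_add
      ((hG.clm_apply d1).clm_apply (differentiableAt_const b))
      ((hG.clm_apply (differentiableAt_const a)).clm_apply d2),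
      add_apply,
      fderiv_apply_apply hG d1 (differentiableAt_const b),
      fderiv_apply_apply hG (differentiableAt_const a) d2,
      fderiv_apply_const ((hG2.clm_apply (differentiableAt_const v)).clm_apply
        (differentiableAt_const a)),
      fderiv_apply_const (hG2.clm_apply (differentiableAt_const v)),
      fderiv_apply_const hG2, L.fderiv_chris_apply hz, L.fderiv_chris_apply hz,
      L.fderiv_metric hz, L.fderiv_metric hz] at h1
    rw [h1]
    simp
  have hs := L.isSymmSndFDerivAt_of_domain L.contDiffOn_metric hz u v
  have hs' := congrArg (fun A => A a b) hs
  rw [key u v, key v u] at hs'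
  simp only [curv_apply, map_sub, map_add, sub_apply,
    add_apply]
  linarith

variable {L}

/-- The curvature annihilates the torsion. -/
lemma IsParallel.curv_tor (hL : L.IsParallel) (hz : z ∈ L.domain) (u v a b : E) :
    L.curv z u v (L.tor z a b) = L.tor z (L.curv z u v a) b + L.tor z a (L.curv z u v b) := by
  have hG := L.differentiableAt_of_domain L.contDiffOn_tor hz
  have hG2 := L.differentiableAt_fderiv L.contDiffOn_tor hz
  have hta (a b : E) : DifferentiableAt ℝ (fun y => L.tor y a b) z :=
    (hG.clm_apply (differentiableAt_const a)).clm_apply (differentiableAt_const b)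
  -- The Ricci identity for the parallel tensor `τ`: its second derivatives commute, so the
  -- curvature acts on it trivially.
  have key (u v : E) : fderiv ℝ (fderiv ℝ L.tor) z u v a b =
      fderiv ℝ L.tor z u (L.chris z v a) b + L.tor z (fderiv ℝ L.chris z u v a) b
      + (fderiv ℝ L.tor z u a (L.chris z v b) + L.tor z a (fderiv ℝ L.chris z u v b))
      - (fderiv ℝ L.chris z u v (L.tor z a b) + L.chris z v (fderiv ℝ L.tor z u a b)) := by
    have h1 : fderiv ℝ (fun y => fderiv ℝ L.tor y v a b) z u =
        fderiv ℝ (fun y => L.tor y (L.chris y v a) b + L.tor y a (L.chris y v b)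
          - L.chris y v (L.tor y a b)) z u := by
      have : (fun y => fderiv ℝ L.tor y v a b) =ᶠ[𝓝 z]
          fun y => L.tor y (L.chris y v a) b + L.tor y a (L.chris y v b)
            - L.chris y v (L.tor y a b) := by
        filter_upwards [L.isOpen_domain.mem_nhds hz] with y hy using hL.fderiv_tor hy v a b
      rw [this.fderiv_eq]
    have d1 := L.differentiableAt_chris_apply hz v a
    have d2 := L.differentiableAt_chris_apply hz v b
    have e1 := (hG.clm_apply d1).clm_apply (differentiableAt_const b)
    have e2 := (hG.clm_apply (differentiableAt_const a)).clm_apply d2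
    have e3 := ((L.differentiableAt_chris hz).clm_apply (differentiableAt_const v)).clm_apply
      (hta a b)
    rw [fderiv_fun_sub (e1.fun_add e2) e3, fderiv_fun_add e1 e2,
      sub_apply, add_apply,
      fderiv_apply_apply hG d1 (differentiableAt_const b),
      fderiv_apply_apply hG (differentiableAt_const a) d2,
      fderiv_apply_apply (L.differentiableAt_chris hz) (differentiableAt_const v) (hta a b),
      fderiv_apply_const ((hG2.clm_apply (differentiableAt_const v)).clm_apply
        (differentiableAt_const a)),
      fderiv_apply_const (hG2.clm_apply (differentiableAt_const v)),
      fderiv_apply_const hG2, L.fderiv_chris_apply hz, L.fderiv_chris_apply hz,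
      fderiv_apply_const (hG.clm_apply (differentiableAt_const a)), fderiv_apply_const hG] at h1
    rw [h1]
    simp
  have hs := L.isSymmSndFDerivAt_of_domain L.contDiffOn_tor hz u v
  have hs' := congrArg (fun A => A a b) hs
  rw [key u v, key v u] at hs'
  simp only [hL.fderiv_tor hz, map_sub, map_add] at hs'
  simp only [curv_apply, map_sub, map_add, sub_apply,
    add_apply]
  rw [← sub_eq_zero] at hs' ⊢
  rw [← neg_eq_zero, ← hs']
  abel

/-- The first Bianchi identity. -/
lemma IsParallel.bianchi (hL : L.IsParallel) (hz : z ∈ L.domain) (a b c : E) :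
    L.curv z a b c + L.curv z b c a + L.curv z c a b = (4 : ℝ) • (L.tor z (L.tor z a b) c
      + L.tor z (L.tor z b c) a + L.tor z (L.tor z c a) b) := by
  have ht := L.differentiableAt_of_domain L.contDiffOn_tor hz
  -- The derivative of the torsion relation `Γ_b c - Γ_c b = 2 τ_b c`. Since `τ` is parallel, no
  -- derivative of `τ` survives; the factor `4` in the result is the square of the factor `2` here.
  have key (a b c : E) : fderiv ℝ L.chris z a b c - fderiv ℝ L.chris z a c b
      = (2 : ℝ) • fderiv ℝ L.tor z a b c := by
    have h1 : fderiv ℝ (fun y => L.chris y b c - L.chris y c b) z a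
        = fderiv ℝ (fun y => (2 : ℝ) • L.tor y b c) z a := by
      have : (fun y => L.chris y b c - L.chris y c b) =ᶠ[𝓝 z]
          fun y => (2 : ℝ) • L.tor y b c := by
        filter_upwards [L.isOpen_domain.mem_nhds hz] with y hy using L.chris_sub_chris hy b c
      rw [this.fderiv_eq]
    have hta : DifferentiableAt ℝ (fun y => L.tor y b c) z :=
      (ht.clm_apply (differentiableAt_const b)).clm_apply (differentiableAt_const c)
    rw [fderiv_fun_sub (L.differentiableAt_chris_apply hz b c)
      (L.differentiableAt_chris_apply hz c b), sub_apply,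
      L.fderiv_chris_apply hz, L.fderiv_chris_apply hz, fderiv_fun_const_smul hta,
      smul_apply,
      fderiv_apply_const (ht.clm_apply (differentiableAt_const b)), fderiv_apply_const ht] at h1
    exact h1
  have hc (a b : E) : L.chris z b a = L.chris z a b - (2 : ℝ) • L.tor z a b := by
    rw [← L.chris_sub_chris hz]; abel
  have e1 (a b c : E) : fderiv ℝ L.chris z a b c = fderiv ℝ L.chris z a c b
      + (2 : ℝ) • (L.tor z (L.chris z a b) c + L.tor z b (L.chris z a c)
        - L.chris z a (L.tor z b c)) := by
    rw [← hL.fderiv_tor hz, ← key]; abel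
  have e2 (a b c : E) : L.chris z a (L.chris z b c) = L.chris z a (L.chris z c b)
      + (2 : ℝ) • L.chris z a (L.tor z b c) := by
    rw [hc b c, map_sub, map_smul]; abel
  have e3 (a b c : E) : L.tor z (L.chris z a b) c = L.tor z (L.chris z b a) c
      + (2 : ℝ) • L.tor z (L.tor z a b) c := by
    rw [hc a b, map_sub, map_smul, sub_apply, smul_apply]; abel
  simp only [curv_apply]
  rw [e1 a b c, e1 b c a, e1 c a b, e2 a b c, e2 b c a, e2 c a b,
    L.tor_swap hz b (L.chris z a c), L.tor_swap hz c (L.chris z b a),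
    L.tor_swap hz a (L.chris z c b), e3 a b c, e3 b c a, e3 c a b]
  module

/-! ### The Casimir operator of the torsion -/

variable (E) in
/-- The trace, as a continuous linear form. -/
def traceL : (E →L[ℝ] E) →L[ℝ] ℝ :=
  LinearMap.toContinuousLinearMap (LinearMap.trace ℝ E ∘ₗ ContinuousLinearMap.coeLM ℝ)

lemma traceL_apply (A : E →L[ℝ] E) : traceL E A = LinearMap.trace ℝ E A := rfl

lemma traceL_comp_comm (A B : E →L[ℝ] E) : traceL E (A ∘L B) = traceL E (B ∘L A) := by
  simp only [traceL_apply, ContinuousLinearMap.toLinearMap_comp]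
  exact LinearMap.trace_mul_comm ℝ (A : E →ₗ[ℝ] E) (B : E →ₗ[ℝ] E)

variable (E) in
/-- The bilinear form `tr (A B)`. -/
def traceForm : (E →L[ℝ] E) →L[ℝ] (E →L[ℝ] E) →L[ℝ] ℝ :=
  (ContinuousLinearMap.compL ℝ (E →L[ℝ] E) (E →L[ℝ] E) ℝ (traceL E)) ∘L
    ContinuousLinearMap.compL ℝ E E E

lemma traceForm_apply (A B : E →L[ℝ] E) : traceForm E A B = traceL E (A ∘L B) := rfl

variable (L)

/-- The symmetric bilinear form `-tr (τ_u τ_v)`. -/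
def casimirForm (z : E) : E →L[ℝ] E →L[ℝ] ℝ :=
  -((traceForm E).bilinearComp (L.tor z) (L.tor z))

lemma casimirForm_apply (u v : E) :
    L.casimirForm z u v = - traceForm E (L.tor z u) (L.tor z v) := rfl

lemma contDiffOn_casimirForm : ContDiffOn ℝ ∞ L.casimirForm L.domain := by
  simp_rw [contDiffOn_clm_apply]
  intro a b
  exact (((contDiffOn_const (c := traceForm E)).clm_apply
    (L.contDiffOn_tor.clm_apply contDiffOn_const)).clm_apply
    (L.contDiffOn_tor.clm_apply contDiffOn_const)).neg

/-- The symmetric endomorphism `S` with `g(S u, v) = -tr (τ_u τ_v)`. -/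
def casimir (z : E) : E →L[ℝ] E := L.raise z ∘L L.casimirForm z

lemma contDiffOn_casimir : ContDiffOn ℝ ∞ L.casimir L.domain :=
  L.contDiffOn_raise.clm_comp L.contDiffOn_casimirForm

lemma metric_casimir (hz : z ∈ L.domain) (u v : E) :
    L.metric z (L.casimir z u) v = - traceL E (L.tor z u ∘L L.tor z v) :=
  L.metric_raise hz _ v

variable {L}

/-- As `τ` is parallel, the derivative of `τ_u` in direction `w` is `τ_{Γ_w u}` minus the commutator
of `Γ_w` with `τ_u`. The commutators drop out because the trace form is invariant under commutation.
-/
lemma IsParallel.fderiv_casimirForm (hL : L.IsParallel) (hz : z ∈ L.domain) (w u v : E) :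
    fderiv ℝ (fun y => L.casimirForm y u v) z w
      = L.casimirForm z (L.chris z w u) v + L.casimirForm z u (L.chris z w v) := by
  have ht := L.differentiableAt_of_domain L.contDiffOn_tor hz
  have hu (u : E) : DifferentiableAt ℝ (fun y => L.tor y u) z :=
    ht.clm_apply (differentiableAt_const u)
  have key (u : E) : fderiv ℝ L.tor z w u = L.tor z (L.chris z w u) + L.tor z u ∘L L.chris z w
      - L.chris z w ∘L L.tor z u := by
    ext b
    rw [hL.fderiv_tor hz]; rfl
  have h1 : fderiv ℝ (fun y => L.casimirForm y u v) z w
      = - fderiv ℝ (fun y => traceForm E (L.tor y u) (L.tor y v)) z w := by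
    simp_rw [casimirForm_apply]
    rw [fderiv_fun_neg]; rfl
  rw [h1, fderiv_apply_apply (differentiableAt_const _) (hu u) (hu v), fderiv_apply_const ht,
    fderiv_apply_const ht, key, key, casimirForm_apply, casimirForm_apply]
  simp only [map_sub, map_add, sub_apply, add_apply, traceForm_apply]
  rw [traceL_comp_comm (L.chris z w ∘L L.tor z u) (L.tor z v),
    traceL_comp_comm (L.tor z u) (L.tor z v ∘L L.chris z w),
    traceL_comp_comm (L.tor z u) (L.chris z w ∘L L.tor z v),
    traceL_comp_comm (L.tor z u ∘L L.chris z w) (L.tor z v),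
    ContinuousLinearMap.comp_assoc (L.tor z v), ContinuousLinearMap.comp_assoc (L.chris z w),
    traceL_comp_comm (L.chris z w) (L.tor z v ∘L L.tor z u),
    ContinuousLinearMap.comp_assoc (L.tor z v)]
  simp
  ring

/-- The Casimir operator is parallel. -/
lemma IsParallel.fderiv_casimir (hL : L.IsParallel) (hz : z ∈ L.domain) (w u : E) :
    fderiv ℝ L.casimir z w u = L.casimir z (L.chris z w u) - L.chris z w (L.casimir z u) := by
  have hG := L.differentiableAt_of_domain L.contDiffOn_metric hz
  have hS := L.differentiableAt_of_domain L.contDiffOn_casimir hz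
  have hSu : DifferentiableAt ℝ (fun y => L.casimir y u) z :=
    hS.clm_apply (differentiableAt_const u)
  refine L.metric_ext hz fun c => ?_
  have h1 : fderiv ℝ (fun y => L.metric y (L.casimir y u) c) z w
      = fderiv ℝ (fun y => L.casimirForm y u c) z w := by
    have : (fun y => L.metric y (L.casimir y u) c) =ᶠ[𝓝 z] fun y => L.casimirForm y u c := by
      filter_upwards [L.isOpen_domain.mem_nhds hz] with y hy using L.metric_raise hy _ c
    rw [this.fderiv_eq]
  have hC (u v : E) : L.casimirForm z u v = L.metric z (L.casimir z u) v :=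
    (L.metric_raise hz _ v).symm
  rw [fderiv_apply_apply hG hSu (differentiableAt_const c), hL.fderiv_casimirForm hz,
    fderiv_apply_const hS, L.fderiv_metric hz, hC, hC] at h1
  simp only [map_sub, sub_apply]
  simp at h1
  linarith

/-- The commutator with `Γ_w` is a derivation of the algebra of endomorphisms, so the formula for
`S` passes to its powers. -/
lemma IsParallel.fderiv_casimir_pow (hL : L.IsParallel) (hz : z ∈ L.domain) (k : ℕ) (w : E) :
    fderiv ℝ (fun y => L.casimir y ^ k) z w
      = L.casimir z ^ k * L.chris z w - L.chris z w * L.casimir z ^ k := by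
  have hS := L.differentiableAt_of_domain L.contDiffOn_casimir hz
  have h1 : fderiv ℝ L.casimir z w
      = L.casimir z * L.chris z w - L.chris z w * L.casimir z := by
    ext u
    rw [hL.fderiv_casimir hz]; rfl
  induction k with
  | zero => simp
  | succ k ih =>
    simp_rw [pow_succ]
    rw [fderiv_fun_mul' (hS.fun_pow k) hS]
    simp only [add_apply, smul_apply, ih, h1, smul_eq_mul]
    simp [mul_sub, sub_mul, mul_assoc]

/-- The derivative of `S^k` is a commutator and so has trace zero. This is what makes the
eigenvalues of `S` independent of the point. -/
lemma IsParallel.fderiv_trace_casimir_pow (hL : L.IsParallel) (hz : z ∈ L.domain) (k : ℕ) :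
    fderiv ℝ (fun y => traceL E (L.casimir y ^ k)) z = 0 := by
  have hS := L.differentiableAt_of_domain L.contDiffOn_casimir hz
  ext w
  have := ((traceL E).hasFDerivAt.comp z (hS.fun_pow k).hasFDerivAt).fderiv
  rw [Function.comp_def] at this
  rw [this, ContinuousLinearMap.comp_apply, hL.fderiv_casimir_pow hz, map_sub, zero_apply,
    sub_eq_zero]
  exact traceL_comp_comm _ _

end LocalGeometry

end LocalCalculus

/-! ### Pointwise algebra: the stabilizer, the form of the torsion and the spectrum of the Casimir
operator. -/

section LinearAlgebra

/-! ## Euclidean vector spaces with a three-form -/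

/-- A Euclidean vector space `(V, b)` together with a `3`-form, given by the tensor `t` with
`b(t u v, w) = τ(u, v, w)`. -/
structure TorsionSpace (V : Type*) [AddCommGroup V] [Module ℝ V] where
  b : V →ₗ[ℝ] V →ₗ[ℝ] ℝ
  t : V →ₗ[ℝ] V →ₗ[ℝ] V
  symm : ∀ v w, b v w = b w v
  pos : ∀ v, v ≠ 0 → 0 < b v v
  alt : ∀ u, t u u = 0
  skew : ∀ u v w, b (t u v) w = - b v (t u w)

namespace TorsionSpace

variable {V : Type*} [AddCommGroup V] [Module ℝ V] (P : TorsionSpace V)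

lemma nonneg (v : V) : 0 ≤ P.b v v := by
  by_cases h : v = 0
  · simp [h]
  · exact (P.pos v h).le

lemma eq_zero_of_self {v : V} (h : P.b v v = 0) : v = 0 := by
  by_contra hv
  exact (P.pos v hv).ne' h

lemma ext_b {v w : V} (h : ∀ u, P.b v u = P.b w u) : v = w := by
  rw [← sub_eq_zero]
  apply P.eq_zero_of_self
  have h0 : P.b (v - w) = 0 := by
    ext u
    rw [map_sub, LinearMap.sub_apply, h, sub_self]; rfl
  rw [h0]; rfl

lemma t_swap (u v : V) : P.t u v = - P.t v u := by
  have h := P.alt (u + v)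
  simp only [map_add, LinearMap.add_apply, P.alt, zero_add, add_zero] at h
  exact eq_neg_of_add_eq_zero_left ((add_comm _ _).trans h)

/-- The trilinear form `b(t u v, w)` is invariant under cyclic permutations. -/
lemma b_t_cyclic (u v w : V) : P.b (P.t u v) w = P.b (P.t v w) u := by
  rw [P.t_swap u v, map_neg, LinearMap.neg_apply, P.skew v u w, neg_neg, P.symm]

/-- The skew-symmetric derivations of `t`. -/
def IsStab (A : Module.End ℝ V) : Prop :=
  (∀ v w, P.b (A v) w = - P.b v (A w)) ∧ ∀ u v, A (P.t u v) = P.t (A u) v + P.t u (A v)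

/-- Properties of the stabilizer in the almost irreducible case: it annihilates the unit vector
`ξ`, it is nonzero, and it acts irreducibly on the complement of `ξ`. -/
structure IsVertical (𝔤 : Submodule ℝ (Module.End ℝ V)) (ξ : V) : Prop where
  unit : P.b ξ ξ = 1
  annihilates : ∀ A ∈ 𝔤, A ξ = 0
  nonzero : ∃ A ∈ 𝔤, A ≠ 0
  ne_bot : ∃ v, v ≠ 0 ∧ P.b ξ v = 0
  irreducible : ∀ W : Submodule ℝ V, (∀ w ∈ W, P.b ξ w = 0) → IsInvariant 𝔤 W →
    W = ⊥ ∨ ∀ w, P.b ξ w = 0 → w ∈ W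

lemma _root_.SkewTorsion.isInvariant_iSup {ι : Sort*} {𝔤 : Submodule ℝ (Module.End ℝ V)}
    {W : ι → Submodule ℝ V} (h : ∀ i, IsInvariant 𝔤 (W i)) : IsInvariant 𝔤 (⨆ i, W i) := by
  intro A hA w hw
  have : (⨆ i, W i) ≤ (⨆ i, W i).comap A :=
    iSup_le fun i v hv => (le_iSup W i) (h i A hA v hv)
  exact this hw

variable {P} {𝔤 : Submodule ℝ (Module.End ℝ V)} {ξ : V}

/-- A skew-symmetric family annihilates its one-dimensional invariant subspaces. -/
lemma apply_eq_zero_of_isInvariant_span (hskew : ∀ A ∈ 𝔤, ∀ v w, P.b (A v) w = - P.b v (A w))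
    (h : IsInvariant 𝔤 (Submodule.span ℝ {ξ})) (A : Module.End ℝ V) (hA : A ∈ 𝔤) : A ξ = 0 := by
  obtain ⟨c, hc⟩ := Submodule.mem_span_singleton.mp
    (h A hA ξ (Submodule.mem_span_singleton_self ξ))
  have h1 := hskew A hA ξ ξ
  rw [← hc, map_smul, map_smul, LinearMap.smul_apply, smul_eq_mul] at h1
  have h2 : c * P.b ξ ξ = 0 := by linarith
  rcases mul_eq_zero.mp h2 with h3 | h3
  · rw [← hc, h3, zero_smul]
  · rw [P.eq_zero_of_self h3, map_zero]

lemma IsCanonicalSplitting.isInvariant_right {b : V → V → ℝ} {Hor Ver : Submodule ℝ V}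
    (h : IsCanonicalSplitting b 𝔤 Hor Ver) : IsInvariant 𝔤 Ver := by
  obtain ⟨k, W, hW, -, -, -, rfl⟩ := h
  exact isInvariant_iSup fun i => isInvariant_iSup fun _ => (hW i).1

/-- Extracts from the canonical splitting all that is needed later: `ξ` is a normalized generator of
the vertical line, and the horizontal space is exactly `ξ^⊥`. -/
lemma exists_isVertical (hskew : ∀ A ∈ 𝔤, ∀ v w, P.b (A v) w = - P.b v (A w))
    (h : IsAlmostIrreducible (fun v w => P.b v w) 𝔤) : ∃ ξ, P.IsVertical 𝔤 ξ := by
  obtain ⟨Hor, Ver, hs, hdim, hirr⟩ := h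
  have hinv := IsCanonicalSplitting.isInvariant_right hs
  obtain ⟨k, W, hW, hort, htop, hHor, hVer⟩ := hs
  obtain ⟨⟨ζ, hζV⟩, hζ0, hspan⟩ := finrank_eq_one_iff'.mp hdim
  have hζ : ζ ≠ 0 := fun h => hζ0 (Subtype.ext h)
  have hVspan : Ver = Submodule.span ℝ {ζ} := by
    apply le_antisymm
    · intro v hv
      obtain ⟨c, hc⟩ := hspan ⟨v, hv⟩
      exact Submodule.mem_span_singleton.mpr ⟨c, congrArg Subtype.val hc⟩
    · rwa [Submodule.span_singleton_le_iff_mem]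
  have hkill := apply_eq_zero_of_isInvariant_span hskew (hVspan ▸ hinv)
  have hpos := P.pos ζ hζ
  have hHV : ∀ v ∈ Hor, P.b ζ v = 0 := by
    have h1 : Hor ≤ LinearMap.ker (P.b ζ) := by
      rw [hHor]
      refine iSup_le fun i => iSup_le fun hi v hv => ?_
      have h2 : Ver ≤ LinearMap.ker (P.b v) := by
        rw [hVer]
        refine iSup_le fun j => iSup_le fun hj w hw => ?_
        -- A horizontal and a vertical summand have different indices, since only the former meets
        -- `𝔰𝔬(W)`.
        exact hort i j (fun hij => hj (hij ▸ hi)) v hv w hw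
      have h3 := h2 hζV
      rw [LinearMap.mem_ker] at h3 ⊢
      rw [P.symm, h3]
    exact fun v hv => h1 hv
  have hsup : Hor ⊔ Ver = ⊤ := by
    rw [eq_top_iff, ← htop]
    refine iSup_le fun i => ?_
    by_cases hi : MeetsSo (fun v w => P.b v w) 𝔤 (W i)
    · refine le_trans ?_ le_sup_left
      rw [hHor]
      exact le_trans (le_iSup (fun _ : MeetsSo (fun v w => P.b v w) 𝔤 (W i) => W i) hi)
        (le_iSup (fun i => ⨆ (_ : MeetsSo (fun v w => P.b v w) 𝔤 (W i)), W i) i)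
    · refine le_trans ?_ le_sup_right
      rw [hVer]
      exact le_trans (le_iSup (fun _ : ¬ MeetsSo (fun v w => P.b v w) 𝔤 (W i) => W i) hi)
        (le_iSup (fun i => ⨆ (_ : ¬ MeetsSo (fun v w => P.b v w) 𝔤 (W i)), W i) i)
  have hmem : ∀ v, P.b ζ v = 0 → v ∈ Hor := by
    intro v hv
    have : v ∈ Hor ⊔ Ver := hsup ▸ Submodule.mem_top
    obtain ⟨h, hh, w, hw, rfl⟩ := Submodule.mem_sup.mp this
    rw [hVspan] at hw
    obtain ⟨c, rfl⟩ := Submodule.mem_span_singleton.mp hw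
    rw [map_add, hHV h hh, map_smul, smul_eq_mul, zero_add] at hv
    rw [(mul_eq_zero.mp hv).resolve_right hpos.ne', zero_smul, add_zero]
    exact hh
  set s := Real.sqrt (P.b ζ ζ) with hsdef
  have hs0 : 0 < s := Real.sqrt_pos.mpr hpos
  have hss : s * s = P.b ζ ζ := Real.mul_self_sqrt hpos.le
  have hb (v : V) : P.b (s⁻¹ • ζ) v = 0 ↔ P.b ζ v = 0 := by
    rw [map_smul, LinearMap.smul_apply, smul_eq_mul, mul_eq_zero]
    exact ⟨fun h => h.resolve_left (inv_ne_zero hs0.ne'), Or.inr⟩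
  refine ⟨s⁻¹ • ζ, ⟨?_, fun A hA => by rw [map_smul, hkill A hA, smul_zero], ?_, ?_, ?_⟩⟩
  · rw [map_smul, map_smul, LinearMap.smul_apply, smul_eq_mul, smul_eq_mul, ← hss]
    field_simp
  -- If the stabilizer were zero, no summand could meet it and the horizontal space would vanish.
  · by_contra! hcon
    apply hirr.2.1
    rw [hHor, eq_bot_iff]
    refine iSup_le fun i => iSup_le fun hi => ?_
    obtain ⟨A, hA, hA0, -⟩ := hi
    exact absurd (hcon A hA) hA0
  · obtain ⟨v, hv, hv0⟩ := Submodule.exists_mem_ne_zero_of_ne_bot hirr.2.1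
    exact ⟨v, hv0, (hb v).mpr (hHV v hv)⟩
  · intro W' hW' hinv'
    rcases hirr.2.2 W' (fun w hw => hmem w ((hb w).mp (hW' w hw))) hinv' with h | h
    · exact Or.inl h
    · exact Or.inr fun w hw => h ▸ hmem w ((hb w).mp hw)

lemma IsVertical.ne_zero (h : P.IsVertical 𝔤 ξ) : ξ ≠ 0 := by
  rintro rfl
  simpa using h.unit

/-- The component of `v` orthogonal to `ξ`. -/
lemma IsVertical.b_sub (h : P.IsVertical 𝔤 ξ) (v : V) : P.b ξ (v - P.b ξ v • ξ) = 0 := by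
  rw [map_sub, map_smul, h.unit, smul_eq_mul, mul_one, sub_self]

/-- The common kernel of the stabilizer is spanned by `ξ`. -/
lemma IsVertical.eq_smul (h : P.IsVertical 𝔤 ξ) {v : V} (hv : ∀ A ∈ 𝔤, A v = 0) :
    v = P.b ξ v • ξ := by
  -- The common kernel inside `ξ^⊥` is invariant, hence zero or all of `ξ^⊥`; in the latter case
  -- every element of the stabilizer would be zero.
  let W : Submodule ℝ V := LinearMap.ker (P.b ξ) ⊓ ⨅ A ∈ 𝔤, LinearMap.ker A
  have hWmem (w : V) : w ∈ W ↔ P.b ξ w = 0 ∧ ∀ A ∈ 𝔤, A w = 0 := by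
    simp [W, Submodule.mem_iInf]
  rcases h.irreducible W (fun w hw => ((hWmem w).mp hw).1)
    (fun A hA w hw => by rw [((hWmem w).mp hw).2 A hA]; exact W.zero_mem) with h1 | h1
  · have : v - P.b ξ v • ξ ∈ W := (hWmem _).mpr ⟨h.b_sub v, fun A hA => by
      rw [map_sub, map_smul, hv A hA, h.annihilates A hA, smul_zero, sub_zero]⟩
    rw [h1, Submodule.mem_bot, sub_eq_zero] at this
    exact this
  · obtain ⟨A, hA, hA0⟩ := h.nonzero
    exfalso
    apply hA0
    ext w
    have h2 := ((hWmem _).mp (h1 _ (h.b_sub w))).2 A hA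
    rw [map_sub, map_smul, h.annihilates A hA, smul_zero, sub_zero] at h2
    exact h2

variable [FiniteDimensional ℝ V]

variable (P) in
/-- The inner product of `V`. -/
@[reducible]
def innerCore : InnerProductSpace.Core ℝ V where
  inner v w := P.b v w
  conj_inner_symm v w := by simp [P.symm]
  re_inner_nonneg v := by simpa using P.nonneg v
  add_left u v w := by simp
  smul_left v w r := by simp
  definite v hv := P.eq_zero_of_self hv

variable (P) in
lemma exists_orthonormal_basis : ∃ e : Module.Basis (Fin (Module.finrank ℝ V)) ℝ V,
    ∀ A : Module.End ℝ V, LinearMap.trace ℝ V A = ∑ i, P.b (e i) (A (e i)) := by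
  let : NormedAddCommGroup V := P.innerCore.toNormedAddCommGroup
  let : InnerProductSpace ℝ V := InnerProductSpace.ofCore P.innerCore.toCore
  let e := stdOrthonormalBasis ℝ V
  refine ⟨e.toBasis, fun A => ?_⟩
  rw [LinearMap.trace_eq_sum_inner A e]
  simp only [OrthonormalBasis.coe_toBasis]
  rfl

variable (P) in
lemma exists_eigenvector {Q : Module.End ℝ V} (hQ : ∀ v w, P.b (Q v) w = P.b v (Q w))
    {W : Submodule ℝ V} (hW : W ≠ ⊥) (hinv : ∀ w ∈ W, Q w ∈ W) :
    ∃ (μ : ℝ) (v : V), v ∈ W ∧ v ≠ 0 ∧ Q v = μ • v := by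
  let : NormedAddCommGroup V := P.innerCore.toNormedAddCommGroup
  let : InnerProductSpace ℝ V := InnerProductSpace.ofCore P.innerCore.toCore
  have hs : (Q.restrict hinv).IsSymmetric := fun v w => hQ v w
  have : Nontrivial W := Submodule.nontrivial_iff_ne_bot.mpr hW
  obtain ⟨v, hv⟩ := (hs.hasEigenvalue_iSup_of_finiteDimensional).exists_hasEigenvector
  exact ⟨_, v, v.2, fun h => hv.2 (Subtype.ext h), congrArg Subtype.val hv.apply_eq_smul⟩

/-- Schur's lemma. -/
lemma IsVertical.schur (h : P.IsVertical 𝔤 ξ) {Q : Module.End ℝ V}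
    (hQ : ∀ v w, P.b (Q v) w = P.b v (Q w)) (hcomm : ∀ A ∈ 𝔤, ∀ v, A (Q v) = Q (A v))
    (hskew : ∀ A ∈ 𝔤, ∀ v w, P.b (A v) w = - P.b v (A w))
    (hξ : ∃ a : ℝ, Q ξ = a • ξ) : ∃ μ : ℝ, ∀ v, P.b ξ v = 0 → Q v = μ • v := by
  obtain ⟨a, ha⟩ := hξ
  have hne : LinearMap.ker (P.b ξ) ≠ ⊥ := by
    obtain ⟨v, hv, hv'⟩ := h.ne_bot
    intro hbot
    exact hv ((Submodule.mem_bot ℝ).mp (hbot ▸ (LinearMap.mem_ker.mpr hv')))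
  have hinv : ∀ w ∈ LinearMap.ker (P.b ξ), Q w ∈ LinearMap.ker (P.b ξ) := by
    intro w hw
    rw [LinearMap.mem_ker] at hw ⊢
    rw [← hQ, ha, map_smul, LinearMap.smul_apply, hw, smul_zero]
  obtain ⟨μ, v, hv, hv0, hμ⟩ := P.exists_eigenvector hQ hne hinv
  refine ⟨μ, ?_⟩
  -- A symmetric operator has a real eigenvector in `ξ^⊥`, and its eigenspace there is invariant, so
  -- irreducibility makes it everything.
  let W : Submodule ℝ V := LinearMap.ker (P.b ξ) ⊓ LinearMap.ker (Q - μ • 1)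
  have hWmem (w : V) : w ∈ W ↔ P.b ξ w = 0 ∧ Q w = μ • w := by
    simp [W, sub_eq_zero]
  have hWinv : IsInvariant 𝔤 W := by
    intro A hA w hw
    rw [hWmem] at hw ⊢
    refine ⟨?_, ?_⟩
    · have := hskew A hA ξ w
      rw [h.annihilates A hA, map_zero, LinearMap.zero_apply] at this
      linarith
    · rw [← hcomm A hA, hw.2, map_smul]
  rcases h.irreducible W (fun w hw => ((hWmem w).mp hw).1) hWinv with h1 | h1
  · exact absurd ((Submodule.mem_bot ℝ).mp (h1 ▸ (hWmem v).mpr ⟨hv, hμ⟩)) hv0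
  · exact fun w hw => ((hWmem w).mp (h1 w hw)).2

/-! ### The curvature condition -/

/-- An algebraic curvature tensor with values in the stabilizer of the torsion satisfies the pair
symmetry. -/
lemma curvature_pair_symm {R : V → V → Module.End ℝ V} (hR : ∀ u v, R u v = - R v u)
    (hst : ∀ u v, P.IsStab (R u v))
    (hB : ∀ u v w, R u v w + R v w u + R w u v
      = (4 : ℝ) • (P.t (P.t u v) w + P.t (P.t v w) u + P.t (P.t w u) v)) (a b c d : V) :
    P.b (R a b c) d = P.b (R c d a) b := by
  have s1 (a b c d : V) : P.b (R a b c) d = - P.b (R b a c) d := by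
    rw [hR a b, LinearMap.neg_apply, map_neg, LinearMap.neg_apply]
  have s2 (a b c d : V) : P.b (R a b c) d = - P.b (R a b d) c := by
    rw [(hst a b).1, P.symm]
  have q (a b c d : V) : P.b (P.t (P.t a b) c) d = P.b (P.t a b) (P.t c d) := by
    rw [P.b_t_cyclic, P.symm]
  have hB' (a b c d : V) : P.b (R a b c) d + P.b (R b c a) d + P.b (R c a b) d
      = 4 * (P.b (P.t a b) (P.t c d) + P.b (P.t b c) (P.t a d) + P.b (P.t c a) (P.t b d)) := by
    have := congrArg (fun x => P.b x d) (hB a b c)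
    simp only [map_add, map_smul, LinearMap.add_apply, LinearMap.smul_apply, smul_eq_mul, q] at this
    exact this
  have sw (a b c d : V) : P.b (P.t a b) (P.t c d) = P.b (P.t c d) (P.t a b) := P.symm _ _
  have n1 (a b c d : V) : P.b (P.t a b) (P.t c d) = - P.b (P.t b a) (P.t c d) := by
    rw [P.t_swap a b, map_neg, LinearMap.neg_apply]
  have n2 (a b c d : V) : P.b (P.t a b) (P.t c d) = - P.b (P.t a b) (P.t d c) := by
    rw [P.t_swap c d, map_neg]
  -- The octahedron argument: the first two Bianchi identities minus the last two give twice the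
  -- claim. The torsion term alternates in `a, b, c, d`, so under the successive cyclic shifts it
  -- appears with signs `+, -, +, -` and cancels.
  have e1 := hB' a b c d
  have e2 := hB' b c d a
  have e3 := hB' c d a b
  have e4 := hB' d a b c
  linarith [s2 b c d a, s2 c d b a, s1 d b c a, s2 b d c a, s1 d a c b, s2 a d c b, s1 a c d b,
    s2 c a d b, s1 d a b c, s2 a b d c, n2 b c d a, sw c d b a, n1 b a c d, n1 d b c a, sw b d c a,
    sw c d a b, n1 d a c b, n2 a d c b, sw a d b c, n1 a c d b, n2 c a d b, n1 d a b c, n2 a b d c,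
    n2 b d a c]

/-- If a vector is annihilated by the stabilizer, then contraction with it belongs to the
stabilizer. -/
lemma isStab_t {R : V → V → Module.End ℝ V} (hR : ∀ u v, R u v = - R v u)
    (hst : ∀ u v, P.IsStab (R u v))
    (hB : ∀ u v w, R u v w + R v w u + R w u v
      = (4 : ℝ) • (P.t (P.t u v) w + P.t (P.t v w) u + P.t (P.t w u) v))
    (hξ : ∀ u v, R u v ξ = 0) : P.IsStab (P.t ξ) := by
  refine ⟨P.skew ξ, fun u v => ?_⟩
  -- Pair symmetry turns `R(v,w) ξ = 0` into `R(ξ,u) = 0`. The curvature side of the Bianchi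
  -- identity for `ξ, u, v` therefore vanishes, and the torsion side is the derivation rule for `t
  -- ξ`.
  have h0 (u v : V) : R ξ u v = 0 := P.ext_b fun w => by
    rw [curvature_pair_symm hR hst hB, hξ]; simp
  have h1 := hB ξ u v
  rw [h0, hξ, hR v ξ, LinearMap.neg_apply, h0, neg_zero, add_zero, add_zero, eq_comm,
    smul_eq_zero_iff_right (by norm_num), P.t_swap (P.t u v) ξ, P.t_swap v ξ, map_neg,
    LinearMap.neg_apply, P.t_swap (P.t ξ v) u, neg_neg] at h1
  rw [← sub_eq_zero, ← neg_eq_zero, ← h1]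
  abel

/-! ### The Casimir operator -/

variable {S : Module.End ℝ V}

lemma casimir_symm (hS : ∀ u v, P.b (S u) v = - LinearMap.trace ℝ V (P.t u ∘ₗ P.t v)) (u v : V) :
    P.b (S u) v = P.b u (S v) := by
  rw [P.symm u, hS, hS]
  congr 1
  exact LinearMap.trace_mul_comm ℝ (P.t u) (P.t v)

/-- A derivation `A` satisfies `t (A u) = [A, t u]`, and the trace form is invariant under
commutators. With `schur` this makes the Casimir operator a scalar on `ξ^⊥`. -/
lemma casimir_comm (hS : ∀ u v, P.b (S u) v = - LinearMap.trace ℝ V (P.t u ∘ₗ P.t v))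
    {A : Module.End ℝ V} (hA : P.IsStab A) (u : V) : A (S u) = S (A u) := by
  refine P.ext_b fun v => ?_
  have key (u : V) : P.t (A u) = A * P.t u - P.t u * A := by
    ext v
    rw [LinearMap.sub_apply, Module.End.mul_apply, Module.End.mul_apply, hA.2 u v]; abel
  rw [hA.1, hS, hS]
  change - -LinearMap.trace ℝ V (P.t u * P.t (A v)) = -LinearMap.trace ℝ V (P.t (A u) * P.t v)
  rw [key, key, mul_sub, sub_mul, map_sub, map_sub, 
    mul_assoc A, ← mul_assoc, ← mul_assoc,
    LinearMap.trace_mul_comm ℝ (P.t u * P.t v) A, ← mul_assoc]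
  ring

/-- For skew `A`, `-tr(A²)` is the sum of the squared lengths of the images of an orthonormal basis.
This gives the sign of the Casimir eigenvalue and detects vanishing torsion. -/
lemma trace_sq_nonpos {A : Module.End ℝ V} (hA : ∀ v w, P.b (A v) w = - P.b v (A w)) :
    LinearMap.trace ℝ V (A ∘ₗ A) ≤ 0 ∧ (LinearMap.trace ℝ V (A ∘ₗ A) = 0 → A = 0) := by
  obtain ⟨e, he⟩ := P.exists_orthonormal_basis
  have h1 : LinearMap.trace ℝ V (A ∘ₗ A) = - ∑ i, P.b (A (e i)) (A (e i)) := by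
    rw [he, ← Finset.sum_neg_distrib]
    refine Finset.sum_congr rfl fun i _ => ?_
    rw [hA, neg_neg]; rfl
  have h2 : ∀ i ∈ Finset.univ, 0 ≤ P.b (A (e i)) (A (e i)) := fun i _ => P.nonneg _
  refine ⟨by rw [h1]; linarith [Finset.sum_nonneg h2], fun h => ?_⟩
  rw [h1, neg_eq_zero, Finset.sum_eq_zero_iff_of_nonneg h2] at h
  exact e.ext fun i => P.eq_zero_of_self (h i (Finset.mem_univ i))

variable (P) in
/-- The skew-symmetric endomorphism `ξ ∧ h`. -/
def wedge (ξ h : V) : Module.End ℝ V := (P.b ξ).smulRight h - (P.b h).smulRight ξ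

lemma wedge_apply (ξ h v : V) : P.wedge ξ h v = P.b ξ v • h - P.b h v • ξ := rfl

lemma wedge_skew (ξ h v w : V) : P.b (P.wedge ξ h v) w = - P.b v (P.wedge ξ h w) := by
  rw [P.symm v]
  simp only [wedge_apply, map_sub, map_smul, LinearMap.sub_apply, LinearMap.smul_apply,
    smul_eq_mul]
  ring

/-- The torsion is given by `ξ ∧ J`, with `J = t ξ` a multiple of a complex structure. -/
structure IsContact (P : TorsionSpace V) (ξ : V) (μ : ℝ) : Prop where
  unit : P.b ξ ξ = 1
  pos : 0 < μ
  sq : ∀ v, P.t ξ (P.t ξ v) = - μ • v + (μ * P.b ξ v) • ξ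
  t_eq : ∀ u v, P.t u v = P.b ξ u • P.t ξ v - P.b ξ v • P.t ξ u + P.b (P.t ξ u) v • ξ

lemma b_t_left (ξ v : V) : P.b ξ (P.t ξ v) = 0 := by
  have := P.skew ξ ξ v
  rw [P.alt, map_zero, LinearMap.zero_apply] at this
  linarith

/-- Either `t ξ` vanishes, or the torsion is `ξ ∧ J`. -/
lemma IsVertical.t_eq_zero_or_isContact (h : P.IsVertical 𝔤 ξ) (h𝔤 : ∀ A, A ∈ 𝔤 ↔ P.IsStab A)
    (hJ : P.IsStab (P.t ξ)) : P.t ξ = 0 ∨ ∃ μ, P.IsContact ξ μ := by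
  -- `J = t ξ` is skew and commutes with the stabilizer because the stabilizer kills `ξ`. Schur's
  -- lemma needs a symmetric operator, so it is applied to `J²`.
  obtain ⟨μ, hμ⟩ := h.schur (Q := P.t ξ ∘ₗ P.t ξ)
    (fun v w => by simp only [LinearMap.comp_apply, P.skew ξ, neg_neg])
    (fun A hA v => by
      have hc (v : V) : A (P.t ξ v) = P.t ξ (A v) := by
        rw [((h𝔤 A).mp hA).2, h.annihilates A hA, map_zero, LinearMap.zero_apply, zero_add]
      simp only [LinearMap.comp_apply, hc])
    (fun A hA => ((h𝔤 A).mp hA).1)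
    ⟨0, by simp [P.alt]⟩
  simp only [LinearMap.comp_apply] at hμ
  have hsq (v : V) : P.t ξ (P.t ξ v) = μ • v - (μ * P.b ξ v) • ξ := by
    have h1 := hμ _ (h.b_sub v)
    rw [map_sub, map_smul, P.alt, smul_zero, sub_zero, smul_sub, smul_smul] at h1
    exact h1
  obtain ⟨h0, hh0, hh0'⟩ := h.ne_bot
  have hμ0 : μ ≤ 0 := by
    have h1 := P.skew ξ h0 (P.t ξ h0)
    rw [hμ h0 hh0', map_smul, smul_eq_mul] at h1
    by_contra! hcon
    linarith [P.nonneg (P.t ξ h0), mul_pos hcon (P.pos h0 hh0)]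
  rcases hμ0.eq_or_lt with rfl | hneg
  · left
    ext v
    apply P.eq_zero_of_self
    rw [P.skew, hsq]; simp
  right
  refine ⟨-μ, h.unit, by linarith, fun v => by rw [hsq]; module, fun u v => ?_⟩
  -- The complex structure has no nonzero invariant 3-form on `ξ^⊥`, where invariance means that `J`
  -- acts trivially as a derivation.
  have hH : ∀ u v w, P.b ξ u = 0 → P.b ξ v = 0 → P.b ξ w = 0 → P.b (P.t u v) w = 0 := by
    have hD (u v w : V) : P.b (P.t (P.t ξ u) v) w + P.b (P.t u (P.t ξ v)) w
        + P.b (P.t u v) (P.t ξ w) = 0 := by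
      have h1 := congrArg (fun x => P.b x w) (hJ.2 u v)
      simp only [map_add, LinearMap.add_apply, P.skew ξ (P.t u v) w] at h1
      linarith
    have h3 (u v w : V) (hu : P.b ξ u = 0) (hv : P.b ξ v = 0) (hw : P.b ξ w = 0) :
        P.b (P.t (P.t ξ u) (P.t ξ v)) (P.t ξ w) = 0 := by
      -- With `T(u,v,w) = b(t u v, w)`, summing the rule over the three ways of inserting two copies
      -- of `J` gives `3 T(Ju,Jv,Jw)` plus `2μ` times the original sum, which is zero.
      have a1 := hD (P.t ξ u) (P.t ξ v) w
      have a2 := hD (P.t ξ u) v (P.t ξ w)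
      have a3 := hD u (P.t ξ v) (P.t ξ w)
      have a0 := hD u v w
      simp only [hμ u hu, hμ v hv, hμ w hw, map_smul, LinearMap.smul_apply, smul_eq_mul]
        at a1 a2 a3
      linear_combination (a1 + a2 + a3 - 2 * μ * a0) / 3
    intro u v w hu hv hw
    -- Replacing each argument by its image under `J` turns `T(Ju,Jv,Jw) = 0` into `μ³ T(u,v,w) =
    -- 0`.
    have h4 := h3 _ _ _ (P.b_t_left ξ u) (P.b_t_left ξ v) (P.b_t_left ξ w)
    simp only [hμ u hu, hμ v hv, hμ w hw, map_smul, LinearMap.smul_apply, smul_eq_mul] at h4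
    have hne : μ ≠ 0 := hneg.ne
    have h5 : μ * (μ * (μ * P.b (P.t u v) w)) = 0 := by linarith
    simpa [hne] using h5
  refine P.ext_b fun w => ?_
  have h6 := hH _ _ _ (h.b_sub u) (h.b_sub v) (h.b_sub w)
  simp only [map_sub, map_smul, LinearMap.sub_apply, LinearMap.smul_apply, smul_eq_mul, P.alt,
    map_zero, LinearMap.zero_apply] at h6
  simp only [map_sub, map_add, map_smul, LinearMap.sub_apply, LinearMap.add_apply,
    LinearMap.smul_apply, smul_eq_mul]
  have z1 : P.b (P.t u v) ξ = P.b (P.t ξ u) v := (P.b_t_cyclic ξ u v).symm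
  have z2 (v : V) : P.b (P.t ξ v) ξ = 0 := by rw [P.symm, P.b_t_left]
  have z3 : P.b (P.t u ξ) w = - P.b (P.t ξ u) w := by
    rw [P.t_swap, map_neg, LinearMap.neg_apply]
  have z4 : P.b (P.t u ξ) ξ = 0 := by rw [P.t_swap, map_neg, LinearMap.neg_apply, z2, neg_zero]
  rw [z1, z2, z3, z4] at h6
  linear_combination h6

/-- In dimension three, the wedge products belong to the stabilizer of `ξ ∧ J`. -/
lemma IsContact.isStab_wedge {μ : ℝ} (hc : P.IsContact ξ μ) (hdim : Module.finrank ℝ V = 3)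
    {h : V} (hh : h ≠ 0) (hξh : P.b ξ h = 0) : P.IsStab (P.wedge ξ h) := by
  refine ⟨P.wedge_skew ξ h, fun u v => P.ext_b fun w => ?_⟩
  set k := P.t ξ h with hk
  have hhh := P.pos h hh
  have hhk : P.b h k = 0 := by
    have := P.skew ξ h h
    rw [P.symm] at this
    linarith
  have hξk : P.b ξ k = 0 := P.b_t_left ξ h
  have hkk : P.b k k = μ * P.b h h := by
    rw [hk, P.skew, hc.sq, hξh]
    simp
  have hμ := hc.pos
  -- `ξ, h, k = J h` are orthogonal and nonzero; a nonzero remainder orthogonal to all three would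
  -- be a fourth independent vector in dimension three.
  have hexp (v : V) : v = P.b ξ v • ξ + (P.b h v / P.b h h) • h
      + (P.b k v / (μ * P.b h h)) • k := by
    rw [← sub_eq_zero]
    set r := v - (P.b ξ v • ξ + (P.b h v / P.b h h) • h + (P.b k v / (μ * P.b h h)) • k) with hr
    by_contra hr0
    have o1 : P.b ξ r = 0 := by
      rw [hr]; simp [hc.unit, hξh, hξk]
    have o2 : P.b h r = 0 := by
      rw [hr]; simp [P.symm h ξ, hξh, hhk, hhh.ne']
    have o3 : P.b k r = 0 := by
      rw [hr]
      simp only [map_sub, map_add, map_smul, P.symm k ξ, hξk, P.symm k h, hhk, hkk, smul_eq_mul]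
      field_simp
      ring
    have hli : LinearIndependent ℝ ![ξ, h, k, r] := by
      rw [Fintype.linearIndependent_iff]
      intro c hsum
      simp only [Fin.sum_univ_four, Matrix.cons_val] at hsum
      have hsum' (x : V) := congrArg (P.b x) hsum
      simp only [map_add, map_smul, map_zero, smul_eq_mul] at hsum'
      have c0 := hsum' ξ
      have c1 := hsum' h
      have c2 := hsum' k
      have c3 := hsum' r
      rw [hc.unit, hξh, hξk, o1] at c0
      rw [P.symm h ξ, hξh, hhk, o2] at c1
      rw [P.symm k ξ, hξk, P.symm k h, hhk, o3, hkk] at c2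
      rw [P.symm r ξ, o1, P.symm r h, o2, P.symm r k, o3] at c3
      have hr1 := (P.pos r hr0).ne'
      simp [hhh.ne', hμ.ne', hr1] at c0 c1 c2 c3
      intro i
      fin_cases i <;> assumption
    have := hli.fintype_card_le_finrank
    rw [hdim] at this
    simp at this
  -- The 2-form of `J` is a multiple of `h ∧ k`, so the torsion is a multiple of the volume form and
  -- every skew endomorphism preserves it.
  have hω (v w : V) : P.b (P.t ξ v) w * P.b h h = P.b h v * P.b k w - P.b k v * P.b h w := by
    have hJk : P.t ξ k = - μ • h := by
      rw [hk, hc.sq, hξh]; simp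
    conv_lhs => rw [hexp v]
    simp only [map_add, map_smul, P.alt, hJk, ← hk, LinearMap.add_apply, LinearMap.smul_apply,
      smul_eq_mul, smul_zero, zero_add]
    field_simp
    ring
  have f1 (v : V) : P.b (P.t ξ v) h = - P.b k v := by
    rw [P.skew, P.symm]
  have f2 (v : V) : P.b (P.t ξ v) ξ = 0 := by rw [P.symm, P.b_t_left]
  rw [P.wedge_skew ξ h _ w, hc.t_eq u v, hc.t_eq (P.wedge ξ h u) v,
    hc.t_eq u (P.wedge ξ h v)]
  simp only [wedge_apply, map_add, map_sub, map_smul, LinearMap.add_apply, LinearMap.sub_apply,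
    LinearMap.smul_apply, smul_eq_mul, P.alt, smul_zero, sub_zero, hξh, ← hk, hc.unit, f1, f2]
  -- This is `h ∧ (h ∧ k) = 0`.
  have key : P.b h h * (P.b h u * P.b (P.t ξ v) w - P.b h v * P.b (P.t ξ u) w
      + P.b h w * P.b (P.t ξ u) v) = 0 := by
    linear_combination P.b h u * hω v w - P.b h v * hω u w + P.b h w * hω u v
  have key' := (mul_eq_zero.mp key).resolve_left hhh.ne'
  linear_combination key'

/-- The eigenvalues of the Casimir operator. -/
theorem IsVertical.casimir_dichotomy (h : P.IsVertical 𝔤 ξ) (h𝔤 : ∀ A, A ∈ 𝔤 ↔ P.IsStab A)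
    (hJ : P.IsStab (P.t ξ))
    (hS : ∀ u v, P.b (S u) v = - LinearMap.trace ℝ V (P.t u ∘ₗ P.t v)) :
    (P.t ξ = 0 ∧ S ξ = 0 ∧ ∃ β : ℝ, 0 < β ∧ ∀ v, P.b ξ v = 0 → S v = β • v) ∨
    ∃ μ, P.IsContact ξ μ ∧ Module.finrank ℝ V ≠ 3 ∧
      S ξ = ((Module.finrank ℝ V - 1 : ℝ) * μ) • ξ ∧ ∀ v, P.b ξ v = 0 → S v = (2 * μ) • v := by
  have hskew : ∀ A ∈ 𝔤, ∀ v w, P.b (A v) w = - P.b v (A w) := fun A hA => ((h𝔤 A).mp hA).1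
  have hcomm : ∀ A ∈ 𝔤, ∀ v, A (S v) = S (A v) := fun A hA => casimir_comm hS ((h𝔤 A).mp hA)
  have hSξ : S ξ = P.b ξ (S ξ) • ξ := h.eq_smul fun A hA => by
    rw [hcomm A hA, h.annihilates A hA, map_zero]
  obtain ⟨β, hβ⟩ := h.schur (casimir_symm hS) hcomm hskew ⟨_, hSξ⟩
  obtain ⟨h0, hh0, hh0'⟩ := h.ne_bot
  -- `ξ ∧ h0` sends `ξ` to `h0 ≠ 0`, whereas the stabilizer kills `ξ`. This excludes both zero
  -- torsion and the contact case in dimension three, where the Casimir eigenvalues would coincide.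
  have hwedge : ¬ P.IsStab (P.wedge ξ h0) := by
    intro hst
    have := h.annihilates _ ((h𝔤 _).mpr hst)
    rw [wedge_apply, h.unit, P.symm, hh0', one_smul, zero_smul, sub_zero] at this
    exact hh0 this
  rcases h.t_eq_zero_or_isContact h𝔤 hJ with ht | ⟨μ, hμ⟩
  · left
    refine ⟨ht, P.ext_b fun v => ?_, β, ?_, hβ⟩
    · rw [hS, ht]; simp
    · have h1 (u : V) (hu : P.b ξ u = 0) :
          β * P.b u u = - LinearMap.trace ℝ V (P.t u ∘ₗ P.t u) := by
        rw [← hS, hβ u hu, map_smul, LinearMap.smul_apply, smul_eq_mul]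
      rcases lt_trichotomy 0 β with hlt | heq | hgt
      · exact hlt
      · exfalso
        apply hwedge
        -- With `β = 0`, each `t u` for `u` in `ξ^⊥` has square of trace zero and so vanishes; `t ξ
        -- = 0` already holds.
        have ht0 : P.t = 0 := by
          ext1 u
          have h2 := (trace_sq_nonpos (P.skew (u - P.b ξ u • ξ))).2 (by
            have := h1 _ (h.b_sub u)
            rw [← heq, zero_mul] at this
            linarith)
          rw [map_sub, map_smul, ht, smul_zero, sub_zero] at h2
          exact h2
        exact ⟨P.wedge_skew ξ h0, fun u v => by simp [ht0]⟩
      · have h2 := h1 h0 hh0'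
        have h3 := (trace_sq_nonpos (P.skew h0)).1
        nlinarith [P.pos h0 hh0]
  · right
    refine ⟨μ, hμ, fun hdim => hwedge (hμ.isStab_wedge hdim hh0 hh0'), ?_, ?_⟩
    · rw [hSξ]
      congr 1
      rw [P.symm, hS]
      -- `J²` is `-μ` times the projection to `ξ^⊥`, of rank `dim V - 1`.
      have h1 : P.t ξ ∘ₗ P.t ξ = - μ • LinearMap.id + μ • (P.b ξ).smulRight ξ := by
        ext v
        simp [hμ.sq, smul_smul]
      rw [h1, map_add, map_smul, map_smul, LinearMap.trace_id, LinearMap.trace_smulRight, h.unit]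
      simp only [smul_eq_mul]
      ring
    · suffices hb : β = 2 * μ by rw [← hb]; exact hβ
      have h1 := hS h0 h0
      -- `t h0` only rotates the plane of `ξ` and `J h0`, so its square has two equal contributions
      -- to the trace; this is the `2` in `2μ`.
      have h2 : P.t h0 ∘ₗ P.t h0 = - (P.b (P.t ξ h0)).smulRight (P.t ξ h0)
          - P.b (P.t ξ h0) (P.t ξ h0) • (P.b ξ).smulRight ξ := by
        ext v
        have e (v : V) : P.t h0 v = - P.b ξ v • P.t ξ h0 + P.b (P.t ξ h0) v • ξ := by
          rw [hμ.t_eq, hh0', zero_smul]; module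
        simp only [LinearMap.comp_apply, e, map_add, map_smul, LinearMap.sub_apply,
          LinearMap.neg_apply, LinearMap.smulRight_apply, LinearMap.smul_apply, P.b_t_left,
          h.unit, P.symm (P.t ξ h0) ξ, smul_eq_mul]
        module
      have h3 : P.b (P.t ξ h0) (P.t ξ h0) = μ * P.b h0 h0 := by
        rw [P.skew, hμ.sq, hh0']; simp
      rw [h2, map_sub, map_neg, map_smul, LinearMap.trace_smulRight, LinearMap.trace_smulRight,
        h.unit, hβ h0 hh0', h3, map_smul, LinearMap.smul_apply, smul_eq_mul, smul_eq_mul] at h1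
      have h4 : (β - 2 * μ) * P.b h0 h0 = 0 := by linarith
      linarith [(mul_eq_zero.mp h4).resolve_right (P.pos h0 hh0).ne']

/-- The traces of the powers of an endomorphism which is scalar on `ξ` and on its complement. -/
lemma trace_pow_of_eigen {a β : ℝ} (hunit : P.b ξ ξ = 1) (ha : S ξ = a • ξ)
    (hβ : ∀ v, P.b ξ v = 0 → S v = β • v) (k : ℕ) :
    LinearMap.trace ℝ V (S ^ k) = a ^ k + (Module.finrank ℝ V - 1 : ℝ) * β ^ k := by
  have h1 (c : ℝ) (v : V) (hv : S v = c • v) : (S ^ k) v = c ^ k • v := by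
    induction k with
    | zero => simp
    | succ k ih => rw [pow_succ', Module.End.mul_apply, ih, map_smul, hv, smul_smul, pow_succ]
  have h2 : S ^ k = β ^ k • LinearMap.id + (a ^ k - β ^ k) • (P.b ξ).smulRight ξ := by
    ext v
    have h3 := h1 β (v - P.b ξ v • ξ) (hβ _ (by
      rw [map_sub, map_smul, hunit, smul_eq_mul, mul_one, sub_self]))
    rw [map_sub, map_smul, h1 a ξ ha, sub_eq_iff_eq_add] at h3
    rw [h3]
    simp only [LinearMap.add_apply, LinearMap.smul_apply, LinearMap.id_apply,
      LinearMap.smulRight_apply]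
    module
  rw [h2, map_add, map_smul, map_smul, LinearMap.trace_id, LinearMap.trace_smulRight, hunit]
  simp only [smul_eq_mul]
  ring

end TorsionSpace

end LinearAlgebra

/-! ### Vector fields, derivatives and Lie brackets in a chart. -/

section Coordinates

/-! ## Coordinates -/

variable {n : ℕ} {M : Type*} [TopologicalSpace M] [ChartedSpace (EuclideanSpace ℝ (Fin n)) M]
  [IsManifold (𝓡 n) ∞ M]

variable (n) in
/-- The model space. -/
abbrev Coord := EuclideanSpace ℝ (Fin n)

/-- The inverse of the chart at `p`. -/
def chartInv (p : M) : Coord n → M := (extChartAt (𝓡 n) p).symm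

variable (n) in
/-- The domain of the chart at `p`, as an open subset of `M`. -/
def chartDomain (p : M) : Set M := (chartAt (Coord n) p).source

variable (n) in
/-- The image of the chart at `p`. -/
def chartRange (p : M) : Set (Coord n) := (extChartAt (𝓡 n) p).target

/-- The coordinate frame at `x` of the chart at `p`. -/
def frame (p x : M) : Coord n →L[ℝ] TangentSpace (𝓡 n) x :=
  (trivializationAt (Coord n) (TangentSpace (𝓡 n)) p).symmL ℝ x

/-- The coordinates of tangent vectors at `x` in the chart at `p`. -/
def coframe (p x : M) : TangentSpace (𝓡 n) x →L[ℝ] Coord n :=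
  (trivializationAt (Coord n) (TangentSpace (𝓡 n)) p).continuousLinearMapAt ℝ x

/-- The coordinate representation of a vector field. -/
def rep (p : M) (Y : VField n M) (z : Coord n) : Coord n :=
  coframe p (chartInv p z) (Y (chartInv p z))

/-- The coordinate vector fields. -/
def coordField (p : M) (a : Coord n) : VField n M := fun x => frame p x a

variable (n) in
lemma isOpen_chartDomain (p : M) : IsOpen (chartDomain n p) := (chartAt (Coord n) p).open_source

variable (n) in
lemma mem_chartDomain (p : M) : p ∈ chartDomain n p := mem_chart_source _ p

variable (n) in
lemma isOpen_chartRange (p : M) : IsOpen (chartRange n p) := isOpen_extChartAt_target p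

variable (n) in
lemma chartDomain_eq (p : M) : chartDomain n p = (extChartAt (𝓡 n) p).source := by
  rw [extChartAt_source]; rfl

lemma chartInv_mem {p : M} {z : Coord n} (hz : z ∈ chartRange n p) :
    chartInv p z ∈ chartDomain n p := by
  rw [chartDomain_eq]
  exact (extChartAt (𝓡 n) p).map_target hz

lemma exists_chartInv_eq {p x : M} (hx : x ∈ chartDomain n p) :
    ∃ z ∈ chartRange n p, chartInv p z = x := by
  rw [chartDomain_eq] at hx
  exact ⟨extChartAt (𝓡 n) p x, (extChartAt (𝓡 n) p).map_source hx,
    (extChartAt (𝓡 n) p).left_inv hx⟩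

lemma coframe_frame {p x : M} (hx : x ∈ chartDomain n p) (a : Coord n) :
    coframe p x (frame p x a) = a :=
  (trivializationAt (Coord n) (TangentSpace (𝓡 n)) p).continuousLinearMapAt_symmL hx a

lemma frame_coframe {p x : M} (hx : x ∈ chartDomain n p) (v : TangentSpace (𝓡 n) x) :
    frame p x (coframe p x v) = v :=
  (trivializationAt (Coord n) (TangentSpace (𝓡 n)) p).symmL_continuousLinearMapAt hx v

lemma contMDiffAt_chartInv {p : M} {z : Coord n} (hz : z ∈ chartRange n p) :
    ContMDiffAt 𝓘(ℝ, Coord n) (𝓡 n) ∞ (chartInv p) z :=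
  (contMDiffOn_extChartAt_symm p).contMDiffAt ((isOpen_chartRange n p).mem_nhds hz)

lemma continuousAt_chartInv {p : M} {z : Coord n} (hz : z ∈ chartRange n p) :
    ContinuousAt (chartInv p) z := (contMDiffAt_chartInv hz).continuousAt

lemma mfderiv_chartInv {p : M} {z : Coord n} (hz : z ∈ chartRange n p) :
    mfderiv 𝓘(ℝ, Coord n) (𝓡 n) (chartInv p) z = frame p (chartInv p z) := by
  have h := TangentBundle.symmL_trivializationAt (I := 𝓡 n) (chartInv_mem hz)
  rw [frame, h]
  have : extChartAt (𝓡 n) p (chartInv p z) = z := (extChartAt (𝓡 n) p).right_inv hz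
  rw [this]
  simp [chartInv]
  rfl

/-- Directional derivatives in coordinates. -/
lemma dirDeriv_frame {p : M} {z : Coord n} (hz : z ∈ chartRange n p) {f : M → ℝ}
    (hf : MDifferentiableAt (𝓡 n) 𝓘(ℝ, ℝ) f (chartInv p z)) (a : Coord n) :
    dirDeriv f (chartInv p z) (frame p (chartInv p z) a)
      = fderiv ℝ (fun y => f (chartInv p y)) z a := by
  have h1 := mfderiv_comp z hf ((contMDiffAt_chartInv hz).mdifferentiableAt (by simp))
  rw [mfderiv_chartInv hz, mfderiv_eq_fderiv] at h1
  change _ = fderiv ℝ (f ∘ chartInv p) z a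
  rw [h1]
  rfl

lemma dirDeriv_eq {p : M} {z : Coord n} (hz : z ∈ chartRange n p) {f : M → ℝ}
    (hf : MDifferentiableAt (𝓡 n) 𝓘(ℝ, ℝ) f (chartInv p z))
    (v : TangentSpace (𝓡 n) (chartInv p z)) :
    dirDeriv f (chartInv p z) v
      = fderiv ℝ (fun y => f (chartInv p y)) z (coframe p (chartInv p z) v) := by
  rw [← dirDeriv_frame hz hf, frame_coframe (chartInv_mem hz)]

lemma smoothOn_iff {p : M} {U : Set M} (hU : IsOpen U) (hUp : U ⊆ chartDomain n p)
    (Y : VField n M) : SmoothOn Y U ↔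
      ContMDiffOn (𝓡 n) 𝓘(ℝ, Coord n) ∞ (fun x => coframe p x (Y x)) U := by
  have h := (trivializationAt (Coord n) (TangentSpace (𝓡 n)) p).contMDiffOn_section_iff
    (IB := 𝓡 n) (n := ∞) (s := Y) hU hUp
  refine Iff.trans h ?_
  refine contMDiffOn_congr fun x hx => ?_
  rw [coframe, Bundle.Trivialization.continuousLinearMapAt_apply]
  rw [Bundle.Trivialization.linearMapAt_apply]
  exact (if_pos (hUp hx)).symm

lemma SmoothOn.mono {Y : VField n M} {U U' : Set M} (h : SmoothOn Y U) (hU : U' ⊆ U) :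
    SmoothOn Y U' := ContMDiffOn.mono h hU

lemma smoothOn_coordField (p : M) (a : Coord n) : SmoothOn (coordField p a) (chartDomain n p) := by
  rw [smoothOn_iff (isOpen_chartDomain n p) subset_rfl]
  exact contMDiffOn_const.congr fun x hx => coframe_frame hx a

/-- A function which is smooth near a point is smooth in coordinates. -/
lemma contDiffAt_comp_chartInv {F : Type*} [NormedAddCommGroup F] [NormedSpace ℝ F]
    {p : M} {z : Coord n} (hz : z ∈ chartRange n p) {f : M → F}
    (hf : ContMDiffAt (𝓡 n) 𝓘(ℝ, F) ∞ f (chartInv p z)) :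
    ContDiffAt ℝ ∞ (fun y => f (chartInv p y)) z :=
  (hf.comp z (contMDiffAt_chartInv hz)).contDiffAt

lemma contMDiffAt_coframe {p x : M} {U : Set M} (hU : IsOpen U) (hxU : x ∈ U)
    (hx : x ∈ chartDomain n p) {Y : VField n M} (hY : SmoothOn Y U) :
    ContMDiffAt (𝓡 n) 𝓘(ℝ, Coord n) ∞ (fun x => coframe p x (Y x)) x := by
  have h := (smoothOn_iff (hU.inter (isOpen_chartDomain n p)) Set.inter_subset_right Y).mp
    (hY.mono Set.inter_subset_left)
  exact h.contMDiffAt ((hU.inter (isOpen_chartDomain n p)).mem_nhds ⟨hxU, hx⟩)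

lemma contDiffAt_rep {p : M} {z : Coord n} (hz : z ∈ chartRange n p) {U : Set M} (hU : IsOpen U)
    (hzU : chartInv p z ∈ U) {Y : VField n M} (hY : SmoothOn Y U) :
    ContDiffAt ℝ ∞ (rep p Y) z :=
  contDiffAt_comp_chartInv hz (contMDiffAt_coframe hU hzU (chartInv_mem hz) hY)

lemma differentiableAt_rep {p : M} {z : Coord n} (hz : z ∈ chartRange n p) {U : Set M}
    (hU : IsOpen U) (hzU : chartInv p z ∈ U) {Y : VField n M} (hY : SmoothOn Y U) :
    DifferentiableAt ℝ (rep p Y) z :=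
  (contDiffAt_rep hz hU hzU hY).differentiableAt (by simp)

lemma rep_coordField {p : M} {z : Coord n} (hz : z ∈ chartRange n p) (a : Coord n) :
    rep p (coordField p a) z = a := coframe_frame (chartInv_mem hz) a

lemma SmoothOn.mdifferentiableAt {Y : VField n M} {U : Set M} (hU : IsOpen U)
    (hY : SmoothOn Y U) {x : M} (hx : x ∈ U) :
    MDifferentiableAt (𝓡 n) (𝓡 n).tangent
      (fun x => (⟨x, Y x⟩ : TangentBundle (𝓡 n) M)) x :=
  (hY.contMDiffAt (hU.mem_nhds hx)).mdifferentiableAt (by simp)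

/-- The coordinate representation is the pullback along the inverse chart, so naturality of the Lie
bracket applies to it. -/
lemma mpullback_chartInv {p : M} {z : Coord n} (hz : z ∈ chartRange n p) (Y : VField n M) :
    VectorField.mpullback 𝓘(ℝ, Coord n) (𝓡 n) (chartInv p) Y z = rep p Y z := by
  let e : Coord n ≃L[ℝ] TangentSpace (𝓡 n) (chartInv p z) :=
    ContinuousLinearEquiv.equivOfInverse (frame p (chartInv p z)) (coframe p (chartInv p z))
      (coframe_frame (chartInv_mem hz)) (frame_coframe (chartInv_mem hz))
  rw [VectorField.mpullback_apply, mfderiv_chartInv hz]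
  have : frame p (chartInv p z) = (e : Coord n →L[ℝ] TangentSpace (𝓡 n) (chartInv p z)) := rfl
  rw [this]
  erw [ContinuousLinearMap.inverse_equiv]
  rfl

/-- The Lie bracket in coordinates. -/
lemma coframe_mlieBracket {p : M} {z : Coord n} (hz : z ∈ chartRange n p) {U : Set M}
    (hU : IsOpen U) (hzU : chartInv p z ∈ U) {X Y : VField n M} (hX : SmoothOn X U)
    (hY : SmoothOn Y U) :
    coframe p (chartInv p z) (VectorField.mlieBracket (𝓡 n) X Y (chartInv p z))
      = fderiv ℝ (rep p Y) z (rep p X z) - fderiv ℝ (rep p X) z (rep p Y z) := by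
  have : IsManifold (𝓡 n) (minSmoothness ℝ 2) M := by
    rw [minSmoothness_of_isRCLikeNormedField]
    exact IsManifold.of_le (n := ∞) (WithTop.coe_le_coe.mpr le_top)
  have h := VectorField.mpullback_mlieBracket (I := 𝓘(ℝ, Coord n)) (I' := 𝓡 n) (n := ∞)
    (hX.mdifferentiableAt hU hzU) (hY.mdifferentiableAt hU hzU) (contMDiffAt_chartInv hz)
    (by simp; exact WithTop.coe_le_coe.mpr le_top)
  rw [mpullback_chartInv hz] at h
  refine Eq.trans h ?_
  have h2 (Y : VField n M) : VectorField.mpullback 𝓘(ℝ, Coord n) (𝓡 n) (chartInv p) Y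
      =ᶠ[𝓝 z] rep p Y := by
    filter_upwards [(isOpen_chartRange n p).mem_nhds hz] with y hy using mpullback_chartInv hy Y
  rw [Filter.EventuallyEq.mlieBracket_vectorField_eq (h2 X) (h2 Y)]
  have h3 := VectorField.mlieBracketWithin_eq_lieBracketWithin (𝕜 := ℝ) (V := rep p X)
    (W := rep p Y) (s := Set.univ)
  rw [VectorField.lieBracketWithin_univ] at h3
  exact (congrFun (VectorField.mlieBracketWithin_univ (I := 𝓘(ℝ, Coord n)) (V := rep p X)
    (W := rep p Y)) z).symm.trans (congrFun h3 z)

end Coordinates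

/-! ### The metric, the 3-form and the Koszul formula in a chart. -/

section CoordinateConnection

variable {n : ℕ} {M : Type*} [TopologicalSpace M] [ChartedSpace (EuclideanSpace ℝ (Fin n)) M]
  [IsManifold (𝓡 n) ∞ M]

/-! ## The connection in coordinates -/

instance (x : M) : FiniteDimensional ℝ (TangentSpace (𝓡 n) x) :=
  inferInstanceAs (FiniteDimensional ℝ (EuclideanSpace ℝ (Fin n)))

lemma ext_eq_coordField {x y : M} (v : TangentSpace (𝓡 n) x) (hy : y ∈ chartDomain n x) :
    ext v y = coordField x (coframe x x v) y := by
  have h : coframe x x v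
      = ((trivializationAt (Coord n) (TangentSpace (𝓡 n)) x) ⟨x, v⟩).2 := by
    rw [coframe, Bundle.Trivialization.continuousLinearMapAt_apply,
      Bundle.Trivialization.linearMapAt_apply]
    exact if_pos (mem_chartDomain n x)
  rw [h]
  exact (Bundle.Trivialization.symmL_apply (R := ℝ) _ hy _).symm

lemma SmoothOn.congr {X Y : VField n M} {U : Set M} (hY : SmoothOn Y U)
    (h : ∀ x ∈ U, X x = Y x) : SmoothOn X U :=
  ContMDiffOn.congr hY fun x hx => by rw [h x hx]

lemma smoothOn_ext {x : M} (v : TangentSpace (𝓡 n) x) : SmoothOn (ext v) (chartDomain n x) :=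
  (smoothOn_coordField x _).congr fun _ hy => ext_eq_coordField v hy

lemma ext_self {x : M} (v : TangentSpace (𝓡 n) x) : ext v x = v :=
  FiberBundle.extend_apply_self _ v

variable (g : Metric n M)

/-- The metric at `x`, as a bilinear form. -/
def metricAt (x : M) : TangentSpace (𝓡 n) x →ₗ[ℝ] TangentSpace (𝓡 n) x →ₗ[ℝ] ℝ :=
  LinearMap.mk₂ ℝ (fun v w => g.inner x v w) (by simp) (by simp) (by simp) (by simp)

lemma metricAt_apply (x : M) (v w : TangentSpace (𝓡 n) x) : metricAt g x v w = g.inner x v w := rfl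

lemma eq_of_inner_eq {x : M} {v w : TangentSpace (𝓡 n) x}
    (h : ∀ u, g.inner x v u = g.inner x w u) : v = w := by
  by_contra hvw
  have h1 := g.pos x (v - w) (sub_ne_zero.mpr hvw)
  have h2 : metricAt g x (v - w) = 0 := by
    ext u
    rw [map_sub, LinearMap.sub_apply, metricAt_apply, metricAt_apply, h, sub_self]; rfl
  rw [← metricAt_apply, h2] at h1
  exact lt_irrefl _ h1

/-- Positive definiteness and equality of dimensions make the metric an isomorphism onto the dual
space, so the vector chosen in `sharp` has its defining property for every linear form. -/
lemma inner_sharp (x : M) (α : TangentSpace (𝓡 n) x →ₗ[ℝ] ℝ) (z : TangentSpace (𝓡 n) x) :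
    g.inner x (sharp g x α) z = α z := by
  have hinj : Function.Injective (metricAt g x) := fun v w h =>
    eq_of_inner_eq g fun u => congrArg (fun f => f u) h
  have hsurj : Function.Surjective (metricAt g x) :=
    (LinearMap.injective_iff_surjective_of_finrank_eq_finrank
      (Subspace.dual_finrank_eq (K := ℝ) (V := TangentSpace (𝓡 n) x)).symm).mp hinj
  obtain ⟨w, hw⟩ := hsurj α
  have h : ∃ w, ∀ z, g.inner x w z = α z := ⟨w, fun z => congrArg (fun f => f z) hw⟩
  exact Classical.epsilon_spec h z

lemma contMDiffOn_inner {U : Set M} {X Y : VField n M} (hX : SmoothOn X U) (hY : SmoothOn Y U) :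
    ContMDiffOn (𝓡 n) 𝓘(ℝ, ℝ) ∞ (fun x => g.inner x (X x) (Y x)) U := by
  intro x hx
  have : ContMDiffWithinAt (𝓡 n) ((𝓡 n).prod 𝓘(ℝ)) ∞
      (fun m ↦ Bundle.TotalSpace.mk' ℝ (E := Bundle.Trivial M ℝ) m
        (g.inner m (X m) (Y m))) U x := by
    apply ContMDiffWithinAt.clm_bundle_apply₂ (F₁ := Coord n) (F₂ := Coord n)
    · exact (g.contMDiff x).contMDiffWithinAt
    · exact hX x hx
    · exact hY x hx
  simp only [Bundle.contMDiffWithinAt_totalSpace] at this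
  exact this.2

/-- Continuity of the components of a trilinear map on a finite-dimensional space. -/
def trilinearCLM {E : Type*} [NormedAddCommGroup E] [NormedSpace ℝ E] [FiniteDimensional ℝ E]
    (L : E →ₗ[ℝ] E →ₗ[ℝ] E →ₗ[ℝ] ℝ) : E →L[ℝ] E →L[ℝ] E →L[ℝ] ℝ :=
  LinearMap.toContinuousLinearMap
    { toFun := fun a => LinearMap.toContinuousBilinearMap (L a)
      map_add' := fun a b => by ext; simp
      map_smul' := fun c a => by ext; simp }

variable {g} {τ : TriForm n M}

lemma contDiffOn_comp_chartInv {F : Type*} [NormedAddCommGroup F] [NormedSpace ℝ F] {p : M}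
    {f : M → F} (hf : ContMDiffOn (𝓡 n) 𝓘(ℝ, F) ∞ f (chartDomain n p)) :
    ContDiffOn ℝ ∞ (fun z => f (chartInv p z)) (chartRange n p) := fun _ hz =>
  (contDiffAt_comp_chartInv hz (hf.contMDiffAt
    ((isOpen_chartDomain n p).mem_nhds (chartInv_mem hz)))).contDiffWithinAt

variable (g) in
/-- The metric in coordinates. -/
def coordMetric (p : M) (z : Coord n) : Coord n →L[ℝ] Coord n →L[ℝ] ℝ :=
  LinearMap.toContinuousBilinearMap ((metricAt g (chartInv p z)).compl₁₂
    (frame (n := n) p (chartInv p z)).toLinearMap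
    (frame (n := n) p (chartInv p z)).toLinearMap)

lemma coordMetric_apply (p : M) (z a b : Coord n) : coordMetric g p z a b
    = g.inner (chartInv p z) (frame p (chartInv p z) a) (frame p (chartInv p z) b) := rfl

variable (τ) in
/-- The `3`-form in coordinates. -/
def coordForm (p : M) (z : Coord n) : Coord n →L[ℝ] Coord n →L[ℝ] Coord n →L[ℝ] ℝ :=
  trilinearCLM
    { toFun := fun a => (τ (chartInv p z) (frame p (chartInv p z) a)).compl₁₂
        (frame (n := n) p (chartInv p z)).toLinearMap
        (frame (n := n) p (chartInv p z)).toLinearMap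
      map_add' := fun a b => by ext; simp
      map_smul' := fun c a => by ext; simp }

lemma coordForm_apply (p : M) (z a b c : Coord n) : coordForm τ p z a b c
    = τ (chartInv p z) (frame p (chartInv p z) a) (frame p (chartInv p z) b)
      (frame p (chartInv p z) c) := rfl

variable (g) in
/-- The metric and the `3`-form in the chart at `p`. -/
def localGeometry (hτ : IsThreeForm τ) (p : M) : LocalGeometry (Coord n) where
  domain := chartRange n p
  isOpen_domain := isOpen_chartRange n p
  metric := coordMetric g p
  form := coordForm τ p
  contDiffOn_metric := by
    simp_rw [contDiffOn_clm_apply]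
    exact fun a b => contDiffOn_comp_chartInv
      (contMDiffOn_inner g (smoothOn_coordField p a) (smoothOn_coordField p b))
  contDiffOn_form := by
    simp_rw [contDiffOn_clm_apply]
    exact fun a b c => contDiffOn_comp_chartInv (hτ.smooth _ _ _ _ (isOpen_chartDomain n p)
      (smoothOn_coordField p a) (smoothOn_coordField p b) (smoothOn_coordField p c))
  metric_symm z _ a b := g.symm _ _ _
  metric_pos z hz a ha := g.pos _ _ fun h => ha (by
    have h' : frame p (chartInv p z) a = 0 := h
    rw [← coframe_frame (chartInv_mem hz) a, h', map_zero])
  form_alt_left z _ a b := hτ.alt_left _ _ _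
  form_alt_right z _ a b := hτ.alt_right _ _ _

variable (hτ : IsThreeForm τ) {p : M} {z : Coord n}

lemma localGeometry_metric : (localGeometry g hτ p).metric = coordMetric g p := rfl

lemma localGeometry_form : (localGeometry g hτ p).form = coordForm τ p := rfl

lemma coordMetric_coframe (hz : z ∈ chartRange n p) (v w : TangentSpace (𝓡 n) (chartInv p z)) :
    coordMetric g p z (coframe p (chartInv p z) v) (coframe p (chartInv p z) w)
      = g.inner (chartInv p z) v w := by
  rw [coordMetric_apply, frame_coframe (chartInv_mem hz), frame_coframe (chartInv_mem hz)]

lemma coordForm_coframe (hz : z ∈ chartRange n p) (u v w : TangentSpace (𝓡 n) (chartInv p z)) :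
    coordForm τ p z (coframe p (chartInv p z) u) (coframe p (chartInv p z) v)
      (coframe p (chartInv p z) w) = τ (chartInv p z) u v w := by
  rw [coordForm_apply, frame_coframe (chartInv_mem hz), frame_coframe (chartInv_mem hz),
    frame_coframe (chartInv_mem hz)]

include hτ in
/-- The derivative of a scalar product in coordinates. -/
lemma dirDeriv_inner (hz : z ∈ chartRange n p) {U : Set M} (hU : IsOpen U)
    (hzU : chartInv p z ∈ U) {X Y : VField n M} (hX : SmoothOn X U) (hY : SmoothOn Y U)
    (v : TangentSpace (𝓡 n) (chartInv p z)) :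
    dirDeriv (fun y => g.inner y (X y) (Y y)) (chartInv p z) v
      = fderiv ℝ (coordMetric g p) z (coframe p _ v) (rep p X z) (rep p Y z)
        + coordMetric g p z (fderiv ℝ (rep p X) z (coframe p _ v)) (rep p Y z)
        + coordMetric g p z (rep p X z) (fderiv ℝ (rep p Y) z (coframe p _ v)) := by
  have hf := ((contMDiffOn_inner g hX hY).contMDiffAt (hU.mem_nhds hzU)).mdifferentiableAt
    (by simp)
  rw [dirDeriv_eq hz hf]
  have heq : (fun y => g.inner (chartInv p y) (X (chartInv p y)) (Y (chartInv p y)))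
      =ᶠ[𝓝 z] fun y => coordMetric g p y (rep p X y) (rep p Y y) := by
    filter_upwards [(isOpen_chartRange n p).mem_nhds hz] with y hy
    exact (coordMetric_coframe hy _ _).symm
  rw [heq.fderiv_eq]
  exact LocalGeometry.fderiv_apply_apply
    ((localGeometry g hτ p).differentiableAt_of_domain
      (localGeometry g hτ p).contDiffOn_metric hz)
    (differentiableAt_rep hz hU hzU hX) (differentiableAt_rep hz hU hzU hY) _

include hτ in
/-- The Koszul formula in coordinates. -/
lemma koszul_eq (hz : z ∈ chartRange n p) {U : Set M} (hU : IsOpen U)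
    (hzU : chartInv p z ∈ U) {X Y Z : VField n M} (hX : SmoothOn X U) (hY : SmoothOn Y U)
    (hZ : SmoothOn Z U) :
    koszul g X Y Z (chartInv p z) = 2 * (coordMetric g p z
      (fderiv ℝ (rep p Y) z (rep p X z)) (rep p Z z)
        + (localGeometry g hτ p).koszulForm z (rep p X z) (rep p Y z) (rep p Z z)) := by
  have hs (a b : Coord n) : coordMetric g p z a b = coordMetric g p z b a := g.symm _ _ _
  rw [koszul, dirDeriv_inner hτ hz hU hzU hY hZ, dirDeriv_inner hτ hz hU hzU hX hZ,
    dirDeriv_inner hτ hz hU hzU hX hY, ← coordMetric_coframe hz (VectorField.mlieBracket _ X Y _),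
    ← coordMetric_coframe hz (VectorField.mlieBracket _ X Z _),
    ← coordMetric_coframe hz (VectorField.mlieBracket _ Y Z _),
    coframe_mlieBracket hz hU hzU hX hY, coframe_mlieBracket hz hU hzU hX hZ,
    coframe_mlieBracket hz hU hzU hY hZ, LocalGeometry.koszulForm_apply, localGeometry_metric]
  simp only [map_sub, sub_apply, ← rep.eq_1]
  rw [hs (rep p X z) (fderiv ℝ (rep p Z) z (rep p Y z)),
    hs (rep p X z) (fderiv ℝ (rep p Y) z (rep p Z z)),
    hs (rep p Y z) (fderiv ℝ (rep p Z) z (rep p X z))]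
  ring

end CoordinateConnection

/-! ### Torsion, Casimir endomorphism and connection on tangent spaces, compared with coordinates.
-/

section TangentAlgebra

variable {n : ℕ} {M : Type*} [TopologicalSpace M] [ChartedSpace (EuclideanSpace ℝ (Fin n)) M]
  [IsManifold (𝓡 n) ∞ M]

/-! ## The torsion and its Casimir endomorphism on tangent spaces -/

variable {g : Metric n M} {τ : TriForm n M}

lemma inner_add_left {x : M} (u v w : TangentSpace (𝓡 n) x) :
    g.inner x (u + v) w = g.inner x u w + g.inner x v w :=
  congrArg (fun f => f w) (map_add (metricAt g x) u v)

lemma inner_sub_left {x : M} (u v w : TangentSpace (𝓡 n) x) :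
    g.inner x (u - v) w = g.inner x u w - g.inner x v w :=
  congrArg (fun f => f w) (map_sub (metricAt g x) u v)

lemma inner_smul_left {x : M} (c : ℝ) (v w : TangentSpace (𝓡 n) x) :
    g.inner x (c • v) w = c * g.inner x v w :=
  congrArg (fun f => f w) (map_smul (metricAt g x) c v)

lemma inner_add_right {x : M} (u v w : TangentSpace (𝓡 n) x) :
    g.inner x u (v + w) = g.inner x u v + g.inner x u w := map_add (metricAt g x u) v w

lemma inner_sub_right {x : M} (u v w : TangentSpace (𝓡 n) x) :
    g.inner x u (v - w) = g.inner x u v - g.inner x u w := map_sub (metricAt g x u) v w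

lemma inner_smul_right {x : M} (c : ℝ) (v w : TangentSpace (𝓡 n) x) :
    g.inner x v (c • w) = c * g.inner x v w := map_smul (metricAt g x v) c w

lemma sharp_inner {x : M} (w : TangentSpace (𝓡 n) x) {f : TangentSpace (𝓡 n) x → ℝ}
    (hf : ∀ u, f u = g.inner x w u) : sharp g x f = w := by
  refine eq_of_inner_eq g fun u => ?_
  have : f = metricAt g x w := funext hf
  rw [this, inner_sharp, metricAt_apply]

variable (g) in
/-- The isomorphism of cotangent and tangent space defined by the metric. -/
def raiseAt (x : M) : (TangentSpace (𝓡 n) x →ₗ[ℝ] ℝ) →ₗ[ℝ] TangentSpace (𝓡 n) x where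
  toFun α := sharp g x α
  map_add' α β := eq_of_inner_eq g fun u => by
    rw [inner_sharp, inner_add_left, inner_sharp, inner_sharp, LinearMap.add_apply]
  map_smul' c α := eq_of_inner_eq g fun u => by
    rw [inner_sharp, inner_smul_left, inner_sharp, LinearMap.smul_apply, RingHom.id_apply,
      smul_eq_mul]

lemma inner_raiseAt (x : M) (α : TangentSpace (𝓡 n) x →ₗ[ℝ] ℝ) (z : TangentSpace (𝓡 n) x) :
    g.inner x (raiseAt g x α) z = α z := inner_sharp g x α z

lemma IsThreeForm.swap_right (hτ : IsThreeForm τ) (x : M) (u v w : TangentSpace (𝓡 n) x) :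
    τ x u v w = - τ x u w v := by
  have h := hτ.alt_right x u (v + w)
  simp only [map_add, LinearMap.add_apply, hτ.alt_right] at h
  linarith

variable (g τ) in
/-- The endomorphisms `τ_u` with `g(τ_u v, w) = τ(u, v, w)`. -/
def torsionAt (x : M) :
    TangentSpace (𝓡 n) x →ₗ[ℝ] TangentSpace (𝓡 n) x →ₗ[ℝ] TangentSpace (𝓡 n) x where
  toFun u := raiseAt g x ∘ₗ τ x u
  map_add' u v := by ext w; simp
  map_smul' c u := by ext w; simp

lemma inner_torsionAt (x : M) (u v w : TangentSpace (𝓡 n) x) :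
    g.inner x (torsionAt g τ x u v) w = τ x u v w := inner_sharp g x _ _

variable (g) in
/-- The tangent space at `x` with its metric and torsion. -/
def torsionSpace (hτ : IsThreeForm τ) (x : M) : TorsionSpace (TangentSpace (𝓡 n) x) where
  b := metricAt g x
  t := torsionAt g τ x
  symm v w := g.symm x v w
  pos v hv := g.pos x v hv
  alt u := eq_of_inner_eq g fun w => by rw [inner_torsionAt, hτ.alt_left, map_zero]; rfl
  skew u v w := by
    change g.inner x (torsionAt g τ x u v) w = - g.inner x v (torsionAt g τ x u w)
    rw [g.symm x v, inner_torsionAt, inner_torsionAt, hτ.swap_right]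

/-- For skew `A`, the action on the 3-form is the action on the `(2,1)`-tensor with an index
lowered, so invariance of the form becomes a derivation rule. -/
lemma mem_stab_iff (hτ : IsThreeForm τ) (x : M) (A : Module.End ℝ (TangentSpace (𝓡 n) x)) :
    A ∈ stab g τ x ↔ (torsionSpace g hτ x).IsStab A := by
  have key (hA : ∀ v w, g.inner x (A v) w + g.inner x v (A w) = 0)
      (u v w : TangentSpace (𝓡 n) x) : τ x (A u) v w + τ x u (A v) w + τ x u v (A w)
      = g.inner x (torsionAt g τ x (A u) v + torsionAt g τ x u (A v)) w
        - g.inner x (A (torsionAt g τ x u v)) w := by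
    have := hA (torsionAt g τ x u v) w
    rw [inner_torsionAt] at this
    rw [map_add, add_apply, inner_torsionAt, inner_torsionAt]
    linarith
  constructor
  · rintro ⟨h1, h2⟩
    refine ⟨fun v w => eq_neg_of_add_eq_zero_left (h1 v w), fun u v => ?_⟩
    refine eq_of_inner_eq g fun w => ?_
    have := h2 u v w
    rw [key h1] at this
    exact (sub_eq_zero.mp this).symm
  · rintro ⟨h1, h2⟩
    have h1' (v w : TangentSpace (𝓡 n) x) : g.inner x (A v) w + g.inner x v (A w) = 0 :=
      add_eq_zero_iff_eq_neg.mpr (h1 v w)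
    refine ⟨h1', fun u v w => ?_⟩
    rw [key h1', sub_eq_zero]
    exact congrArg (fun y => g.inner x y w) (h2 u v).symm

variable (g τ) in
/-- The endomorphism `S` with `g(S u, v) = -tr (τ_u τ_v)`. -/
def casimirAt (x : M) : Module.End ℝ (TangentSpace (𝓡 n) x) :=
  raiseAt g x ∘ₗ LinearMap.mk₂ ℝ
    (fun u v => - LinearMap.trace ℝ _ (torsionAt g τ x u ∘ₗ torsionAt g τ x v))
    (fun u v w => by rw [map_add, LinearMap.add_comp, map_add]; ring)
    (fun c u v => by rw [map_smul, LinearMap.smul_comp, map_smul, smul_neg])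
    (fun u v w => by rw [map_add, LinearMap.comp_add, map_add]; ring)
    (fun c u v => by rw [map_smul, LinearMap.comp_smul, map_smul, smul_neg])

lemma inner_casimirAt (x : M) (u v : TangentSpace (𝓡 n) x) : g.inner x (casimirAt g τ x u) v
    = - LinearMap.trace ℝ _ (torsionAt g τ x u ∘ₗ torsionAt g τ x v) := inner_raiseAt x _ _

/-! ### Comparison with coordinates -/

/-- The isomorphism of the tangent space with the model space given by the chart at `p`. -/
def coframeEquiv {p x : M} (hx : x ∈ chartDomain n p) : TangentSpace (𝓡 n) x ≃ₗ[ℝ] Coord n where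
  toFun := coframe p x
  invFun := frame p x
  map_add' := map_add _
  map_smul' := map_smul _
  left_inv := frame_coframe hx
  right_inv := coframe_frame hx

variable (hτ : IsThreeForm τ) {p : M} {z : Coord n}

lemma coframe_torsionAt (hz : z ∈ chartRange n p) (u v : TangentSpace (𝓡 n) (chartInv p z)) :
    coframe p _ (torsionAt g τ _ u v)
      = (localGeometry g hτ p).tor z (coframe p _ u) (coframe p _ v) := by
  refine (localGeometry g hτ p).metric_ext hz fun c => ?_
  rw [(localGeometry g hτ p).metric_tor hz, localGeometry_metric, localGeometry_form,
    ← coframe_frame (chartInv_mem hz) c, coordMetric_coframe hz, coordForm_coframe hz,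
    inner_torsionAt]

lemma trace_eq_of_coframe (hz : z ∈ chartRange n p)
    (A : Module.End ℝ (TangentSpace (𝓡 n) (chartInv p z))) (B : Coord n →L[ℝ] Coord n)
    (h : ∀ v, coframe p _ (A v) = B (coframe p _ v)) :
    LinearMap.trace ℝ _ A = LocalGeometry.traceL (Coord n) B := by
  rw [LocalGeometry.traceL_apply, ← LinearMap.trace_conj' A (coframeEquiv (chartInv_mem hz))]
  congr 1
  ext1 a
  rw [LinearEquiv.conj_apply_apply]
  change coframe p _ (A (frame p _ a)) = B a
  rw [h, coframe_frame (chartInv_mem hz)]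

lemma coframe_casimirAt (hz : z ∈ chartRange n p) (u : TangentSpace (𝓡 n) (chartInv p z)) :
    coframe p _ (casimirAt g τ _ u) = (localGeometry g hτ p).casimir z (coframe p _ u) := by
  refine (localGeometry g hτ p).metric_ext hz fun c => ?_
  rw [(localGeometry g hτ p).metric_casimir hz, localGeometry_metric,
    ← coframe_frame (chartInv_mem hz) c, coordMetric_coframe hz, inner_casimirAt]
  congr 1
  refine trace_eq_of_coframe hz _ _ fun v => ?_
  rw [LinearMap.comp_apply, ContinuousLinearMap.comp_apply, coframe_torsionAt hτ hz,
    coframe_torsionAt hτ hz]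

lemma trace_casimirAt_pow (hz : z ∈ chartRange n p) (k : ℕ) :
    LinearMap.trace ℝ _ (casimirAt g τ (chartInv p z) ^ k)
      = LocalGeometry.traceL (Coord n) ((localGeometry g hτ p).casimir z ^ k) := by
  refine trace_eq_of_coframe hz _ _ fun v => ?_
  induction k generalizing v with
  | zero => simp
  | succ k ih => rw [pow_succ, pow_succ, Module.End.mul_apply, ih, coframe_casimirAt hτ hz]; rfl

/-- The symbols `chris` belong to `∇^g + τ`, so the torsion must be subtracted again. -/
lemma coframe_leviCivita (hz : z ∈ chartRange n p) {U : Set M} (hU : IsOpen U)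
    (hzU : chartInv p z ∈ U) {Y : VField n M} (hY : SmoothOn Y U)
    (v : TangentSpace (𝓡 n) (chartInv p z)) :
    coframe p _ (leviCivita g Y (chartInv p z) v) = fderiv ℝ (rep p Y) z (coframe p _ v)
      + (localGeometry g hτ p).chris z (coframe p _ v) (rep p Y z)
      - (localGeometry g hτ p).tor z (coframe p _ v) (rep p Y z) := by
  set L := localGeometry g hτ p with hL
  set r := fderiv ℝ (rep p Y) z (coframe p _ v) + L.chris z (coframe p _ v) (rep p Y z)
      - L.tor z (coframe p _ v) (rep p Y z) with hr
  have : leviCivita g Y (chartInv p z) v = frame p _ r := by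
    refine sharp_inner _ fun u => ?_
    -- The fields `ext v` and `ext u` are smooth in the chart centred at the point itself, which
    -- need not be the chart at `p`.
    have hU' := hU.inter (isOpen_chartDomain n (chartInv p z))
    have he (w : TangentSpace (𝓡 n) (chartInv p z)) : rep p (ext w) z = coframe p _ w := by
      rw [rep, ext_self]
    rw [koszul_eq hτ hz hU' ⟨hzU, mem_chartDomain n _⟩
      ((smoothOn_ext v).mono Set.inter_subset_right) (hY.mono Set.inter_subset_left)
      ((smoothOn_ext u).mono Set.inter_subset_right), he, he, ← coordMetric_coframe hz,
      coframe_frame (chartInv_mem hz), hr, ← localGeometry_metric hτ, ← hL]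
    simp only [map_add, map_sub, add_apply, sub_apply]
    rw [L.metric_chris hz, L.metric_tor hz]
    ring
  rw [this, coframe_frame (chartInv_mem hz)]

lemma connection_eq (Y : VField n M) (x : M) (v : TangentSpace (𝓡 n) x) :
    connection g τ Y x v = leviCivita g Y x v + torsionAt g τ x v (Y x) := rfl

lemma coframe_connection (hz : z ∈ chartRange n p) {U : Set M} (hU : IsOpen U)
    (hzU : chartInv p z ∈ U) {Y : VField n M} (hY : SmoothOn Y U)
    (v : TangentSpace (𝓡 n) (chartInv p z)) :
    coframe p _ (connection g τ Y (chartInv p z) v) = fderiv ℝ (rep p Y) z (coframe p _ v)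
      + (localGeometry g hτ p).chris z (coframe p _ v) (rep p Y z) := by
  rw [connection_eq, map_add, coframe_leviCivita hτ hz hU hzU hY, coframe_torsionAt hτ hz,
    ← rep.eq_1, sub_add_cancel]

end TangentAlgebra

/-! ### Metric property, torsion, curvature and parallel tensors on the manifold. -/

section Connection

variable {n : ℕ} {M : Type*} [TopologicalSpace M] [ChartedSpace (EuclideanSpace ℝ (Fin n)) M]
  [IsManifold (𝓡 n) ∞ M]

/-! ## Properties of the connection -/

variable {g : Metric n M} {τ : TriForm n M} {p : M} {z : Coord n}

lemma coframe_injective (hz : z ∈ chartRange n p) {v w : TangentSpace (𝓡 n) (chartInv p z)}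
    (h : coframe p _ v = coframe p _ w) : v = w := by
  rw [← frame_coframe (chartInv_mem hz) v, h, frame_coframe (chartInv_mem hz)]

lemma exists_chartInv (x : M) :
    ∃ (p : M) (z : Coord n), z ∈ chartRange n p ∧ chartInv p z = x :=
  ⟨x, exists_chartInv_eq (mem_chartDomain n x)⟩

lemma rep_eventuallyEq (hz : z ∈ chartRange n p) {U : Set M} (hU : IsOpen U)
    (hzU : chartInv p z ∈ U) {X : VField n M} {f : Coord n → Coord n}
    (h : ∀ y ∈ chartRange n p, chartInv p y ∈ U → rep p X y = f y) : rep p X =ᶠ[𝓝 z] f := by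
  filter_upwards [(isOpen_chartRange n p).mem_nhds hz,
    (continuousAt_chartInv hz).preimage_mem_nhds (hU.mem_nhds hzU)] with y hy hyU using h y hy hyU

lemma fderiv_rep_coordField (hz : z ∈ chartRange n p) (a : Coord n) :
    fderiv ℝ (rep p (coordField p a)) z = 0 := by
  have h : rep p (coordField p a) =ᶠ[𝓝 z] fun _ => a :=
    rep_eventuallyEq hz (isOpen_chartDomain n p) (chartInv_mem hz)
      fun y hy _ => rep_coordField hy a
  rw [h.fderiv_eq, fderiv_fun_const]; rfl

/-- A vector field is smooth if it is smooth in coordinates. -/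
lemma smoothOn_of_contDiffAt_rep {U : Set M} {X : VField n M}
    (h : ∀ p, ∀ z ∈ chartRange n p, chartInv p z ∈ U → ContDiffAt ℝ ∞ (rep p X) z) :
    SmoothOn X U := by
  intro x hx
  have hxs : x ∈ (extChartAt (𝓡 n) x).source := mem_extChartAt_source x
  have h1 := h x (extChartAt (𝓡 n) x x) ((extChartAt (𝓡 n) x).map_source hxs) (by
    rw [chartInv, (extChartAt (𝓡 n) x).left_inv hxs]; exact hx)
  have h2 : ContMDiffAt (𝓡 n) 𝓘(ℝ, Coord n) ∞ (fun y => rep x X (extChartAt (𝓡 n) x y)) x :=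
    h1.contMDiffAt.comp x contMDiffAt_extChartAt
  have h3 : ContMDiffAt (𝓡 n) 𝓘(ℝ, Coord n) ∞ (fun y => coframe x y (X y)) x := by
    refine h2.congr_of_eventuallyEq ?_
    filter_upwards [(isOpen_chartDomain n x).mem_nhds (mem_chartDomain n x)] with y hy
    have : chartInv x (extChartAt (𝓡 n) x y) = y :=
      (extChartAt (𝓡 n) x).left_inv (by rw [← chartDomain_eq]; exact hy)
    rw [rep, this]
  refine ContMDiffAt.contMDiffWithinAt ?_
  refine (Bundle.contMDiffAt_section (IB := 𝓡 n) _).mpr (h3.congr_of_eventuallyEq ?_)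
  filter_upwards [(isOpen_chartDomain n x).mem_nhds (mem_chartDomain n x)] with y hy
  rw [coframe, Bundle.Trivialization.continuousLinearMapAt_apply,
    Bundle.Trivialization.linearMapAt_apply]
  exact (if_pos hy).symm

/-- The `3`-form is parallel in coordinates. -/
lemma IsParallelSkewTorsion.isParallel (hτ : IsParallelSkewTorsion g τ) (p : M) :
    (localGeometry g hτ.threeForm p).IsParallel := by
  intro z hz u a b c
  set L := localGeometry g hτ.threeForm p with hL
  have hz' : z ∈ chartRange n p := hz
  have hp := hτ.parallel (chartDomain n p) _ _ _ (isOpen_chartDomain n p)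
    (smoothOn_coordField p a) (smoothOn_coordField p b) (smoothOn_coordField p c) _
    (chartInv_mem hz') (frame p _ u)
  have hc (a : Coord n) : coframe p _ (connection g τ (coordField p a) (chartInv p z)
      (frame p _ u)) = L.chris z u a := by
    rw [coframe_connection hτ.threeForm hz' (isOpen_chartDomain n p) (chartInv_mem hz')
      (smoothOn_coordField p a), fderiv_rep_coordField hz', rep_coordField hz',
      coframe_frame (chartInv_mem hz'), zero_apply, zero_add]
  have hF := L.differentiableAt_of_domain L.contDiffOn_form hz
  rw [dirDeriv_frame hz' (((hτ.threeForm.smooth _ _ _ _ (isOpen_chartDomain n p)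
    (smoothOn_coordField p a) (smoothOn_coordField p b)
    (smoothOn_coordField p c)).contMDiffAt ((isOpen_chartDomain n p).mem_nhds
      (chartInv_mem hz'))).mdifferentiableAt (by simp)),
    ← coordForm_coframe hz', ← coordForm_coframe hz', ← coordForm_coframe hz',
    hc, hc, hc] at hp
  simp only [← rep.eq_1, rep_coordField hz'] at hp
  have hd : fderiv ℝ (fun y => coordForm τ p y a b c) z u = fderiv ℝ L.form z u a b c := by
    change fderiv ℝ (fun y => L.form y a b c) z u = _
    rw [LocalGeometry.fderiv_apply_const ((hF.clm_apply (differentiableAt_const a)).clm_apply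
      (differentiableAt_const b)),
      LocalGeometry.fderiv_apply_const (hF.clm_apply (differentiableAt_const a)),
      LocalGeometry.fderiv_apply_const hF]
  have hp' : fderiv ℝ (fun y => coordForm τ p y a b c) z u - L.form z (L.chris z u a) b c
    - L.form z a (L.chris z u b) c - L.form z a b (L.chris z u c) = 0 := hp
  rw [hd] at hp'
  linarith

section

variable {U : Set M} (hU : IsOpen U) {x : M} (hx : x ∈ U) {X Y : VField n M}

include hU hx

/-- The connection is metric. -/
lemma dirDeriv_inner_eq (hτ : IsThreeForm τ) (hX : SmoothOn X U) (hY : SmoothOn Y U)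
    (v : TangentSpace (𝓡 n) x) :
    dirDeriv (fun y => g.inner y (X y) (Y y)) x v
      = g.inner x (connection g τ X x v) (Y x) + g.inner x (X x) (connection g τ Y x v) := by
  obtain ⟨p, z, hz, rfl⟩ := exists_chartInv (n := n) x
  rw [dirDeriv_inner hτ hz hU hx hX hY, ← coordMetric_coframe hz, ← coordMetric_coframe hz,
    coframe_connection hτ hz hU hx hX, coframe_connection hτ hz hU hx hY,
    ← localGeometry_metric hτ, (localGeometry g hτ p).fderiv_metric hz]
  simp only [map_add, add_apply, ← rep.eq_1]
  ring

/-- The torsion of the connection. -/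
lemma connection_sub_connection (hτ : IsThreeForm τ) (hX : SmoothOn X U) (hY : SmoothOn Y U) :
    connection g τ Y x (X x) - connection g τ X x (Y x)
      = VectorField.mlieBracket (𝓡 n) X Y x + (2 : ℝ) • torsionAt g τ x (X x) (Y x) := by
  obtain ⟨p, z, hz, rfl⟩ := exists_chartInv (n := n) x
  apply coframe_injective hz
  rw [map_sub, map_add, map_smul, coframe_connection hτ hz hU hx hX,
    coframe_connection hτ hz hU hx hY, coframe_mlieBracket hz hU hx hX hY,
    coframe_torsionAt hτ hz]
  simp only [← rep.eq_1]
  rw [← (localGeometry g hτ p).chris_sub_chris hz]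
  abel

lemma connection_congr (hτ : IsThreeForm τ) (hY : SmoothOn Y U) (h : ∀ y ∈ U, X y = Y y)
    (v : TangentSpace (𝓡 n) x) : connection g τ X x v = connection g τ Y x v := by
  obtain ⟨p, z, hz, rfl⟩ := exists_chartInv (n := n) x
  apply coframe_injective hz
  have hr : rep p X =ᶠ[𝓝 z] rep p Y :=
    rep_eventuallyEq hz hU hx fun y _ hy => by rw [rep, rep, h _ hy]
  rw [coframe_connection hτ hz hU hx (hY.congr h), coframe_connection hτ hz hU hx hY,
    hr.fderiv_eq, hr.self_of_nhds]

lemma connection_const_smul (hτ : IsThreeForm τ) (hY : SmoothOn Y U) (c : ℝ)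
    (v : TangentSpace (𝓡 n) x) :
    connection g τ (fun y => c • Y y) x v = c • connection g τ Y x v := by
  obtain ⟨p, z, hz, rfl⟩ := exists_chartInv (n := n) x
  apply coframe_injective hz
  have hr : rep p (fun y => c • Y y) = fun y => c • rep p Y y := by
    funext y; rw [rep, map_smul, rep]
  have hs : SmoothOn (fun y => c • Y y) U := ContMDiffOn.const_smul_section hY
  rw [coframe_connection hτ hz hU hx hs, map_smul, coframe_connection hτ hz hU hx hY, hr,
    fderiv_fun_const_smul (differentiableAt_rep hz hU hx hY), map_smul, smul_add, smul_apply]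

/-- The torsion is parallel. -/
lemma connection_torsionAt (hτ : IsParallelSkewTorsion g τ) (hX : SmoothOn X U)
    (hY : SmoothOn Y U) (v : TangentSpace (𝓡 n) x)
    (hs : SmoothOn (fun y => torsionAt g τ y (X y) (Y y)) U) :
    connection g τ (fun y => torsionAt g τ y (X y) (Y y)) x v
      = torsionAt g τ x (connection g τ X x v) (Y x)
        + torsionAt g τ x (X x) (connection g τ Y x v) := by
  obtain ⟨p, z, hz, rfl⟩ := exists_chartInv (n := n) x
  apply coframe_injective hz
  have hτ' := hτ.threeForm
  set L := localGeometry g hτ' p with hL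
  have hr : rep p (fun y => torsionAt g τ y (X y) (Y y))
      =ᶠ[𝓝 z] fun y => L.tor y (rep p X y) (rep p Y y) :=
    rep_eventuallyEq hz hU hx fun y hy _ => coframe_torsionAt hτ' hy _ _
  rw [coframe_connection hτ' hz hU hx hs, map_add, coframe_torsionAt hτ' hz,
    coframe_torsionAt hτ' hz, coframe_connection hτ' hz hU hx hX,
    coframe_connection hτ' hz hU hx hY, hr.fderiv_eq, hr.self_of_nhds, ← hL,
    LocalGeometry.fderiv_apply_apply (L.differentiableAt_of_domain L.contDiffOn_tor hz)
      (differentiableAt_rep hz hU hx hX) (differentiableAt_rep hz hU hx hY),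
    (hτ.isParallel p).fderiv_tor hz]
  simp only [map_add, add_apply, ← rep.eq_1, ← hL]
  abel

/-- The Casimir endomorphism is parallel. -/
lemma connection_casimirAt (hτ : IsParallelSkewTorsion g τ) (hY : SmoothOn Y U)
    (v : TangentSpace (𝓡 n) x) (hs : SmoothOn (fun y => casimirAt g τ y (Y y)) U) :
    connection g τ (fun y => casimirAt g τ y (Y y)) x v
      = casimirAt g τ x (connection g τ Y x v) := by
  obtain ⟨p, z, hz, rfl⟩ := exists_chartInv (n := n) x
  apply coframe_injective hz
  have hτ' := hτ.threeForm
  set L := localGeometry g hτ' p with hL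
  have hr : rep p (fun y => casimirAt g τ y (Y y)) =ᶠ[𝓝 z] fun y => L.casimir y (rep p Y y) :=
    rep_eventuallyEq hz hU hx fun y hy _ => coframe_casimirAt hτ' hy _
  have hd := ((L.differentiableAt_of_domain L.contDiffOn_casimir hz).hasFDerivAt.clm_apply
    (differentiableAt_rep hz hU hx hY).hasFDerivAt).fderiv
  rw [coframe_connection hτ' hz hU hx hs, coframe_casimirAt hτ' hz,
    coframe_connection hτ' hz hU hx hY, hr.fderiv_eq, hr.self_of_nhds, ← hL, hd, add_apply,
    ContinuousLinearMap.comp_apply, ContinuousLinearMap.flip_apply,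
    (hτ.isParallel p).fderiv_casimir hz]
  simp only [map_add, ← hL]
  abel

end

lemma SmoothOn.torsionAt (hτ : IsThreeForm τ) {U : Set M} (hU : IsOpen U) {X Y : VField n M}
    (hX : SmoothOn X U) (hY : SmoothOn Y U) :
    SmoothOn (fun y => torsionAt g τ y (X y) (Y y)) U := by
  refine smoothOn_of_contDiffAt_rep fun p z hz hzU => ?_
  set L := localGeometry g hτ p with hL
  have hr : rep p (fun y => SkewTorsion.torsionAt g τ y (X y) (Y y))
      =ᶠ[𝓝 z] fun y => L.tor y (rep p X y) (rep p Y y) :=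
    rep_eventuallyEq hz hU hzU fun y hy _ => coframe_torsionAt hτ hy _ _
  exact (((L.contDiffAt_of_domain L.contDiffOn_tor hz).clm_apply
    (contDiffAt_rep hz hU hzU hX)).clm_apply (contDiffAt_rep hz hU hzU hY)).congr_of_eventuallyEq hr

lemma SmoothOn.casimirAt (hτ : IsThreeForm τ) {U : Set M} (hU : IsOpen U) {Y : VField n M}
    (hY : SmoothOn Y U) : SmoothOn (fun y => casimirAt g τ y (Y y)) U := by
  refine smoothOn_of_contDiffAt_rep fun p z hz hzU => ?_
  set L := localGeometry g hτ p with hL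
  have hr : rep p (fun y => SkewTorsion.casimirAt g τ y (Y y))
      =ᶠ[𝓝 z] fun y => L.casimir y (rep p Y y) :=
    rep_eventuallyEq hz hU hzU fun y hy _ => coframe_casimirAt hτ hy _
  exact ((L.contDiffAt_of_domain L.contDiffOn_casimir hz).clm_apply
    (contDiffAt_rep hz hU hzU hY)).congr_of_eventuallyEq hr

/-- Covariant derivatives preserve the eigenspaces of the Casimir endomorphism. -/
lemma casimirAt_connection_of_eigen (hτ : IsParallelSkewTorsion g τ) {U : Set M} (hU : IsOpen U)
    {x : M} (hx : x ∈ U) {Y : VField n M} (hY : SmoothOn Y U) {a : ℝ}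
    (h : ∀ y ∈ U, casimirAt g τ y (Y y) = a • Y y) (v : TangentSpace (𝓡 n) x) :
    casimirAt g τ x (connection g τ Y x v) = a • connection g τ Y x v := by
  rw [← connection_casimirAt hU hx hτ hY v (hY.casimirAt hτ.threeForm hU),
    ← connection_const_smul hU hx hτ.threeForm hY]
  exact connection_congr hU hx hτ.threeForm (ContMDiffOn.const_smul_section hY) h v

/-- The traces of powers of the Casimir endomorphism are locally constant. -/
lemma isLocallyConstant_trace (hτ : IsParallelSkewTorsion g τ) (k : ℕ) :
    IsLocallyConstant fun x : M => LinearMap.trace ℝ _ (casimirAt g τ x ^ k) := by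
  rw [IsLocallyConstant.iff_eventually_eq]
  intro x
  set L := localGeometry g hτ.threeForm x with hL
  set f : Coord n → ℝ := fun z => LocalGeometry.traceL (Coord n) (L.casimir z ^ k) with hf
  have hxs : x ∈ (extChartAt (𝓡 n) x).source := mem_extChartAt_source x
  have hz0 : extChartAt (𝓡 n) x x ∈ chartRange n x := (extChartAt (𝓡 n) x).map_source hxs
  have hd : DifferentiableOn ℝ f (chartRange n x) := fun z hz =>
    ((LocalGeometry.traceL (Coord n)).differentiableAt.comp z
      ((L.differentiableAt_of_domain L.contDiffOn_casimir hz).fun_pow k)).differentiableWithinAt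
  obtain ⟨ε, hε, hball⟩ := Metric.isOpen_iff.mp (isOpen_chartRange n x) _ hz0
  -- A ball is convex, so vanishing of the derivative in the chart gives constancy there.
  have hconst : ∀ z ∈ Metric.ball (extChartAt (𝓡 n) x x) ε, f z = f (extChartAt (𝓡 n) x x) := by
    intro z hz
    refine (convex_ball _ ε).is_const_of_fderivWithin_eq_zero (𝕜 := ℝ) (hd.mono hball)
      (fun y hy => ?_) hz (Metric.mem_ball_self hε)
    rw [fderivWithin_of_isOpen Metric.isOpen_ball hy]
    exact (hτ.isParallel x).fderiv_trace_casimir_pow (hball hy) k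
  have hval (y : M) (hy : y ∈ chartDomain n x) :
      LinearMap.trace ℝ _ (casimirAt g τ y ^ k) = f (extChartAt (𝓡 n) x y) := by
    rw [chartDomain_eq] at hy
    have h1 := trace_casimirAt_pow (g := g) hτ.threeForm ((extChartAt (𝓡 n) x).map_source hy) k
    have h2 : chartInv x (extChartAt (𝓡 n) x y) = y := (extChartAt (𝓡 n) x).left_inv hy
    rw [h2] at h1
    exact h1
  filter_upwards [(isOpen_chartDomain n x).mem_nhds (mem_chartDomain n x),
    (continuousAt_extChartAt (I := 𝓡 n) x).preimage_mem_nhds (Metric.ball_mem_nhds _ hε)]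
    with y hy hyb
  rw [hval y hy, hval x (mem_chartDomain n x), hconst _ hyb]

/-- The curvature of the connection at a point. -/
lemma exists_curvature (hτ : IsParallelSkewTorsion g τ) (x : M) :
    ∃ R : TangentSpace (𝓡 n) x → TangentSpace (𝓡 n) x → Module.End ℝ (TangentSpace (𝓡 n) x),
      (∀ u v, R u v = - R v u) ∧ (∀ u v, (torsionSpace g hτ.threeForm x).IsStab (R u v)) ∧
      ∀ u v w, R u v w + R v w u + R w u v
        = (4 : ℝ) • (torsionAt g τ x (torsionAt g τ x u v) w
          + torsionAt g τ x (torsionAt g τ x v w) u + torsionAt g τ x (torsionAt g τ x w u) v) := by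
  obtain ⟨p, z, hz, rfl⟩ := exists_chartInv (n := n) x
  have hτ' := hτ.threeForm
  set L := localGeometry g hτ' p with hL
  let R (u v : TangentSpace (𝓡 n) (chartInv p z)) :
      Module.End ℝ (TangentSpace (𝓡 n) (chartInv p z)) :=
    (coframeEquiv (chartInv_mem hz)).symm.conj
      (L.curv z (coframe p _ u) (coframe p _ v)).toLinearMap
  have hR (u v w : TangentSpace (𝓡 n) (chartInv p z)) : coframe p _ (R u v w)
      = L.curv z (coframe p _ u) (coframe p _ v) (coframe p _ w) :=
    coframe_frame (chartInv_mem hz) _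
  refine ⟨R, fun u v => ?_, fun u v => ⟨fun w y => ?_, fun a b => ?_⟩, fun u v w => ?_⟩
  · ext w
    apply coframe_injective hz
    rw [hR, LinearMap.neg_apply, map_neg, hR, L.curv_swap]
  · change g.inner _ _ _ = - g.inner _ _ _
    rw [← coordMetric_coframe hz, ← coordMetric_coframe hz, hR, hR]
    exact eq_neg_of_add_eq_zero_left (L.metric_curv_skew hz _ _ _ _)
  · change R u v (torsionAt g τ _ a b) = torsionAt g τ _ _ _ + torsionAt g τ _ _ _
    apply coframe_injective hz
    rw [hR, map_add, coframe_torsionAt hτ' hz, coframe_torsionAt hτ' hz, coframe_torsionAt hτ' hz,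
      hR, hR, (hτ.isParallel p).curv_tor hz]
  · apply coframe_injective hz
    simp only [map_add, map_smul, hR, coframe_torsionAt hτ' hz]
    exact (hτ.isParallel p).bianchi hz _ _ _

end Connection

/-! ### Constancy of the spectrum, and exclusion of vanishing `τ_ξ`. -/

section Alternative

variable {n : ℕ} {M : Type*} [TopologicalSpace M] [ChartedSpace (EuclideanSpace ℝ (Fin n)) M]
  [IsManifold (𝓡 n) ∞ M]

/-! ## The global alternative -/

variable {g : Metric n M} {τ : TriForm n M}

variable (M) in
lemma finrank_tangentSpace (x : M) : Module.finrank ℝ (TangentSpace (𝓡 n) x) = n :=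
  finrank_euclideanSpace_fin (𝕜 := ℝ) (n := n)

/-- `ξ` is a unit vector spanning the vertical space, and the Casimir endomorphism is `a` on `ξ`
and `β` on its complement. -/
structure IsVerticalAt (g : Metric n M) (hτ : IsThreeForm τ) (x : M) (a β : ℝ)
    (ξ : TangentSpace (𝓡 n) x) : Prop where
  isVertical : (torsionSpace g hτ x).IsVertical (stab g τ x) ξ
  casimir_self : casimirAt g τ x ξ = a • ξ
  casimir_of_orthogonal : ∀ v, g.inner x ξ v = 0 → casimirAt g τ x v = β • v

lemma IsVerticalAt.unit {hτ : IsThreeForm τ} {x : M} {a β : ℝ} {ξ : TangentSpace (𝓡 n) x}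
    (h : IsVerticalAt g hτ x a β ξ) : g.inner x ξ ξ = 1 := h.isVertical.unit

lemma exists_isVerticalAt (hτ : IsParallelSkewTorsion g τ) (x : M)
    (hirr : IsAlmostIrreducible (fun v w => g.inner x v w) (stab g τ x)) :
    (∃ (ξ : TangentSpace (𝓡 n) x) (β : ℝ), 0 < β ∧ torsionAt g τ x ξ = 0 ∧
      IsVerticalAt g hτ.threeForm x 0 β ξ) ∨
    ∃ (ξ : TangentSpace (𝓡 n) x) (μ : ℝ), n ≠ 3 ∧ (torsionSpace g hτ.threeForm x).IsContact ξ μ ∧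
      IsVerticalAt g hτ.threeForm x ((n - 1 : ℝ) * μ) (2 * μ) ξ := by
  have h𝔤 := mem_stab_iff (g := g) hτ.threeForm x
  obtain ⟨ξ, hξ⟩ := TorsionSpace.exists_isVertical (P := torsionSpace g hτ.threeForm x)
    (𝔤 := stab g τ x) (fun A hA => ((h𝔤 A).mp hA).1) hirr
  obtain ⟨R, hR, hst, hB⟩ := exists_curvature hτ x
  have hJ := TorsionSpace.isStab_t hR hst hB
    fun u v => hξ.annihilates _ ((h𝔤 _).mpr (hst u v))
  rcases hξ.casimir_dichotomy h𝔤 hJ (inner_casimirAt x) with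
    ⟨h1, h2, β, hβ, h3⟩ | ⟨μ, h1, h2, h3, h4⟩
  · exact Or.inl ⟨ξ, β, hβ, h1, hξ, by rw [h2, zero_smul], h3⟩
  · rw [finrank_tangentSpace] at h2 h3
    exact Or.inr ⟨ξ, μ, h2, h1, hξ, h3, h4⟩

lemma IsVerticalAt.one_lt {hτ : IsThreeForm τ} {x : M} {a β : ℝ} {ξ : TangentSpace (𝓡 n) x}
    (h : IsVerticalAt g hτ x a β ξ) : 1 < n := by
  by_contra hn
  have hn1 : Module.finrank ℝ (TangentSpace (𝓡 n) x) ≤ 1 := by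
    rw [finrank_tangentSpace]; omega
  obtain ⟨v, hv, hξv⟩ := h.isVertical.ne_bot
  obtain ⟨e, he⟩ := finrank_le_one_iff.mp hn1
  obtain ⟨c, hc⟩ := he ξ
  obtain ⟨d, hd⟩ := he v
  have hd0 : d ≠ 0 := by rintro rfl; exact hv (by rw [← hd, zero_smul])
  have h1 : ξ = (c / d) • v := by rw [← hc, ← hd, smul_smul, div_mul_cancel₀ _ hd0]
  have h2 := h.unit
  nth_rewrite 2 [h1] at h2
  have h3 : g.inner x ξ v = 0 := hξv
  rw [inner_smul_right, h3, mul_zero] at h2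
  exact zero_ne_one h2

lemma IsVerticalAt.trace_pow {hτ : IsThreeForm τ} {x : M} {a β : ℝ} {ξ : TangentSpace (𝓡 n) x}
    (h : IsVerticalAt g hτ x a β ξ) (k : ℕ) :
    LinearMap.trace ℝ _ (casimirAt g τ x ^ k) = a ^ k + (n - 1 : ℝ) * β ^ k := by
  have := TorsionSpace.trace_pow_of_eigen (P := torsionSpace g hτ x) (S := casimirAt g τ x)
    h.unit h.casimir_self h.casimir_of_orthogonal k
  rwa [finrank_tangentSpace] at this

/-- Here `N = n - 1`. Equal traces of `S` give `β = 3μ`, and equal traces of `S³` would then give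
`N² = 19`. The trace of `S²` in place of `S³` would not exclude `N = 5`. -/
lemma trace_ne_of_pos {N : ℕ} (hN : 0 < N) {β μ : ℝ} (hμ : 0 < μ)
    (h1 : N * β = N * μ + N * (2 * μ)) : N * β ^ 3 ≠ (N * μ) ^ 3 + N * (2 * μ) ^ 3 := by
  intro h3
  have hN' : (0 : ℝ) < N := by exact_mod_cast hN
  have hβ : β = 3 * μ := by
    have : (N : ℝ) * (β - 3 * μ) = 0 := by linarith
    rcases mul_eq_zero.mp this with h | h <;> linarith
  subst hβ
  have h4 : (N : ℝ) * μ ^ 3 * ((N : ℝ) ^ 2 - 19) = 0 := by linear_combination -h3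
  have h5 : (N : ℝ) ^ 2 = 19 := by
    rcases mul_eq_zero.mp h4 with h | h
    · exact absurd h (by positivity)
    · linarith
  have h6 : N ^ 2 = 19 := by exact_mod_cast h5
  rcases le_or_gt N 4 with h | h
  · nlinarith
  · nlinarith

/-- On a connected manifold, the same alternative and the same eigenvalues occur everywhere. -/
theorem exists_forall_isVerticalAt [ConnectedSpace M] (hτ : IsParallelSkewTorsion g τ)
    (hirr : ∀ x : M, IsAlmostIrreducible (fun v w => g.inner x v w) (stab g τ x)) :
    (∃ β : ℝ, 0 < β ∧ ∀ x, ∃ ξ : TangentSpace (𝓡 n) x, torsionAt g τ x ξ = 0 ∧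
      IsVerticalAt g hτ.threeForm x 0 β ξ) ∨
    ∃ μ : ℝ, 0 < μ ∧ n ≠ 3 ∧ ∀ x, ∃ ξ : TangentSpace (𝓡 n) x,
      (torsionSpace g hτ.threeForm x).IsContact ξ μ ∧
      IsVerticalAt g hτ.threeForm x ((n - 1 : ℝ) * μ) (2 * μ) ξ := by
  have hconst (k : ℕ) (x y : M) : LinearMap.trace ℝ _ (casimirAt g τ x ^ k)
      = LinearMap.trace ℝ _ (casimirAt g τ y ^ k) :=
    (isLocallyConstant_trace hτ k).apply_eq_of_isPreconnected isPreconnected_univ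
      (Set.mem_univ x) (Set.mem_univ y)
  have hN {x : M} {a β : ℝ} {ξ : TangentSpace (𝓡 n) x}
      (h : IsVerticalAt g hτ.threeForm x a β ξ) : (0 : ℝ) < n - 1 := by
    have : (1 : ℝ) < n := by exact_mod_cast h.one_lt
    linarith
  have hmix {x y : M} {β μ : ℝ} {ξ : TangentSpace (𝓡 n) x} {ζ : TangentSpace (𝓡 n) y}
      (hμ : 0 < μ) (h1 : IsVerticalAt g hτ.threeForm x 0 β ξ)
      (h2 : IsVerticalAt g hτ.threeForm y ((n - 1 : ℝ) * μ) (2 * μ) ζ) : False := by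
    have e1 := hconst 1 x y
    have e3 := hconst 3 x y
    rw [h1.trace_pow, h2.trace_pow] at e1 e3
    have hn := h1.one_lt
    have hc : ((n - 1 : ℕ) : ℝ) = n - 1 := by rw [Nat.cast_sub hn.le, Nat.cast_one]
    refine trace_ne_of_pos (N := n - 1) (by omega) hμ (β := β) ?_ ?_
    · rw [hc]; simpa using e1
    · rw [hc]; simpa using e3
  obtain ⟨x₀⟩ : Nonempty M := inferInstance
  rcases exists_isVerticalAt hτ x₀ (hirr x₀) with ⟨ξ, β, hβ, -, hξ⟩ | ⟨ξ, μ, hn, hc, hξ⟩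
  · refine Or.inl ⟨β, hβ, fun x => ?_⟩
    rcases exists_isVerticalAt hτ x (hirr x) with ⟨ζ, β', -, ht, hζ⟩ | ⟨ζ, μ, -, hc, hζ⟩
    · have e1 := hconst 1 x x₀
      rw [hξ.trace_pow, hζ.trace_pow] at e1
      have : β' = β := by
        refine mul_left_cancel₀ (hN hξ).ne' ?_
        simpa using e1
      exact ⟨ζ, ht, this ▸ hζ⟩
    · exact (hmix hc.pos hξ hζ).elim
  · refine Or.inr ⟨μ, hc.pos, hn, fun x => ?_⟩
    rcases exists_isVerticalAt hτ x (hirr x) with ⟨ζ, β, -, -, hζ⟩ | ⟨ζ, μ', -, hc', hζ⟩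
    · exact (hmix hc.pos hζ hξ).elim
    · have e1 := hconst 1 x x₀
      rw [hξ.trace_pow, hζ.trace_pow] at e1
      have : μ' = μ := by
        refine mul_left_cancel₀ (hN hξ).ne' ?_
        linarith
      subst this
      exact ⟨ζ, hc', hζ⟩

/-! ## Eigenfields of the Casimir endomorphism -/

section

variable {hτ : IsThreeForm τ} {a β : ℝ}

lemma IsVerticalAt.casimirAt_apply {x : M} {ξ : TangentSpace (𝓡 n) x}
    (h : IsVerticalAt g hτ x a β ξ) (v : TangentSpace (𝓡 n) x) :
    casimirAt g τ x v = β • v + ((a - β) * g.inner x ξ v) • ξ := by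
  have h1 := h.casimir_of_orthogonal (v - g.inner x ξ v • ξ) (h.isVertical.b_sub v)
  rw [map_sub, map_smul, h.casimir_self, sub_eq_iff_eq_add] at h1
  rw [h1]
  module

lemma IsVerticalAt.eq_smul_of_eigen {x : M} {ξ : TangentSpace (𝓡 n) x}
    (h : IsVerticalAt g hτ x a β ξ) (hab : a ≠ β) {v : TangentSpace (𝓡 n) x}
    (hv : casimirAt g τ x v = a • v) : v = g.inner x ξ v • ξ := by
  rw [h.casimirAt_apply] at hv
  have h1 : (a - β) • v = (a - β) • (g.inner x ξ v • ξ) := by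
    rw [smul_smul, sub_smul, ← hv, add_sub_cancel_left]
  exact smul_right_injective _ (sub_ne_zero.mpr hab) h1

lemma IsVerticalAt.inner_eq_zero_of_eigen {x : M} {ξ : TangentSpace (𝓡 n) x}
    (h : IsVerticalAt g hτ x a β ξ) (hab : a ≠ β) {v : TangentSpace (𝓡 n) x}
    (hv : casimirAt g τ x v = β • v) : g.inner x ξ v = 0 := by
  rw [h.casimirAt_apply, add_eq_left] at hv
  rcases smul_eq_zero.mp hv with h1 | h1
  · exact (mul_eq_zero.mp h1).resolve_left (sub_ne_zero.mpr hab)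
  · exact (h.isVertical.ne_zero h1).elim

/-- The relation `(S - a)(S - β) = 0` no longer mentions `ξ`. The eigenprojections are therefore
polynomials in the smooth field `S`, whereas `ξ` is chosen pointwise without any regularity. -/
lemma IsVerticalAt.casimirAt_casimirAt {x : M} {ξ : TangentSpace (𝓡 n) x}
    (h : IsVerticalAt g hτ x a β ξ) (v : TangentSpace (𝓡 n) x) :
    casimirAt g τ x (casimirAt g τ x v) = (a + β) • casimirAt g τ x v - (a * β) • v := by
  rw [h.casimirAt_apply v, map_add, map_smul, map_smul, h.casimir_self, h.casimirAt_apply v]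
  module

/-- Eigenvectors of the Casimir endomorphism extend to eigenfields. -/
lemma exists_eigenfield (hτ : IsThreeForm τ) (hab : a ≠ β)
    (hq : ∀ (x : M) (v : TangentSpace (𝓡 n) x),
      casimirAt g τ x (casimirAt g τ x v) = (a + β) • casimirAt g τ x v - (a * β) • v)
    (p : M) {v : TangentSpace (𝓡 n) p} (hv : casimirAt g τ p v = a • v) :
    ∃ Y : VField n M, SmoothOn Y (chartDomain n p) ∧ Y p = v ∧
      ∀ x, casimirAt g τ x (Y x) = a • Y x := by
  let C := coordField p (coframe p p v)
  have hC : SmoothOn C (chartDomain n p) := smoothOn_coordField p _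
  -- `(S - β)/(a - β)` is the projection to the `a`-eigenspace, applied to a coordinate field.
  have hs : SmoothOn (fun x => (a - β)⁻¹ • (casimirAt g τ x (C x) - β • C x)) (chartDomain n p) :=
    ContMDiffOn.const_smul_section (ContMDiffOn.sub_section
      (hC.casimirAt hτ (isOpen_chartDomain n p)) (ContMDiffOn.const_smul_section hC))
  refine ⟨_, hs, ?_, fun x => ?_⟩
  · have : C p = v := frame_coframe (mem_chartDomain n p) v
    rw [this, hv, ← sub_smul, smul_smul, inv_mul_cancel₀ (sub_ne_zero.mpr hab), one_smul]
  · rw [map_smul, map_sub, map_smul, hq]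
    module

/-- The eigenspaces of the Casimir endomorphism form smooth distributions. -/
lemma isSmoothDistribution_eigenspace (hτ : IsThreeForm τ) (hab : a ≠ β)
    (hq : ∀ (x : M) (v : TangentSpace (𝓡 n) x),
      casimirAt g τ x (casimirAt g τ x v) = (a + β) • casimirAt g τ x v - (a * β) • v)
    (k : ℕ) (hk : ∀ x : M, Module.finrank ℝ (Module.End.eigenspace (casimirAt g τ x) a) = k) :
    IsSmoothDistribution fun x : M => Module.End.eigenspace (casimirAt g τ x) a := by
  intro p
  let bs := Module.finBasisOfFinrankEq ℝ (Module.End.eigenspace (casimirAt g τ p) a) (hk p)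
  choose Y hY hYp hYe using fun i => exists_eigenfield hτ hab hq p
    (Module.End.mem_eigenspace_iff.mp (bs i).2)
  let F : M → Fin k → Coord n := fun x i => coframe p x (Y i x)
  have hF : ContinuousOn F (chartDomain n p) := continuousOn_pi.mpr fun i =>
    ((smoothOn_iff (isOpen_chartDomain n p) subset_rfl (Y i)).mp (hY i)).continuousOn
  have hind (x : M) (hx : x ∈ chartDomain n p) :
      LinearIndependent ℝ (F x) ↔ LinearIndependent ℝ fun i => Y i x :=
    (coframeEquiv hx).toLinearMap.linearIndependent_iff (LinearEquiv.ker _)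
  -- Linear independence is an open condition, and the constant rank `k` makes the independent
  -- eigenfields span the whole eigenspace.
  refine ⟨chartDomain n p ∩ F ⁻¹' {f | LinearIndependent ℝ f},
    hF.isOpen_inter_preimage (isOpen_chartDomain n p) isOpen_setOfPred_linearIndependent,
    ⟨mem_chartDomain n p, ?_⟩, k, Y, fun i => (hY i).mono Set.inter_subset_left, ?_⟩
  · change LinearIndependent ℝ (F p)
    rw [hind p (mem_chartDomain n p)]
    simp_rw [hYp]
    exact bs.linearIndependent.map' (Submodule.subtype _) (Submodule.ker_subtype _)
  · rintro x ⟨hx, hxF⟩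
    have hl := (hind x hx).mp hxF
    refine ⟨hl, (Submodule.eq_of_le_of_finrank_eq ?_ ?_).symm⟩
    · rw [Submodule.span_le]
      rintro _ ⟨i, rfl⟩
      exact Module.End.mem_eigenspace_iff.mpr (hYe i x)
    · rw [finrank_span_eq_card hl, hk x, Fintype.card_fin]

end

/-- If `τ_ξ` vanishes for the vertical vectors `ξ`, then there is a one-dimensional factor. -/
theorem hasLocalOneDimFactor (hτ : IsParallelSkewTorsion g τ) {β : ℝ} (hβ : 0 < β)
    (h : ∀ x, ∃ ξ : TangentSpace (𝓡 n) x, torsionAt g τ x ξ = 0 ∧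
      IsVerticalAt g hτ.threeForm x 0 β ξ) : HasLocalOneDimFactor g τ := by
  choose ξ ht hξ using h
  have hq (x : M) := (hξ x).casimirAt_casimirAt
  -- The same quadratic relation with the eigenvalues exchanged, for use on the complementary
  -- eigenspace.
  have hq' (x : M) (v : TangentSpace (𝓡 n) x) : casimirAt g τ x (casimirAt g τ x v)
      = (β + 0) • casimirAt g τ x v - (β * 0) • v := by
    rw [hq, add_comm, mul_comm]
  have hT₁ (x : M) : Module.End.eigenspace (casimirAt g τ x) 0 = Submodule.span ℝ {ξ x} := by
    ext v
    rw [Module.End.mem_eigenspace_iff, Submodule.mem_span_singleton]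
    constructor
    · exact fun hv => ⟨_, ((hξ x).eq_smul_of_eigen hβ.ne hv).symm⟩
    · rintro ⟨c, rfl⟩
      rw [map_smul, (hξ x).casimir_self, smul_comm]
  have hsup (x : M) : Module.End.eigenspace (casimirAt g τ x) 0
      ⊔ Module.End.eigenspace (casimirAt g τ x) β = ⊤ := by
    refine eq_top_iff.mpr fun v _ => ?_
    rw [← add_sub_cancel (g.inner x (ξ x) v • ξ x) v]
    refine Submodule.add_mem_sup (Module.End.mem_eigenspace_iff.mpr ?_)
      (Module.End.mem_eigenspace_iff.mpr ?_)
    · rw [map_smul, (hξ x).casimir_self, smul_comm]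
    · exact (hξ x).casimir_of_orthogonal _ ((hξ x).isVertical.b_sub v)
  have hrank₁ (x : M) : Module.finrank ℝ (Module.End.eigenspace (casimirAt g τ x) 0) = 1 := by
    rw [hT₁, finrank_span_singleton (hξ x).isVertical.ne_zero]
  have hrank₂ (x : M) :
      Module.finrank ℝ (Module.End.eigenspace (casimirAt g τ x) β) = n - 1 := by
    have h1 := Submodule.finrank_sup_add_finrank_inf_eq
      (Module.End.eigenspace (casimirAt g τ x) 0) (Module.End.eigenspace (casimirAt g τ x) β)
    have h2 : Module.End.eigenspace (casimirAt g τ x) 0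
        ⊓ Module.End.eigenspace (casimirAt g τ x) β = ⊥ := by
      refine (Submodule.eq_bot_iff _).mpr fun v hv => ?_
      have h3 := Module.End.mem_eigenspace_iff.mp hv.1
      rw [Module.End.mem_eigenspace_iff.mp hv.2, zero_smul] at h3
      exact (smul_eq_zero.mp h3).resolve_left hβ.ne'
    rw [hsup, h2, finrank_bot, finrank_top, hrank₁, finrank_tangentSpace] at h1
    omega
  refine ⟨fun x => Module.End.eigenspace (casimirAt g τ x) 0,
    fun x => Module.End.eigenspace (casimirAt g τ x) β, ?_, hrank₁⟩
  have hpar (c : ℝ) : IsParallelDistribution g τ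
      fun x => Module.End.eigenspace (casimirAt g τ x) c := fun U Y hU hY hYT x hx v =>
    Module.End.mem_eigenspace_iff.mpr (casimirAt_connection_of_eigen hτ hU hx hY
      (fun y hy => Module.End.mem_eigenspace_iff.mp (hYT y hy)) v)
  refine
    { smooth₁ := isSmoothDistribution_eigenspace hτ.threeForm hβ.ne hq 1 hrank₁
      smooth₂ := isSmoothDistribution_eigenspace hτ.threeForm hβ.ne' hq' (n - 1) hrank₂
      nontrivial₁ := fun x h0 => ?_
      nontrivial₂ := fun x h0 => ?_
      sup_eq := hsup
      orthogonal := fun x v hv w hw => ?_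
      parallel₁ := hpar 0
      parallel₂ := hpar β
      torsion := fun x v hv w _ z => ?_ }
  · have := hrank₁ x
    rw [h0, finrank_bot] at this
    exact zero_ne_one this
  · have h1 := hrank₂ x
    have h2 := (hξ x).one_lt
    rw [h0, finrank_bot] at h1
    omega
  · rw [(hξ x).eq_smul_of_eigen hβ.ne (Module.End.mem_eigenspace_iff.mp hv), inner_smul_left,
      (hξ x).inner_eq_zero_of_eigen hβ.ne (Module.End.mem_eigenspace_iff.mp hw), mul_zero]
  -- A vector in the kernel of `S` is a multiple of `ξ`, so contraction of `τ` with it vanishes and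
  -- there are no mixed components.
  · rw [← inner_torsionAt (g := g),
      (hξ x).eq_smul_of_eigen hβ.ne (Module.End.mem_eigenspace_iff.mp hv), map_smul, ht, smul_zero,
      LinearMap.zero_apply, map_zero]
    rfl

end Alternative

/-! ### Rescaling, and the Sasaki structure of a parallel unit vertical field. -/

section Sasaki

variable {n : ℕ} {M : Type*} [TopologicalSpace M] [ChartedSpace (EuclideanSpace ℝ (Fin n)) M]
  [IsManifold (𝓡 n) ∞ M]

/-! ## Rescaling the metric -/

variable {g : Metric n M} {τ : TriForm n M}

lemma rescale_inner (c : ℝ) (hc : c ≠ 0) (x : M) (v w : TangentSpace (𝓡 n) x) :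
    (rescale g c hc).inner x v w = c ^ 2 * g.inner x v w := rfl

section

variable {U : Set M} (hU : IsOpen U) {x : M} (hx : x ∈ U) {X Y : VField n M}

include hU hx

lemma mdifferentiableAt_inner (hX : SmoothOn X U) (hY : SmoothOn Y U) :
    MDifferentiableAt (𝓡 n) 𝓘(ℝ, ℝ) (fun y => g.inner y (X y) (Y y)) x :=
  ((contMDiffOn_inner g hX hY).contMDiffAt (hU.mem_nhds hx)).mdifferentiableAt (by simp)

lemma dirDeriv_inner_rescale (hX : SmoothOn X U) (hY : SmoothOn Y U) (c : ℝ) (hc : c ≠ 0)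
    (v : TangentSpace (𝓡 n) x) :
    dirDeriv (fun y => (rescale g c hc).inner y (X y) (Y y)) x v
      = c ^ 2 * dirDeriv (fun y => g.inner y (X y) (Y y)) x v := by
  obtain ⟨p, z, hz, rfl⟩ := exists_chartInv (n := n) x
  have h := contDiffAt_comp_chartInv hz
    ((contMDiffOn_inner g hX hY).contMDiffAt (hU.mem_nhds hx))
  rw [dirDeriv_eq hz (mdifferentiableAt_inner hU hx hX hY),
    dirDeriv_eq hz (mdifferentiableAt_inner hU hx hX hY)]
  simp only [rescale_inner]
  rw [fderiv_const_mul (h.differentiableAt (by simp))]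
  rfl

lemma dirDeriv_inner_eq_zero (hX : SmoothOn X U) (hY : SmoothOn Y U) {c : ℝ}
    (h : ∀ y ∈ U, g.inner y (X y) (Y y) = c) (v : TangentSpace (𝓡 n) x) :
    dirDeriv (fun y => g.inner y (X y) (Y y)) x v = 0 := by
  obtain ⟨p, z, hz, rfl⟩ := exists_chartInv (n := n) x
  rw [dirDeriv_eq hz (mdifferentiableAt_inner hU hx hX hY)]
  have : (fun y => g.inner (chartInv p y) (X (chartInv p y)) (Y (chartInv p y)))
      =ᶠ[𝓝 z] fun _ => c := by
    filter_upwards [(continuousAt_chartInv hz).preimage_mem_nhds (hU.mem_nhds hx)] with y hy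
      using h _ hy
  rw [this.fderiv_eq, fderiv_fun_const]
  rfl

/-- The metric and the Koszul expression both scale by `c²`, so the condition that defines the
covariant derivative is unchanged. -/
lemma leviCivita_rescale (hY : SmoothOn Y U) (c : ℝ) (hc : c ≠ 0) (v : TangentSpace (𝓡 n) x) :
    leviCivita (rescale g c hc) Y x v = leviCivita g Y x v := by
  have hU' := hU.inter (isOpen_chartDomain n x)
  have hx' : x ∈ U ∩ chartDomain n x := ⟨hx, mem_chartDomain n x⟩
  have hY' := hY.mono (Set.inter_subset_left (t := chartDomain n x))
  have he (w : TangentSpace (𝓡 n) x) := (smoothOn_ext w).mono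
    (Set.inter_subset_right (s := U))
  have hk (u : TangentSpace (𝓡 n) x) : koszul (rescale g c hc) (ext v) Y (ext u) x
      = c ^ 2 * koszul g (ext v) Y (ext u) x := by
    rw [koszul, koszul, dirDeriv_inner_rescale hU' hx' hY' (he u),
      dirDeriv_inner_rescale hU' hx' (he v) (he u), dirDeriv_inner_rescale hU' hx' (he v) hY']
    simp only [rescale_inner]
    ring
  rw [leviCivita, leviCivita, sharp, sharp]
  congr 1
  funext w
  refine propext (forall_congr' fun u => ?_)
  rw [rescale_inner, hk, mul_div_assoc]
  exact mul_right_inj' (pow_ne_zero 2 hc)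

end

/-! ## Sasaki structures -/

/-- Since `∇Φ = 0`, the derivative `∇^g_u Φ` equals the commutator of `Φ` with `τ_u`; this computes
it for `Φ = τ_ξ`, before normalization. -/
lemma TorsionSpace.IsContact.commutator {V : Type*} [AddCommGroup V] [Module ℝ V]
    [FiniteDimensional ℝ V] {P : TorsionSpace V} {ξ : V} {μ : ℝ} (h : P.IsContact ξ μ) (u v : V) :
    P.t ξ (P.t u v) - P.t u (P.t ξ v) = - (μ • (P.b u v • ξ - P.b ξ v • u)) := by
  have h1 : P.b (P.t ξ u) (P.t ξ v) = μ * P.b u v - μ * P.b ξ u * P.b ξ v := by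
    rw [P.skew, h.sq, map_add, map_smul, map_smul, P.symm u ξ, smul_eq_mul, smul_eq_mul]
    ring
  rw [h.t_eq u v, h.t_eq u (P.t ξ v), P.b_t_left, h1, map_add, map_sub, map_smul, map_smul,
    map_smul, P.alt, h.sq u]
  module

/-- Reversing `ξ` also reverses `J = t ξ`, and the conditions are even in the pair. -/
lemma TorsionSpace.IsContact.neg {V : Type*} [AddCommGroup V] [Module ℝ V]
    {P : TorsionSpace V} {ξ : V} {μ : ℝ} (h : P.IsContact ξ μ) : P.IsContact (-ξ) μ where
  unit := by simp [h.unit]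
  pos := h.pos
  sq v := by simp [h.sq]
  t_eq u v := by simp [h.t_eq u v]

/-- A unit vertical vector field on `U`, normalized with respect to the rescaled metric, defines a
Sasaki structure. -/
theorem isSasakianOn_of_isContact (hτ : IsParallelSkewTorsion g τ) {U : Set M} (hU : IsOpen U)
    {ξ : VField n M} (hξ : SmoothOn ξ U) {μ : ℝ}
    (hpar : ∀ x ∈ U, ∀ v, connection g τ ξ x v = 0)
    (hcon : ∀ x ∈ U, (torsionSpace g hτ.threeForm x).IsContact (ξ x) μ)
    {c : ℝ} (hc : 0 < c) (hcμ : c ^ 2 = μ) :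
    IsSasakianOn (rescale g c hc.ne') (fun x => c ^ 2 • τ x) U := by
  have hτ' := hτ.threeForm
  have hc0 : c ≠ 0 := hc.ne'
  -- `ζ` has unit length for `c² g`. The endomorphism `Φ = τ_ζ` then satisfies `Φ² = -μ/c² = -1` on
  -- `ξ^⊥`.
  set ζ : VField n M := fun x => c⁻¹ • ξ x with hζ
  have hζs : SmoothOn ζ U := ContMDiffOn.const_smul_section hξ
  have hζp : ∀ x ∈ U, ∀ v, connection g τ ζ x v = 0 := fun x hx v => by
    rw [hζ, connection_const_smul hU hx hτ' hξ, hpar x hx, smul_zero]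
  have hskew (x : M) (u v w : TangentSpace (𝓡 n) x) : g.inner x (torsionAt g τ x u v) w
      = - g.inner x v (torsionAt g τ x u w) := (torsionSpace g hτ' x).skew u v w
  have hcyc (x : M) (u v w : TangentSpace (𝓡 n) x) : g.inner x (torsionAt g τ x u v) w
      = g.inner x (torsionAt g τ x v w) u := (torsionSpace g hτ' x).b_t_cyclic u v w
  refine ⟨ζ, fun x => torsionAt g τ x (ζ x), ?_, fun x hx u v w => ?_⟩
  · refine
      { smooth_xi := hζs
        smooth_phi := fun W Y hW hWU hY => (hζs.mono hWU).torsionAt hτ' hW hY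
        unit := fun x hx => ?_
        killing := fun W X Y hW hWU hX hY x hx => ?_
        skew := fun x hx v w => ?_
        d_xi := fun W X Y hW hWU hX hY x hx => ?_
        phi_sq := fun x hx v => ?_
        nabla_phi := fun W Y hW hWU hY x hx v => ?_ }
    · have : g.inner x (ξ x) (ξ x) = 1 := (hcon x hx).unit
      rw [rescale_inner, inner_smul_left, inner_smul_right, this]
      field_simp
    · have hζW := hζs.mono hWU
      have e1 := connection_sub_connection (g := g) hW hx hτ' hζW hX
      have e2 := connection_sub_connection (g := g) hW hx hτ' hζW hY
      -- As `ζ` is parallel, `[ζ, X] = ∇_ζ X - 2 τ_ζ X`. The Killing equation reduces to metricity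
      -- of `∇` and skewness of `τ_ζ`.
      rw [hζp x (hWU hx), sub_zero] at e1 e2
      rw [dirDeriv_inner_rescale hW hx hX hY, dirDeriv_inner_eq hW hx hτ' hX hY, rescale_inner,
        rescale_inner, e1, e2, inner_add_left, inner_add_right, inner_smul_left, inner_smul_right,
        hskew]
      ring
    · rw [rescale_inner, rescale_inner, hskew]
      ring
    · have hζW := hζs.mono hWU
      have e1 := connection_sub_connection (g := g) hW hx hτ' hX hY
      -- Only the torsion term in the bracket formula contributes to `dζ`; it is `2 g(ζ, τ_X Y) = 2
      -- g(τ_ζ X, Y)` by cyclic invariance.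
      have e2 := congrArg (g.inner x (ζ x)) e1
      rw [inner_sub_right, inner_add_right, inner_smul_right, g.symm x (ζ x) (torsionAt g τ x _ _),
        ← hcyc x (ζ x)] at e2
      rw [dirDeriv_inner_rescale hW hx hζW hY, dirDeriv_inner_rescale hW hx hζW hX,
        dirDeriv_inner_eq hW hx hτ' hζW hY, dirDeriv_inner_eq hW hx hτ' hζW hX,
        hζp x (hWU hx), hζp x (hWU hx), rescale_inner, rescale_inner]
      simp only [map_zero, zero_apply]
      linear_combination c ^ 2 * e2
    · have h := (hcon x hx).sq v
      change torsionAt g τ x (ξ x) (torsionAt g τ x (ξ x) v)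
        = - μ • v + (μ * g.inner x (ξ x) v) • ξ x at h
      rw [rescale_inner]
      simp only [hζ, inner_smul_left]
      simp only [map_smul, LinearMap.smul_apply]
      rw [h, ← hcμ]
      match_scalars <;> field_simp
    · have hζW := hζs.mono hWU
      have hs := hζW.torsionAt (g := g) hτ' hW hY
      have h := (hcon x (hWU hx)).commutator v (Y x)
      change torsionAt g τ x (ξ x) (torsionAt g τ x v (Y x))
        - torsionAt g τ x v (torsionAt g τ x (ξ x) (Y x))
        = - (μ • (g.inner x v (Y x) • ξ x - g.inner x (ξ x) (Y x) • v)) at h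
      have e1 := connection_eq (g := g) (τ := τ) (fun y => torsionAt g τ y (ζ y) (Y y)) x v
      have e2 := connection_eq (g := g) (τ := τ) Y x v
      rw [connection_torsionAt hW hx hτ hζW hY v hs, hζp x (hWU hx), map_zero,
        LinearMap.zero_apply, zero_add, e2, map_add] at e1
      rw [leviCivita_rescale hW hx hs, leviCivita_rescale hW hx hY, rescale_inner, rescale_inner]
      -- Both `τ` and `ζ` are parallel, so `∇Φ = 0`, and replacing `∇` by `∇^g = ∇ - τ` leaves a
      -- commutator.
      have e3 : leviCivita g (fun y => torsionAt g τ y (ζ y) (Y y)) x v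
          - torsionAt g τ x (ζ x) (leviCivita g Y x v)
          = torsionAt g τ x (ζ x) (torsionAt g τ x v (Y x))
            - torsionAt g τ x v (torsionAt g τ x (ζ x) (Y x)) := by
        rw [sub_eq_sub_iff_add_eq_add, ← e1]
        abel
      rw [e3]
      simp only [hζ, inner_smul_left]
      simp only [map_smul, LinearMap.smul_apply]
      rw [← smul_sub, h, ← hcμ]
      match_scalars <;> field_simp
  · have h := (hcon x hx).t_eq u v
    change torsionAt g τ x u v = g.inner x (ξ x) u • torsionAt g τ x (ξ x) v
      - g.inner x (ξ x) v • torsionAt g τ x (ξ x) u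
      + g.inner x (torsionAt g τ x (ξ x) u) v • ξ x at h
    have h' := congrArg (fun y => g.inner x y w) h
    simp only [inner_add_left, inner_sub_left, inner_smul_left, inner_torsionAt (g := g)] at h'
    rw [xiWedgePhi]
    simp only [rescale_inner, hζ, inner_smul_left, inner_torsionAt]
    simp only [map_smul, LinearMap.smul_apply, smul_eq_mul]
    rw [h', hτ'.swap_right x (ξ x) w u]
    field_simp
    ring

end Sasaki

/-! ### Existence, smoothness and parallelism of unit vertical fields. -/

section VerticalFields

variable {n : ℕ} {M : Type*} [TopologicalSpace M] [ChartedSpace (EuclideanSpace ℝ (Fin n)) M]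
  [IsManifold (𝓡 n) ∞ M]

/-! ## Unit vertical fields -/

variable {g : Metric n M} {τ : TriForm n M}

lemma inner_normalize {x : M} {v : TangentSpace (𝓡 n) x} (hv : 0 < g.inner x v v) :
    g.inner x ((Real.sqrt (g.inner x v v))⁻¹ • v) ((Real.sqrt (g.inner x v v))⁻¹ • v) = 1 := by
  have h1 := Real.mul_self_sqrt hv.le
  have h2 := (Real.sqrt_pos.mpr hv).ne'
  rw [inner_smul_left, inner_smul_right]
  nth_rewrite 3 [← h1]
  field_simp

lemma continuousOn_inner {U : Set M} {X Y : VField n M}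
    (hX : ContinuousOn (fun x => (⟨x, X x⟩ : TangentBundle (𝓡 n) M)) U)
    (hY : ContinuousOn (fun x => (⟨x, Y x⟩ : TangentBundle (𝓡 n) M)) U) :
    ContinuousOn (fun x => g.inner x (X x) (Y x)) U := by
  rw [← contMDiffOn_zero_iff (I := 𝓡 n) (I' := (𝓡 n).tangent)] at hX hY
  rw [← contMDiffOn_zero_iff (I := 𝓡 n) (I' := 𝓘(ℝ, ℝ))]
  intro x hx
  have : ContMDiffWithinAt (𝓡 n) ((𝓡 n).prod 𝓘(ℝ)) 0
      (fun m ↦ Bundle.TotalSpace.mk' ℝ (E := Bundle.Trivial M ℝ) m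
        (g.inner m (X m) (Y m))) U x := by
    apply ContMDiffWithinAt.clm_bundle_apply₂ (F₁ := Coord n) (F₂ := Coord n)
    · exact ((g.contMDiff x).of_le (by simp)).contMDiffWithinAt
    · exact hX x hx
    · exact hY x hx
  simp only [Bundle.contMDiffWithinAt_totalSpace] at this
  exact this.2

section

variable {hτ : IsThreeForm τ} {a β : ℝ} (hab : a ≠ β)

include hab

/-- The eigenline is spanned by any unit eigenvector, so the pointwise choice of `ξ` can be
exchanged for a smooth local field. -/
lemma IsVerticalAt.eigen_eq_smul {x : M} {ξ v w : TangentSpace (𝓡 n) x}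
    (h : IsVerticalAt g hτ x a β ξ) (hv1 : g.inner x v v = 1)
    (hv : casimirAt g τ x v = a • v) (hw : casimirAt g τ x w = a • w) :
    w = g.inner x v w • v := by
  have h1 := h.eq_smul_of_eigen hab hv
  have h2 := h.eq_smul_of_eigen hab hw
  set s := g.inner x ξ v
  set r := g.inner x ξ w
  rw [h1, inner_smul_left, inner_smul_right, h.unit, mul_one] at hv1
  rw [h1, h2, inner_smul_left, inner_smul_right, h.unit, smul_smul]
  congr 1
  linear_combination -r * hv1

lemma IsVerticalAt.eq_or_eq_neg {x : M} {ξ v : TangentSpace (𝓡 n) x}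
    (h : IsVerticalAt g hτ x a β ξ) (hv1 : g.inner x v v = 1)
    (hv : casimirAt g τ x v = a • v) : v = ξ ∨ v = -ξ := by
  have h1 := h.eq_smul_of_eigen hab hv
  set s := g.inner x ξ v
  rw [h1, inner_smul_left, inner_smul_right, h.unit, mul_one] at hv1
  rcases mul_self_eq_one_iff.mp hv1 with hs | hs
  · exact Or.inl (by rw [h1, hs, one_smul])
  · exact Or.inr (by rw [h1, hs, neg_smul, one_smul])

/-- Unit vertical fields are parallel. -/
lemma connection_eq_zero_of_unit (hτ : IsParallelSkewTorsion g τ)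
    (hvert : ∀ x : M, ∃ ζ, IsVerticalAt g hτ.threeForm x a β ζ) {U : Set M} (hU : IsOpen U)
    {ξ : VField n M} (hξ : SmoothOn ξ U) (hunit : ∀ x ∈ U, g.inner x (ξ x) (ξ x) = 1)
    (heig : ∀ x ∈ U, casimirAt g τ x (ξ x) = a • ξ x) {x : M} (hx : x ∈ U)
    (v : TangentSpace (𝓡 n) x) : connection g τ ξ x v = 0 := by
  obtain ⟨ζ, hζ⟩ := hvert x
  -- The covariant derivative stays in the eigenline, and by constant length it is orthogonal to
  -- `ξ`.
  have h1 := hζ.eigen_eq_smul hab (hunit x hx) (heig x hx)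
    (casimirAt_connection_of_eigen hτ hU hx hξ heig v)
  have h2 := dirDeriv_inner_eq hU hx (g := g) hτ.threeForm hξ hξ v
  rw [dirDeriv_inner_eq_zero hU hx hξ hξ hunit, g.symm x (connection g τ ξ x v)] at h2
  rw [h1, show g.inner x (ξ x) (connection g τ ξ x v) = 0 by linarith, zero_smul]

/-- Unit vertical fields exist locally. -/
lemma exists_unit_eigenfield (hvert : ∀ x : M, ∃ ζ, IsVerticalAt g hτ x a β ζ) (p : M) :
    ∃ (U : Set M) (ξ : VField n M), IsOpen U ∧ p ∈ U ∧ SmoothOn ξ U ∧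
      (∀ x ∈ U, g.inner x (ξ x) (ξ x) = 1) ∧ ∀ x ∈ U, casimirAt g τ x (ξ x) = a • ξ x := by
  choose ζ hζ using hvert
  obtain ⟨Y, hY, hYp, hYe⟩ := exists_eigenfield hτ hab (fun x => (hζ x).casimirAt_casimirAt) p
    (hζ p).casimir_self
  have hin := contMDiffOn_inner g hY hY
  let U : Set M := chartDomain n p ∩ (fun x => g.inner x (Y x) (Y x)) ⁻¹' Set.Ioi 0
  have hpos (x : M) (hx : x ∈ U) : 0 < g.inner x (Y x) (Y x) := hx.2
  have hf : ContMDiffOn (𝓡 n) 𝓘(ℝ, ℝ) ∞ (fun x => (Real.sqrt (g.inner x (Y x) (Y x)))⁻¹) U := by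
    intro x hx
    have h1 : ContDiffAt ℝ ∞ (fun r : ℝ => (Real.sqrt r)⁻¹) (g.inner x (Y x) (Y x)) :=
      (Real.contDiffAt_sqrt (hpos x hx).ne').inv (Real.sqrt_pos.mpr (hpos x hx)).ne'
    exact h1.contMDiffAt.comp_contMDiffWithinAt (f := fun x => g.inner x (Y x) (Y x)) x
      ((hin x hx.1).mono Set.inter_subset_left)
  have hs : SmoothOn (fun x => (Real.sqrt (g.inner x (Y x) (Y x)))⁻¹ • Y x) U :=
    ContMDiffOn.smul_section hf (hY.mono Set.inter_subset_left)
  refine ⟨U, _, hin.continuousOn.isOpen_inter_preimage (isOpen_chartDomain n p) isOpen_Ioi,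
    ⟨mem_chartDomain n p, ?_⟩, hs, fun x hx => ?_, fun x hx => ?_⟩
  · change 0 < g.inner p (Y p) (Y p)
    rw [hYp, (hζ p).unit]
    exact one_pos
  · exact inner_normalize (hpos x hx)
  · rw [map_smul, hYe, smul_comm]

/-- The normalization of a continuous vertical field is smooth. -/
lemma smoothOn_normalize (hvert : ∀ x : M, ∃ ζ, IsVerticalAt g hτ x a β ζ) {Z : VField n M}
    (hZ : Continuous fun x => (⟨x, Z x⟩ : TangentBundle (𝓡 n) M)) (hZ0 : ∀ x, Z x ≠ 0)
    (hZe : ∀ x, casimirAt g τ x (Z x) = a • Z x) :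
    SmoothOn (fun x => (Real.sqrt (g.inner x (Z x) (Z x)))⁻¹ • Z x) Set.univ := by
  intro p _
  obtain ⟨U, ξ, hU, hp, hξ, hunit, heig⟩ := exists_unit_eigenfield (n := n) hab hvert p
  have hf : ContinuousOn (fun x => g.inner x (ξ x) (Z x)) U :=
    continuousOn_inner hξ.continuousOn hZ.continuousOn
  have hZf (x : M) (hx : x ∈ U) : Z x = g.inner x (ξ x) (Z x) • ξ x := by
    obtain ⟨ζ, hζ⟩ := hvert x
    exact hζ.eigen_eq_smul hab (hunit x hx) (heig x hx) (hZe x)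
  have hnorm (x : M) (hx : x ∈ U) :
      Real.sqrt (g.inner x (Z x) (Z x)) = |g.inner x (ξ x) (Z x)| := by
    nth_rewrite 1 [hZf x hx]
    rw [inner_smul_left, Real.sqrt_mul_self_eq_abs]
  have hp0 : g.inner p (ξ p) (Z p) ≠ 0 := fun h => hZ0 p (by rw [hZf p hp, h, zero_smul])
  -- Near `p`, `Z = f ξ` with `ξ` smooth and `f` continuous and nonzero. With `s` the sign of `f`,
  -- which is locally constant, the normalization of `Z` is the smooth field `s ξ`.
  have key (s : ℝ) (hs : 0 < s * g.inner p (ξ p) (Z p)) (hs1 : |s| = 1) :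
      ContMDiffAt (𝓡 n) (𝓡 n).tangent ∞ (fun x =>
        (⟨x, (Real.sqrt (g.inner x (Z x) (Z x)))⁻¹ • Z x⟩ : TangentBundle (𝓡 n) M)) p := by
    let V : Set M := U ∩ (fun x => s * g.inner x (ξ x) (Z x)) ⁻¹' Set.Ioi 0
    have hV : IsOpen V := (continuousOn_const.mul hf).isOpen_inter_preimage hU isOpen_Ioi
    have h1 : SmoothOn (fun x => s • ξ x) V :=
      ContMDiffOn.const_smul_section (hξ.mono Set.inter_subset_left)
    have h2 : SmoothOn (fun x => (Real.sqrt (g.inner x (Z x) (Z x)))⁻¹ • Z x) V := by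
      refine h1.congr fun x hx => ?_
      have hxs : 0 < s * g.inner x (ξ x) (Z x) := hx.2
      rw [hnorm x hx.1]
      nth_rewrite 2 [hZf x hx.1]
      rw [smul_smul]
      congr 1
      have habs : |g.inner x (ξ x) (Z x)| = s * g.inner x (ξ x) (Z x) := by
        rw [← abs_of_pos hxs, abs_mul, hs1, one_mul]
      have hs2 : s * s = 1 := by rw [← abs_mul_abs_self, hs1, one_mul]
      rw [habs, inv_mul_eq_iff_eq_mul₀ hxs.ne']
      linear_combination -g.inner x (ξ x) (Z x) * hs2
    exact h2.contMDiffAt (hV.mem_nhds ⟨hp, hs⟩)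
  rcases lt_or_gt_of_ne hp0 with h | h
  · exact (key (-1) (by linarith) (by simp)).contMDiffWithinAt
  · exact (key 1 (by linarith) (by simp)).contMDiffWithinAt

end

/-- Unit vertical fields define Sasaki structures. -/
lemma isSasakianOn_of_unit (hτ : IsParallelSkewTorsion g τ) {a β μ : ℝ} (hab : a ≠ β)
    (hvert : ∀ x : M, ∃ ζ, (torsionSpace g hτ.threeForm x).IsContact ζ μ ∧
      IsVerticalAt g hτ.threeForm x a β ζ) {U : Set M} (hU : IsOpen U)
    {ξ : VField n M} (hξ : SmoothOn ξ U) (hunit : ∀ x ∈ U, g.inner x (ξ x) (ξ x) = 1)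
    (heig : ∀ x ∈ U, casimirAt g τ x (ξ x) = a • ξ x)
    {c : ℝ} (hc : 0 < c) (hcμ : c ^ 2 = μ) :
    IsSasakianOn (rescale g c hc.ne') (fun x => c ^ 2 • τ x) U := by
  refine isSasakianOn_of_isContact hτ hU hξ (fun x hx => connection_eq_zero_of_unit hab hτ
    (fun y => ?_) hU hξ hunit heig hx) (fun x hx => ?_) hc hcμ
  · obtain ⟨ζ, -, hζ⟩ := hvert y
    exact ⟨ζ, hζ⟩
  · obtain ⟨ζ, hcon, hζ⟩ := hvert x
    rcases hζ.eq_or_eq_neg hab (hunit x hx) (heig x hx) with h | h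
    · rw [h]; exact hcon
    · rw [h]; exact hcon.neg

end VerticalFields

end SkewTorsion

end

/-! ### The main theorem. -/

open SkewTorsion in
theorem mainTheorem6 {n : ℕ} {M : Type*} [TopologicalSpace M]
    [ChartedSpace (EuclideanSpace ℝ (Fin n)) M] [IsManifold (𝓡 n) ∞ M]
    [T2Space M] [SecondCountableTopology M] [ConnectedSpace M]
    (g : SkewTorsion.Metric n M) (τ : SkewTorsion.TriForm n M)
    (hτ : SkewTorsion.IsParallelSkewTorsion g τ)
    (hirr : ∀ x : M, SkewTorsion.IsAlmostIrreducible (fun v w => g.inner x v w)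
      (SkewTorsion.stab g τ x))
    (hfactor : ¬ SkewTorsion.HasLocalOneDimFactor g τ) :
    ∃ (c : ℝ) (hc : 0 < c),
      (∀ p : M, ∃ U : Set M, IsOpen U ∧ p ∈ U ∧
        SkewTorsion.IsSasakianOn (SkewTorsion.rescale g c hc.ne') (fun x => c ^ 2 • τ x) U) ∧
      (SkewTorsion.VerticalIsTrivial g τ →
        SkewTorsion.IsSasakianOn (SkewTorsion.rescale g c hc.ne') (fun x => c ^ 2 • τ x)
          Set.univ) := by
  rcases exists_forall_isVerticalAt hτ hirr with ⟨β, hβ, h⟩ | ⟨μ, hμ, hn3, h⟩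
  · exact (hfactor (hasLocalOneDimFactor hτ hβ h)).elim
  have hvert : ∀ x : M, ∃ ζ, IsVerticalAt g hτ.threeForm x ((n - 1 : ℝ) * μ) (2 * μ) ζ :=
    fun x => (h x).imp fun _ hζ => hζ.2
  -- The eigenvalues agree only for `n = 3`; their difference is what separates the vertical line
  -- from its complement.
  have hab : (n - 1 : ℝ) * μ ≠ 2 * μ := fun hab => hn3 (by
    have h1 := mul_right_cancel₀ hμ.ne' hab
    have h2 : (n : ℝ) = 3 := by linarith
    exact_mod_cast h2)
  have hc : 0 < Real.sqrt μ := Real.sqrt_pos.mpr hμ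
  refine ⟨Real.sqrt μ, hc, fun p => ?_, ?_⟩
  · obtain ⟨U, ξ, hU, hp, hξ, hunit, heig⟩ := exists_unit_eigenfield (n := n) hab hvert p
    exact ⟨U, hU, hp, isSasakianOn_of_unit hτ hab h hU hξ hunit heig hc (Real.sq_sqrt hμ.le)⟩
  · rintro ⟨Z, hZ, hZV⟩
    have hZ0 (x : M) : Z x ≠ 0 := (hZV x).1
    have hZe (x : M) : casimirAt g τ x (Z x) = ((n - 1 : ℝ) * μ) • Z x := by
      obtain ⟨-, Hor, hsplit⟩ := hZV x
      obtain ⟨ζ, hζ⟩ := hvert x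
      -- No uniqueness of the canonical splitting is needed: the line of `Z` is invariant, so the
      -- stabilizer kills `Z`, and the common kernel of the stabilizer is the vertical line.
      have h1 := TorsionSpace.apply_eq_zero_of_isInvariant_span
        (P := torsionSpace g hτ.threeForm x)
        (fun A hA => ((mem_stab_iff hτ.threeForm x A).mp hA).1)
        (TorsionSpace.IsCanonicalSplitting.isInvariant_right hsplit)
      rw [hζ.isVertical.eq_smul h1, map_smul, hζ.casimir_self, smul_comm]
    refine isSasakianOn_of_unit hτ hab h isOpen_univ (smoothOn_normalize hab hvert hZ hZ0 hZe)
      (fun x _ => inner_normalize (g.pos x (Z x) (hZ0 x)))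
      (fun x _ => by rw [map_smul, hZe, smul_comm]) hc (Real.sq_sqrt hμ.le)
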